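/- **Setting.** Let $d\ge 2$ and call *polytope* a nonempty connected subset of $\mathbb R^d$ that is the interior of a finite union of closed nondegenerate $d$-simplices. Let $\Omega\subset\mathbb R^d$ be a polytope. A *polytopal mesh* of $\Omega$ is a pair $(\mathcal T,\mathcal F)$ where: $\mathcal T$ is a finite set of pairwise disjoint polytopes (the elements) with $\overline\Omega=\bigcup_{T\in\mathcal T}\overline T$; $\mathcal F$ is a finite set of pairwise disjoint faces, a face being a nonempty connected relatively open subset $F$ of a hyperplane with $\mathcal H^{d-1}(\overline F\setminus F)=0$; each $F\in\mathcal F$ satisfies either $F\subset\partial T\cap\partial T'$ for two distinct elements $T,T'$, or $F\subset\partial T\cap\partial\Omega$ for some element $T$; and $\bigcup_{T\in\mathcal T}\partial T=\bigcup_{F\in\mathcal F}\overline F$. For $T\in\mathcal T$ set $\mathcal F_T=\{F\in\mathcal F: F\subset\partial T\}$, $h_T=\operatorname{diam}T$; each $F\in\mathcal F_T$ is assumed to have a constant unit normal $n_{TF}$ pointing out of $T$, and $n_{\partial T}|_F=n_{TF}$. The inner product $(f,g)_{\partial T}=\sum_{F\in\mathcal F_T}\int_F fg\,d\mathcal H^{d-1}$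 has norm $\|\cdot\|_{\partial T}$, and $(\cdot,\cdot)_T$ is the $L^2(T)$ inner product. For $\varrho>0$, the mesh is *regular with parameter $\varrho$* if every $X\in\mathcal T\cup\mathcal F$ is connected by star-shaped sets with parameter $\varrho$: $X=\bigcup_{i=1}^N X_i$ with $N\le\varrho^{-1}$, each $X_i$ is star-shaped with respect to all points of a ball of radius $\varrho\operatorname{diam}(X_i)$, and any two $X_i,X_j$ are joined by a path of such sets whose consecutive intersections contain balls of radius $\varrho\operatorname{diam}(X)$ (balls being taken in the affine hull of $X$). Let $k\ge 1$ and $l=k-1$, and take the diffusion tensor to be the identity. Let $\mathbb P^m(X)$ be the polynomials of degree $\le m$ on $X$, let $\mathbb P^k(\mathcal F_T)$ be the functions on $\partial T$ whose restriction to each $F\in\mathcal F_T$ lies in $\mathbb P^k(F)$, and let $\pi^{0,k}_{\partial T}$ be the projector acting on each $F\in\mathcal F_T$ as the $L^2(F)$-orthogonal projector onto $\mathbb P^k(F)$. The local space is $\underline U_T^{k,l}=\mathbb P^{l}(T)\times\mathbb P^k(\mathcal F_T)$. For $\underline v_T=(v_T,v_{\partial T})\in\underline U_T^{k,l}$, the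 potential reconstruction $p_T^{k+1}\underline v_T\in\mathbb P^{k+1}(T)$ is defined by $$(\nabla p_T^{k+1}\underline v_T,\nabla w)_T=-(v_T,\Delta w)_T+(v_{\partial T},\nabla w\cdot n_{\partial T})_{\partial T}\quad\forall w\in\mathbb P^{k+1}(T),\qquad (v_T-p_T^{k+1}\underline v_T,1)_T=0.$$ Set $$|\underline v_T|_{1,\partial T}=h_T^{-1/2}\|v_{\partial T}-v_T\|_{\partial T},\qquad \delta_{\partial T}^k\underline v_T=\pi_{\partial T}^{0,k}(p_T^{k+1}\underline v_T-v_{\partial T}),$$ $$s_T^{(k-1)}(\underline u_T,\underline v_T)=h_T^{-1}(\delta^k_{\partial T}\underline u_T,\delta^k_{\partial T}\underline v_T)_{\partial T},\qquad a_T(\underline u_T,\underline v_T)=(\nabla p_T^{k+1}\underline u_T,\nabla p_T^{k+1}\underline v_T)_T+s_T^{(k-1)}(\underline u_T,\underline v_T).$$ **Lemma (Coercivity of $s_T^{(k-1)}$).** There is a constant $C>0$ depending only on $\Omega$, $d$, $\varrho$, $k$ and $l=k-1$ such that, for every polytopal mesh of $\Omega$ that is regular with parameter $\varrho$, every element $T$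 of this mesh and every $\underline v_T\in\underline U_T^{k,l}$, $$|\underline v_T|_{1,\partial T}^2\le C\,a_T(\underline v_T,\underline v_T).$$ -/

import Mathlib

open MeasureTheory Filter Topology
open scoped Gradient RealInnerProductSpace

noncomputable section

namespace HHO

/-- The ambient Euclidean space `ℝ^d`. -/
abbrev Space (d : ℕ) : Type := EuclideanSpace ℝ (Fin d)

/-! ### Polytopes, faces, meshes -/

/-- A (full-dimensional, open) polytope of `ℝ^d`: a nonempty connected set that is the interior of
a finite union of closed nondegenerate `d`-simplices. -/
def IsPolytope {d : ℕ} (X : Set (Space d)) : Prop :=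
  IsConnected X ∧
    ∃ S : Finset (Affine.Simplex ℝ (Space d) d), X = interior (⋃ s ∈ S, s.closedInterior)

/-- A flat face: a nonempty, relatively open, connected subset `F` of a hyperplane
`{x | ⟪n, x⟫ = c}` whose relative boundary has zero `(d-1)`-dimensional measure. -/
def IsFlatFace {d : ℕ} (F : Set (Space d)) : Prop :=
  (∃ (n : Space d) (c : ℝ) (U : Set (Space d)), ‖n‖ = 1 ∧ IsOpen U ∧ F = U ∩ {x | ⟪n, x⟫ = c}) ∧
    IsConnected F ∧ μHE[d - 1] (closure F \ F) = 0

/-- `n` is the constant unit normal to the face `F` pointing out of `T`: it is orthogonal to `F`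
and, starting from almost every point of `F`, one enters `T` along `-n` and leaves `T` along `n`. -/
def IsOuterUnitNormal {d : ℕ} (T F : Set (Space d)) (n : Space d) : Prop :=
  ‖n‖ = 1 ∧ (∃ c : ℝ, ∀ x ∈ F, ⟪n, x⟫ = c) ∧
    ∀ᵐ x ∂(μHE[d - 1].restrict F), ∀ᶠ t : ℝ in 𝓝[>] 0, x - t • n ∈ T ∧ x + t • n ∉ T

/-- A polytopal mesh of `Ω`. The `normal` field records the constant outer unit normals `n_{TF}`. -/
structure PolytopalMesh {d : ℕ} (Ω : Set (Space d)) where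
  /-- the mesh elements -/
  elements : Finset (Set (Space d))
  /-- the mesh faces -/
  faces : Finset (Set (Space d))
  /-- `normal T F` is the unit normal to `F` pointing out of `T` -/
  normal : Set (Space d) → Set (Space d) → Space d
  isPolytope_of_mem : ∀ T ∈ elements, IsPolytope T
  elements_disjoint : ∀ T ∈ elements, ∀ T' ∈ elements, T ≠ T' → Disjoint T T'
  closure_domain : closure Ω = ⋃ T ∈ elements, closure T
  isFlatFace_of_mem : ∀ F ∈ faces, IsFlatFace F
  faces_disjoint : ∀ F ∈ faces, ∀ F' ∈ faces, F ≠ F' → Disjoint F F'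
  interface_or_boundary : ∀ F ∈ faces,
    (∃ T ∈ elements, ∃ T' ∈ elements, T ≠ T' ∧ F ⊆ frontier T ∩ frontier T') ∨
      ∃ T ∈ elements, F ⊆ frontier T ∩ frontier Ω
  skeleton : ⋃ T ∈ elements, frontier T = ⋃ F ∈ faces, closure F
  isOuterUnitNormal : ∀ T ∈ elements, ∀ F ∈ faces, F ⊆ frontier T →
    IsOuterUnitNormal T F (normal T F)

/-- `X` (an element or a face) is connected by star-shaped sets with parameter `ϱ`: it is the union
of at most `ϱ⁻¹` sets `Y i`, each star-shaped with respect to every point of a ball of radius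
`ϱ * diam (Y i)`, and any two of them are joined by a path of sets whose consecutive
intersections contain balls of radius `ϱ * diam X`. Balls are balls of the affine hull of `X`
(the whole space for an element, a hyperplane for a face). -/
def ConnectedByStarShapedSets {d : ℕ} (ϱ : ℝ) (X : Set (Space d)) : Prop :=
  ∃ (N : ℕ) (Y : Fin N → Set (Space d)), (N : ℝ) ≤ ϱ⁻¹ ∧ X = ⋃ i, Y i ∧
    (∀ i, ∃ x ∈ affineSpan ℝ X,
      ∀ y ∈ Metric.ball x (ϱ * Metric.diam (Y i)) ∩ affineSpan ℝ X, StarConvex ℝ y (Y i)) ∧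
    ∀ i j, Relation.ReflTransGen
      (fun a b : Fin N => ∃ x ∈ affineSpan ℝ X,
        Metric.ball x (ϱ * Metric.diam X) ∩ affineSpan ℝ X ⊆ Y a ∩ Y b) i j

/-- Regularity of a mesh with parameter `ϱ`: every element and every face is connected by
star-shaped sets with parameter `ϱ`. -/
def PolytopalMesh.IsRegular {d : ℕ} {Ω : Set (Space d)} (M : PolytopalMesh Ω) (ϱ : ℝ) : Prop :=
  (∀ T ∈ M.elements, ConnectedByStarShapedSets ϱ T) ∧
    ∀ F ∈ M.faces, ConnectedByStarShapedSets ϱ F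

open Classical in
/-- The set `F_T` of faces of the element `T`. -/
def PolytopalMesh.facesOf {d : ℕ} {Ω : Set (Space d)} (M : PolytopalMesh Ω)
    (T : Set (Space d)) : Finset (Set (Space d)) :=
  M.faces.filter (fun F => F ⊆ frontier T)

/-! ### Polynomial spaces and projectors -/

/-- Polynomial functions on `ℝ^d` of total degree at most `m`. Elements of `P^m(X)` are the
restrictions to `X` of these functions. -/
def polySpace (d m : ℕ) : Submodule ℝ (Space d → ℝ) :=
  (MvPolynomial.restrictTotalDegree (Fin d) ℝ m).map
    (LinearMap.pi fun x : Space d => (MvPolynomial.aeval fun i => x i).toLinearMap)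

/-- `g` is the `L²`-orthogonal projection, for the measure `μ`, of `f` on the polynomials of degree
at most `m`. -/
def IsL2Projection {d : ℕ} (μ : Measure (Space d)) (m : ℕ) (f g : Space d → ℝ) : Prop :=
  g ∈ polySpace d m ∧ ∀ w ∈ polySpace d m, ∫ x, g x * w x ∂μ = ∫ x, f x * w x ∂μ

/-- The `L²`-orthogonal projector `π_F^{0,m}` on `P^m(F)` of a face `F`. -/
def faceProjection {d : ℕ} (F : Set (Space d)) (m : ℕ) (f : Space d → ℝ) : Space d → ℝ :=
  Classical.epsilon (IsL2Projection (μHE[d - 1].restrict F) m f)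

namespace PolytopalMesh

variable {d : ℕ} {Ω : Set (Space d)}

/-- The inner product `(f, g)_{∂T}` of `L²(∂T)`. -/
def bdryInner (M : PolytopalMesh Ω) (T : Set (Space d)) (f g : Space d → ℝ) : ℝ :=
  ∑ F ∈ M.facesOf T, ∫ x in F, f x * g x ∂μHE[d - 1]

/-- The norm of `L²(∂T)`. -/
def bdryNorm (M : PolytopalMesh Ω) (T : Set (Space d)) (f : Space d → ℝ) : ℝ :=
  √(M.bdryInner T f f)

/-- `P^k(F_T)`: functions on `∂T` that are polynomial of degree at most `k` on each face of `T`. -/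
def bdryPolySpace (M : PolytopalMesh Ω) (T : Set (Space d)) (k : ℕ) :
    Submodule ℝ (Space d → ℝ) where
  carrier := {v | ∀ F ∈ M.facesOf T, ∃ q ∈ polySpace d k, Set.EqOn v q F}
  add_mem' := by
    intro a b ha hb F hF
    obtain ⟨p, hp, hap⟩ := ha F hF
    obtain ⟨q, hq, hbq⟩ := hb F hF
    exact ⟨p + q, add_mem hp hq, fun x hx => by simp [hap hx, hbq hx]⟩
  zero_mem' := fun F _ => ⟨0, zero_mem _, fun _ _ => rfl⟩
  smul_mem' := by
    intro c a ha F hF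
    obtain ⟨p, hp, hap⟩ := ha F hF
    exact ⟨c • p, Submodule.smul_mem _ c hp, fun x hx => by simp [hap hx]⟩

/-- The projector `π_{∂T}^{0,k}`, which coincides with `π_F^{0,k}` on each face `F` of `T`. -/
def bdryProjection (M : PolytopalMesh Ω) (T : Set (Space d)) (k : ℕ) (f : Space d → ℝ) :
    Space d → ℝ :=
  fun x => ∑ F ∈ M.facesOf T, F.indicator (faceProjection F k f) x

/-! ### Local space of unknowns, reconstruction, bilinear forms (diffusion tensor `I`) -/

/-- The local space `U_T^{k,l} = P^l(T) × P^k(F_T)`; its elements are pairs `(v_T, v_{∂T})`. -/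
def localSpace (M : PolytopalMesh Ω) (T : Set (Space d)) (k l : ℕ) :
    Submodule ℝ ((Space d → ℝ) × (Space d → ℝ)) :=
  (polySpace d l).prod (M.bdryPolySpace T k)

/-- The seminorm `|v|_{1,∂T} = h_T^{-1/2} ‖v_{∂T} - v_T‖_{∂T}`. -/
def localSeminorm (M : PolytopalMesh Ω) (T : Set (Space d))
    (v : (Space d → ℝ) × (Space d → ℝ)) : ℝ :=
  (Metric.diam T) ^ (-(1 / 2) : ℝ) * M.bdryNorm T (v.2 - v.1)

/-- The variational problem defining the potential reconstruction: `p` is a polynomial of degree at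
most `k + 1` with
`(∇p, ∇w)_T = -(v_T, Δw)_T + (v_{∂T}, ∇w · n_{∂T})_{∂T}` for all `w ∈ P^{k+1}(T)`, and
`(v_T - p, 1)_T = 0`. -/
def IsPotentialReconstruction (M : PolytopalMesh Ω) (T : Set (Space d)) (k : ℕ)
    (v : (Space d → ℝ) × (Space d → ℝ)) (p : Space d → ℝ) : Prop :=
  p ∈ polySpace d (k + 1) ∧
    (∀ w ∈ polySpace d (k + 1),
      ∫ x in T, ⟪∇ p x, ∇ w x⟫ =
        -(∫ x in T, v.1 x * Laplacian.laplacian w x) +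
          ∑ F ∈ M.facesOf T, ∫ x in F, v.2 x * ⟪∇ w x, M.normal T F⟫ ∂μHE[d - 1]) ∧
    ∫ x in T, (v.1 x - p x) = 0

/-- The potential reconstruction `p_T^{k+1}`. -/
def potentialReconstruction (M : PolytopalMesh Ω) (T : Set (Space d)) (k : ℕ)
    (v : (Space d → ℝ) × (Space d → ℝ)) : Space d → ℝ :=
  Classical.epsilon (M.IsPotentialReconstruction T k v)

/-- The boundary difference operator `δ_{∂T}^k v = π_{∂T}^{0,k} (p_T^{k+1} v - v_{∂T})`. -/
def bdryDifference (M : PolytopalMesh Ω) (T : Set (Space d)) (k : ℕ)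
    (v : (Space d → ℝ) × (Space d → ℝ)) : Space d → ℝ :=
  M.bdryProjection T k (M.potentialReconstruction T k v - v.2)

/-- The pure boundary stabilisation `s_T(u, v) = h_T⁻¹ (δ_{∂T}^k u, δ_{∂T}^k v)_{∂T}`. -/
def bdryStabilisation (M : PolytopalMesh Ω) (T : Set (Space d)) (k : ℕ)
    (u v : (Space d → ℝ) × (Space d → ℝ)) : ℝ :=
  (Metric.diam T)⁻¹ * M.bdryInner T (M.bdryDifference T k u) (M.bdryDifference T k v)

/-- The local bilinear form `a_T(u, v) = (∇ p_T^{k+1} u, ∇ p_T^{k+1} v)_T + s(u, v)` associated with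
a stabilisation `s`. -/
def localForm (M : PolytopalMesh Ω) (T : Set (Space d)) (k : ℕ)
    (s : (Space d → ℝ) × (Space d → ℝ) → (Space d → ℝ) × (Space d → ℝ) → ℝ)
    (u v : (Space d → ℝ) × (Space d → ℝ)) : ℝ :=
  (∫ x in T, ⟪∇ (M.potentialReconstruction T k u) x, ∇ (M.potentialReconstruction T k v) x⟫) +
    s u v

end PolytopalMesh

end HHO

/-! ### Well-posedness of the projector and of the potential reconstruction -/

namespace HHO

theorem polySpace_contDiff {d m : ℕ} {p : Space d → ℝ} (hp : p ∈ polySpace d m) {n : WithTop ℕ∞} :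
    ContDiff ℝ n p := by
  obtain ⟨q, -, rfl⟩ := hp
  change ContDiff ℝ n (fun x : Space d => MvPolynomial.aeval (fun i => x i) q)
  induction q using MvPolynomial.induction_on with
  | C a => simpa using contDiff_const
  | add p q hp hq => simpa using hp.add hq
  | mul_X p i hp =>
    simp only [map_mul, MvPolynomial.aeval_X]
    exact hp.mul (by fun_prop)

instance (d m : ℕ) : FiniteDimensional ℝ (polySpace d m) := by
  unfold polySpace; infer_instance

theorem const_mem_polySpace (d m : ℕ) (c : ℝ) : (fun _ => c) ∈ polySpace d m := by
  refine ⟨MvPolynomial.C c, ?_, ?_⟩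
  · rw [SetLike.mem_coe, MvPolynomial.mem_restrictTotalDegree]; simp
  · ext x; simp

theorem exists_of_psd {V : Type*} [AddCommGroup V] [Module ℝ V] [FiniteDimensional ℝ V]
    (B : V →ₗ[ℝ] V →ₗ[ℝ] ℝ) (hs : ∀ x y, B x y = B y x) (L : V →ₗ[ℝ] ℝ)
    (h : ∀ v, B v v = 0 → L v = 0) : ∃ p, ∀ w, B p w = L w := by
  have h1 : L ∈ (LinearMap.ker B).dualAnnihilator := by
    rw [Submodule.mem_dualAnnihilator]
    intro v hv
    refine h v ?_
    rw [LinearMap.mem_ker] at hv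
    rw [hv]; rfl
  rw [← LinearMap.range_dualMap_eq_dualAnnihilator_ker] at h1
  obtain ⟨φ, hφ⟩ := h1
  obtain ⟨p, hp⟩ := (Module.evalEquiv ℝ V).surjective φ
  refine ⟨p, fun w => ?_⟩
  rw [← hφ, ← hp, hs]
  rfl

theorem integrable_of_poly {X : Type*} [PseudoMetricSpace X] [ProperSpace X] [MeasurableSpace X] [BorelSpace X]
    {μ : Measure X} {A : Set X} (hA : Bornology.IsBounded A) (hm : MeasurableSet A)
    (hμ : μ A ≠ ⊤) {f : X → ℝ} (hf : Continuous f) : IntegrableOn f A μ := by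
  obtain ⟨C, hC⟩ := (hA.isCompact_closure.image hf).isBounded.exists_norm_le
  refine Measure.integrableOn_of_bounded (M := C) hμ hf.aestronglyMeasurable ?_
  refine (ae_restrict_iff' hm).2 (Eventually.of_forall fun x hx => hC _ ⟨x, subset_closure hx, rfl⟩)

theorem IsPolytope.isOpen {d : ℕ} {T : Set (Space d)} (h : IsPolytope T) : IsOpen T := by
  obtain ⟨-, S, rfl⟩ := h
  exact isOpen_interior

theorem IsPolytope.isBounded {d : ℕ} {T : Set (Space d)} (h : IsPolytope T) :
    Bornology.IsBounded T := by
  obtain ⟨-, S, rfl⟩ := h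
  refine Bornology.IsBounded.subset ?_ interior_subset
  exact (Bornology.isBounded_biUnion_finset S).2 fun s _ => s.isCompact_closedInterior.isBounded

theorem IsFlatFace.measurableSet {d : ℕ} {F : Set (Space d)} (h : IsFlatFace F) :
    MeasurableSet F := by
  obtain ⟨⟨n, c, U, -, hU, rfl⟩, -⟩ := h
  exact hU.measurableSet.inter (isClosed_eq (by fun_prop) continuous_const).measurableSet

theorem IsFlatFace.measure_ne_top {d : ℕ} {F : Set (Space d)} (h : IsFlatFace F)
    (hb : Bornology.IsBounded F) : μHE[d - 1] F ≠ ⊤ := by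
  obtain ⟨⟨n, c, U, hn, hU, hF⟩, -⟩ := h
  have hn0 : n ≠ 0 := by rintro rfl; simp at hn
  set V : Submodule ℝ (Space d) := (ℝ ∙ n)ᗮ
  have hrank : Module.finrank ℝ V = d - 1 := by
    have h1 := (ℝ ∙ n).finrank_add_finrank_orthogonal
    rw [finrank_span_singleton hn0, finrank_euclideanSpace_fin] at h1
    change 1 + Module.finrank ℝ V = d at h1
    omega
  have hiso : Isometry (fun v : V => c • n + (v : Space d)) :=
    (IsometryEquiv.addLeft (c • n)).isometry.comp isometry_subtype_coe
  have hr : F ⊆ Set.range (fun v : V => c • n + (v : Space d)) := by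
    intro x hx
    rw [hF] at hx
    have hx2 : ⟪n, x⟫ = c := hx.2
    refine ⟨⟨x - c • n, ?_⟩, by simp⟩
    rw [Submodule.mem_orthogonal_singleton_iff_inner_right, inner_sub_right, inner_smul_right,
      real_inner_self_eq_norm_sq, hn, hx2]
    simp
  have e : μHE[d - 1] F = volume ((fun v : V => c • n + (v : Space d)) ⁻¹' F) := by
    rw [← InnerProductSpace.euclideanHausdorffMeasure_eq_volume, hrank,
      hiso.euclideanHausdorffMeasure_preimage, Set.inter_eq_left.2 hr]
  rw [e]
  exact (hiso.antilipschitz.isBounded_preimage hb).measure_lt_top.ne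

theorem exists_isL2Projection {d : ℕ} {F : Set (Space d)} (hF : IsFlatFace F)
    (hb : Bornology.IsBounded F) (m m' : ℕ) {f q : Space d → ℝ} (hq : q ∈ polySpace d m')
    (hfq : Set.EqOn f q F) : ∃ g, IsL2Projection (μHE[d - 1].restrict F) m f g := by
  have hm := hF.measurableSet
  have hfin := hF.measure_ne_top hb
  have hI : ∀ {f : Space d → ℝ}, Continuous f → Integrable f (μHE[d - 1].restrict F) :=
    fun hf => integrable_of_poly hb hm hfin hf
  have hc : ∀ w : polySpace d m, Continuous (w : Space d → ℝ) :=
    fun w => (polySpace_contDiff w.2 (n := 0)).continuous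
  have hqc : Continuous q := (polySpace_contDiff hq (n := 0)).continuous
  let B : polySpace d m →ₗ[ℝ] polySpace d m →ₗ[ℝ] ℝ := LinearMap.mk₂ ℝ
    (fun p w => ∫ x in F, p.1 x * w.1 x ∂μHE[d - 1])
    (fun p p' w => by
      rw [← integral_add (hI ((hc p).fun_mul (hc w))) (hI ((hc p').fun_mul (hc w)))]
      simp [add_mul])
    (fun a p w => by rw [smul_eq_mul, ← integral_const_mul]; simp [mul_assoc])
    (fun p w w' => by
      rw [← integral_add (hI ((hc p).fun_mul (hc w))) (hI ((hc p).fun_mul (hc w')))]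
      simp [mul_add])
    (fun a p w => by rw [smul_eq_mul, ← integral_const_mul]; simp [mul_left_comm])
  let L : polySpace d m →ₗ[ℝ] ℝ :=
    { toFun := fun w => ∫ x in F, q x * w.1 x ∂μHE[d - 1]
      map_add' := fun w w' => by
        rw [← integral_add (hI (hqc.fun_mul (hc w))) (hI (hqc.fun_mul (hc w')))]
        simp [mul_add]
      map_smul' := fun a w => by
        rw [RingHom.id_apply, smul_eq_mul, ← integral_const_mul]; simp [mul_left_comm] }
  obtain ⟨p, hp⟩ := exists_of_psd B
    (fun x y => by simp only [B, LinearMap.mk₂_apply, mul_comm]) L (by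
      intro v hv
      have hv' : ∫ x in F, v.1 x * v.1 x ∂μHE[d - 1] = 0 := hv
      rw [integral_eq_zero_iff_of_nonneg (fun x => mul_self_nonneg _)
        (hI ((hc v).fun_mul (hc v)))] at hv'
      change ∫ x in F, q x * v.1 x ∂μHE[d - 1] = 0
      refine integral_eq_zero_of_ae ?_
      filter_upwards [hv'] with x hx
      have : v.1 x = 0 := mul_self_eq_zero.1 hx
      simp [this])
  refine ⟨p.1, p.2, fun w hw => (hp ⟨w, hw⟩).trans ?_⟩
  refine setIntegral_congr_fun hm fun x hx => ?_
  simp [hfq hx]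

namespace PolytopalMesh

variable {d : ℕ} {Ω : Set (Space d)}

theorem isBounded_face (M : PolytopalMesh Ω) {T F : Set (Space d)} (hT : T ∈ M.elements)
    (hF : F ∈ M.facesOf T) : IsFlatFace F ∧ Bornology.IsBounded F := by
  classical
  rw [facesOf, Finset.mem_filter] at hF
  exact ⟨M.isFlatFace_of_mem F hF.1,
    ((M.isPolytope_of_mem T hT).isBounded.closure).subset (hF.2.trans frontier_subset_closure)⟩

theorem exists_isPotentialReconstruction (M : PolytopalMesh Ω) {T : Set (Space d)}
    (hT : T ∈ M.elements) (k l : ℕ) {v : (Space d → ℝ) × (Space d → ℝ)}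
    (hv : v ∈ M.localSpace T k l) : ∃ p, M.IsPotentialReconstruction T k v p := by
  have hpoly := M.isPolytope_of_mem T hT
  have hTfin : volume T ≠ ⊤ := hpoly.isBounded.measure_lt_top.ne
  have hTm := hpoly.isOpen.measurableSet
  have hI : ∀ {f : Space d → ℝ}, Continuous f → Integrable f (volume.restrict T) :=
    fun hf => integrable_of_poly hpoly.isBounded hTm hTfin hf
  have hIF : ∀ {F}, F ∈ M.facesOf T → ∀ {f : Space d → ℝ}, Continuous f →
      Integrable (fun x => v.2 x * f x) (μHE[d - 1].restrict F) := by
    intro F hF f hf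
    obtain ⟨h1, h2⟩ := M.isBounded_face hT hF
    obtain ⟨q, hq, hvq⟩ := hv.2 F hF
    have h3 : IntegrableOn (fun x => q x * f x) F μHE[d - 1] :=
      integrable_of_poly h2 h1.measurableSet (h1.measure_ne_top h2)
        ((polySpace_contDiff hq (n := 0)).continuous.mul hf)
    exact h3.congr_fun (fun x hx => by simp [hvq hx]) h1.measurableSet
  have hd : ∀ w : polySpace d (k + 1), ContDiff ℝ 2 (w : Space d → ℝ) :=
    fun w => polySpace_contDiff w.2
  have hdf : ∀ (w : polySpace d (k + 1)) (x), DifferentiableAt ℝ (w : Space d → ℝ) x :=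
    fun w x => ((hd w).differentiable (by norm_num)).differentiableAt
  have hg : ∀ w : polySpace d (k + 1), Continuous (∇ (w : Space d → ℝ)) := fun w =>
    (InnerProductSpace.toDual ℝ (Space d)).symm.continuous.comp
      ((hd w).continuous_fderiv (by norm_num))
  have hl : ∀ w : polySpace d (k + 1), Continuous (Laplacian.laplacian (w : Space d → ℝ)) := by
    intro w
    rw [InnerProductSpace.laplacian_eq_iteratedFDeriv_stdOrthonormalBasis]
    refine continuous_finsetSum _ fun i _ => ?_
    have := (hd w).continuous_iteratedFDeriv (m := 2) (by norm_num)
    fun_prop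
  have gadd : ∀ (w w' : polySpace d (k + 1)) x,
      ∇ ((w + w' : polySpace d (k + 1)) : Space d → ℝ) x = ∇ (w : Space d → ℝ) x + ∇ (w' : Space d → ℝ) x := by
    intro w w' x
    simp only [gradient, Submodule.coe_add]
    rw [fderiv_add (hdf w x) (hdf w' x), map_add]
  have gsmul : ∀ (a : ℝ) (w : polySpace d (k + 1)) x,
      ∇ ((a • w : polySpace d (k + 1)) : Space d → ℝ) x = a • ∇ (w : Space d → ℝ) x := by
    intro a w x
    simp only [gradient, Submodule.coe_smul]
    rw [fderiv_const_smul (hdf w x)]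
    simp
  have ladd : ∀ (w w' : polySpace d (k + 1)) x,
      Laplacian.laplacian ((w + w' : polySpace d (k + 1)) : Space d → ℝ) x =
        Laplacian.laplacian (w : Space d → ℝ) x + Laplacian.laplacian (w' : Space d → ℝ) x :=
    fun w w' x => (hd w).contDiffAt.laplacian_add (hd w').contDiffAt
  have lsmul : ∀ (a : ℝ) (w : polySpace d (k + 1)) x,
      Laplacian.laplacian ((a • w : polySpace d (k + 1)) : Space d → ℝ) x =
        a * Laplacian.laplacian (w : Space d → ℝ) x :=
    fun a w x => InnerProductSpace.laplacian_smul a (hd w).contDiffAt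
  have hv1 : Continuous v.1 := (polySpace_contDiff hv.1 (n := 0)).continuous
  let B : polySpace d (k + 1) →ₗ[ℝ] polySpace d (k + 1) →ₗ[ℝ] ℝ := LinearMap.mk₂ ℝ
    (fun p w => ∫ x in T, ⟪∇ p.1 x, ∇ w.1 x⟫)
    (fun p p' w => by
      rw [← integral_add (hI ((hg p).inner (hg w))) (hI ((hg p').inner (hg w)))]
      simp only [gadd, inner_add_left])
    (fun a p w => by
      rw [smul_eq_mul, ← integral_const_mul]; simp only [gsmul, real_inner_smul_left])
    (fun p w w' => by
      rw [← integral_add (hI ((hg p).inner (hg w))) (hI ((hg p).inner (hg w')))]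
      simp only [gadd, inner_add_right])
    (fun a p w => by
      rw [smul_eq_mul, ← integral_const_mul]; simp only [gsmul, real_inner_smul_right])
  let L : polySpace d (k + 1) →ₗ[ℝ] ℝ :=
    { toFun := fun w => -(∫ x in T, v.1 x * Laplacian.laplacian w.1 x) +
          ∑ F ∈ M.facesOf T, ∫ x in F, v.2 x * ⟪∇ w.1 x, M.normal T F⟫ ∂μHE[d - 1]
      map_add' := fun w w' => by
        have e1 : ∫ x in T, v.1 x * Laplacian.laplacian (w + w').1 x =
            (∫ x in T, v.1 x * Laplacian.laplacian w.1 x) +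
              ∫ x in T, v.1 x * Laplacian.laplacian w'.1 x := by
          rw [← integral_add (hI (hv1.fun_mul (hl w))) (hI (hv1.fun_mul (hl w')))]
          simp only [ladd, mul_add]
        have e2 : ∑ F ∈ M.facesOf T, ∫ x in F, v.2 x * ⟪∇ (w + w').1 x, M.normal T F⟫ ∂μHE[d - 1]
            = (∑ F ∈ M.facesOf T, ∫ x in F, v.2 x * ⟪∇ w.1 x, M.normal T F⟫ ∂μHE[d - 1]) +
              ∑ F ∈ M.facesOf T, ∫ x in F, v.2 x * ⟪∇ w'.1 x, M.normal T F⟫ ∂μHE[d - 1] := by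
          rw [← Finset.sum_add_distrib]
          refine Finset.sum_congr rfl fun F hF => ?_
          rw [← integral_add (hIF hF ((hg w).inner continuous_const))
            (hIF hF ((hg w').inner continuous_const))]
          simp only [gadd, inner_add_left, mul_add]
        rw [e1, e2]; ring
      map_smul' := fun a w => by
        simp only [lsmul, gsmul, real_inner_smul_left, mul_left_comm _ a, integral_const_mul,
          ← Finset.mul_sum, RingHom.id_apply, smul_eq_mul]
        ring }
  obtain ⟨p, hp⟩ := exists_of_psd B
    (fun x y => by simp only [B, LinearMap.mk₂_apply, real_inner_comm]) L (by
      intro w hw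
      have hw' : ∫ x in T, ⟪∇ w.1 x, ∇ w.1 x⟫ = 0 := hw
      rw [integral_eq_zero_iff_of_nonneg (fun x => real_inner_self_nonneg)
        (hI ((hg w).inner (hg w)))] at hw'
      have h0 : Set.EqOn (∇ w.1) 0 T := by
        refine Measure.eqOn_open_of_ae_eq (μ := volume) ?_ hpoly.isOpen (hg w).continuousOn
          continuousOn_const
        filter_upwards [hw'] with x hx
        exact inner_self_eq_zero.1 hx
      have h1 : Set.EqOn (∇ w.1) 0 (closure T) := h0.closure (hg w) continuous_const
      have h2 : ∀ x ∈ T, Laplacian.laplacian w.1 x = 0 := by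
        intro x hx
        have hf : fderiv ℝ w.1 =ᶠ[𝓝 x] 0 := by
          filter_upwards [hpoly.isOpen.mem_nhds hx] with y hy
          have := h0 hy
          simpa [gradient] using this
        rw [InnerProductSpace.laplacian_eq_iteratedFDeriv_stdOrthonormalBasis]
        refine Finset.sum_eq_zero fun i _ => ?_
        rw [iteratedFDeriv_two_apply, hf.fderiv_eq]
        simp
      change -(∫ x in T, v.1 x * Laplacian.laplacian w.1 x) +
          ∑ F ∈ M.facesOf T, ∫ x in F, v.2 x * ⟪∇ w.1 x, M.normal T F⟫ ∂μHE[d - 1] = 0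
      have e1 : ∫ x in T, v.1 x * Laplacian.laplacian w.1 x = 0 :=
        setIntegral_eq_zero_of_forall_eq_zero fun x hx => by rw [h2 x hx, mul_zero]
      have e2 : ∀ F ∈ M.facesOf T,
          ∫ x in F, v.2 x * ⟪∇ w.1 x, M.normal T F⟫ ∂μHE[d - 1] = 0 := by
        intro F hF
        refine setIntegral_eq_zero_of_forall_eq_zero fun x hx => ?_
        have hFT : F ⊆ frontier T := by
          classical
          rw [facesOf, Finset.mem_filter] at hF
          exact hF.2
        rw [h1 (frontier_subset_closure (hFT hx))]
        simp
      rw [e1, Finset.sum_eq_zero e2]; simp)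
  have hTpos : volume.real T ≠ 0 := by
    rw [measureReal_def, ENNReal.toReal_ne_zero]
    exact ⟨(hpoly.isOpen.measure_pos volume hpoly.1.nonempty).ne', hTfin⟩
  set c : ℝ := (∫ x in T, (v.1 x - p.1 x)) / volume.real T with hcdef
  let cc : polySpace d (k + 1) := ⟨fun _ => c, const_mem_polySpace d (k + 1) c⟩
  have hcg : ∀ x, ∇ (p + cc).1 x = ∇ p.1 x := by
    intro x
    have hz : ∇ cc.1 x = 0 := gradient_fun_const x c
    rw [gadd, hz, add_zero]
  refine ⟨(p + cc).1, (p + cc).2, fun w hw => ?_, ?_⟩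
  · simp only [hcg]
    exact hp ⟨w, hw⟩
  · have hpc : Continuous p.1 := (polySpace_contDiff p.2 (n := 0)).continuous
    have : ∀ x, v.1 x - (p + cc).1 x = (v.1 x - p.1 x) - c := fun x => by
      simp [cc]; ring
    simp only [this]
    rw [integral_sub (hI (hv1.fun_sub hpc)) (hI continuous_const), setIntegral_const, smul_eq_mul,
      hcdef, mul_div_cancel₀ _ hTpos, sub_self]

/-- The potential reconstruction solves its defining variational problem. -/
theorem isPotentialReconstruction (M : PolytopalMesh Ω) {T : Set (Space d)}
    (hT : T ∈ M.elements) (k l : ℕ) {v : (Space d → ℝ) × (Space d → ℝ)}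
    (hv : v ∈ M.localSpace T k l) :
    M.IsPotentialReconstruction T k v (M.potentialReconstruction T k v) :=
  Classical.epsilon_spec (M.exists_isPotentialReconstruction hT k l hv)

/-- On each face of `T`, the projection entering `δ_{∂T}^k` satisfies its defining identity. -/
theorem isL2Projection_face (M : PolytopalMesh Ω) {T : Set (Space d)}
    (hT : T ∈ M.elements) (k l : ℕ) {v : (Space d → ℝ) × (Space d → ℝ)}
    (hv : v ∈ M.localSpace T k l) {F : Set (Space d)} (hF : F ∈ M.facesOf T) :
    IsL2Projection (μHE[d - 1].restrict F) k (M.potentialReconstruction T k v - v.2)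
      (faceProjection F k (M.potentialReconstruction T k v - v.2)) := by
  obtain ⟨h1, h2⟩ := M.isBounded_face hT hF
  obtain ⟨q, hq, hvq⟩ := hv.2 F hF
  have hle : polySpace d k ≤ polySpace d (k + 1) := by
    refine Submodule.map_mono fun p hp => ?_
    rw [MvPolynomial.mem_restrictTotalDegree] at hp ⊢
    omega
  have hp := (M.isPotentialReconstruction hT k l hv).1
  exact Classical.epsilon_spec (exists_isL2Projection h1 h2 k (k + 1)
    (sub_mem hp (hle hq)) fun x hx => by simp [hvq hx])

end PolytopalMesh

end HHO

end

/-! Write `p` for the reconstruction of `v`, `δ` for its boundary difference, `h` for the diameter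
of `T`. On a face, `v_T` is a polynomial of degree at most `k`, so `v_∂T - v_T` is the projection of
`p - v_T` minus `δ`. It therefore suffices to control `p - v_T` on the boundary and, by a discrete
trace inequality, in `L²(T)`, with a constant times `h²‖∇p‖² + h‖δ‖²`.

The heart of the matter is the identity `∫_T (p - v_T) Δw = Σ_F ∫_F δ ∇w·n` for `w` of degree at
most `k + 1` (`integral_sub_mul_laplacian`). It subtracts the definition of `p` from Green's
formula; the projector in `δ` is invisible because `∇w·n` has degree at most `k`. The Laplacian maps
polynomials of degree `k + 1` onto those of degree `k - 1 = l` (`exists_laplacian_eq`), so `w` may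
be chosen with `Δw = v_T - c`, where `c = p(x₀)`. After Young's inequality, `‖v_T - c‖²` is bounded
by `‖p - c‖²` and `h‖δ‖²` (`integral_reconstruction_sub_sq_le`), and a Poincaré inequality for
polynomials bounds `‖p - c‖` by `h‖∇p‖` (`integral_sub_sq_le`).

Uniform constants come from two consequences of regularity. An element contains a ball of radius `ϱ
h` and lies in the concentric closed ball of radius `h`
(`ConnectedByStarShapedSets.exists_ball_subset`), so finite-dimensional norm equivalences on fixed
balls transfer by scaling. Moreover the boundary has measure at most `K h^(d-1)`
(`exists_frontier_measure_le`), by radial projection of each star-shaped piece onto a cube. A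
supremum bound times this measure is the trace inequality.

Green's formula rests on a divergence theorem for possibly nonconvex elements, obtained by slicing
along coordinate axes (`setIntegral_fderiv_single_eq_sum`). Its geometric input is that, off a null
set, the boundary of `T` is covered by faces of `T` and `T` is locally a half-space there
(`PolytopalMesh.exists_null_set`). -/

namespace HHO

/-! ### Slicing the Euclidean space along a coordinate axis -/

/-- The point of `ℝ^(n+1)` with `i`-th coordinate `t` and remaining coordinates `y`. -/
def insertCoord {n : ℕ} (i : Fin (n + 1)) (t : ℝ) (y : Space n) : Space (n + 1) :=
  WithLp.toLp 2 (i.insertNth (α := fun _ => ℝ) t y.ofLp)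

/-- The point of `ℝ^n` obtained by deleting the `i`-th coordinate. -/
def deleteCoord {n : ℕ} (i : Fin (n + 1)) (x : Space (n + 1)) : Space n :=
  WithLp.toLp 2 (fun j => x (i.succAbove j))

section Slicing

variable {n : ℕ} (i : Fin (n + 1))

@[simp] theorem insertCoord_same (t : ℝ) (y : Space n) : insertCoord i t y i = t := by
  simp [insertCoord]

@[simp] theorem insertCoord_succAbove (t : ℝ) (y : Space n) (j : Fin n) :
    insertCoord i t y (i.succAbove j) = y j := by
  simp [insertCoord]

@[simp] theorem deleteCoord_apply (x : Space (n + 1)) (j : Fin n) :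
    deleteCoord i x j = x (i.succAbove j) := rfl

@[simp] theorem deleteCoord_insertCoord (t : ℝ) (y : Space n) :
    deleteCoord i (insertCoord i t y) = y := by
  ext j; simp

@[simp] theorem insertCoord_deleteCoord (x : Space (n + 1)) :
    insertCoord i (x i) (deleteCoord i x) = x := by
  ext j
  refine Fin.succAboveCases i ?_ (fun j => ?_) j <;> simp

theorem insertCoord_eq_add (t : ℝ) (y : Space n) :
    insertCoord i t y = insertCoord i 0 y + t • EuclideanSpace.single i (1 : ℝ) := by
  ext j
  refine Fin.succAboveCases i ?_ (fun j => ?_) j <;> simp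

theorem inner_eq_coord (x y : Space (n + 1)) :
    ⟪x, y⟫ = x i * y i + ∑ j, x (i.succAbove j) * y (i.succAbove j) := by
  rw [PiLp.inner_apply, Fin.sum_univ_succAbove _ i]
  simp [mul_comm]

theorem inner_insertCoord (x : Space (n + 1)) (t : ℝ) (y : Space n) :
    ⟪x, insertCoord i t y⟫ = x i * t + ⟪deleteCoord i x, y⟫ := by
  rw [inner_eq_coord i, PiLp.inner_apply]
  simp [mul_comm]

theorem measurePreserving_insertCoord :
    ∃ e : (ℝ × Space n) ≃ᵐ Space (n + 1), (∀ p, e p = insertCoord i p.1 p.2) ∧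
      MeasurePreserving e (volume.prod volume) volume := by
  let e1 : (ℝ × Space n) ≃ᵐ (ℝ × (Fin n → ℝ)) :=
    (MeasurableEquiv.refl ℝ).prodCongr (MeasurableEquiv.toLp 2 (Fin n → ℝ)).symm
  let e2 := (MeasurableEquiv.piFinSuccAbove (fun _ : Fin (n + 1) => ℝ) i).symm
  let e3 := (MeasurableEquiv.toLp 2 (Fin (n + 1) → ℝ))
  refine ⟨e1.trans (e2.trans e3), fun p => rfl, ?_⟩
  have h1 : MeasurePreserving e1 (volume.prod volume) (volume.prod volume) :=
    (MeasurePreserving.id volume).prod (PiLp.volume_preserving_ofLp (Fin n))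
  have h2 : MeasurePreserving e2 (volume.prod volume) volume :=
    (volume_preserving_piFinSuccAbove (fun _ : Fin (n + 1) => ℝ) i).symm _
  have h3 : MeasurePreserving e3 volume volume := PiLp.volume_preserving_toLp (Fin (n + 1))
  exact (h1.trans h2).trans h3

/-- Fubini's theorem along the `i`-th axis. -/
theorem integral_eq_integral_insertCoord {f : Space (n + 1) → ℝ} (hf : Integrable f) :
    ∫ x, f x = ∫ y : Space n, ∫ t : ℝ, f (insertCoord i t y) := by
  obtain ⟨e, he, hm⟩ := measurePreserving_insertCoord i
  rw [← hm.integral_comp' f, integral_prod_symm]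
  · simp [he]
  · exact (hm.integrable_comp_emb e.measurableEmbedding).2 hf

theorem norm_deleteCoord_le (x : Space (n + 1)) : ‖deleteCoord i x‖ ≤ ‖x‖ := by
  rw [EuclideanSpace.norm_eq, EuclideanSpace.norm_eq, Fin.sum_univ_succAbove _ i]
  refine Real.sqrt_le_sqrt ?_
  simp only [deleteCoord_apply]
  nlinarith [sq_nonneg ‖x i‖]

theorem lipschitzWith_deleteCoord : LipschitzWith 1 (deleteCoord (n := n) i) := by
  refine LipschitzWith.of_dist_le_mul fun x y => ?_
  rw [dist_eq_norm, dist_eq_norm]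
  have : deleteCoord i x - deleteCoord i y = deleteCoord i (x - y) := by ext j; simp
  rw [this]
  simpa using norm_deleteCoord_le i (x - y)

end Slicing

/-! ### Hausdorff null sets under coordinate projection -/

theorem euclideanHausdorffMeasure_image_le {X Y : Type*} [MetricSpace X] [MeasurableSpace X]
    [BorelSpace X] [MetricSpace Y] [MeasurableSpace Y] [BorelSpace Y] {f : X → Y} {s : Set X}
    {K : NNReal} (hf : LipschitzOnWith K f s) (m : ℕ) :
    μHE[m] (f '' s) ≤ (K : ENNReal) ^ m * μHE[m] s := by
  have := hf.hausdorffMeasure_image_le (d := m) (by positivity)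
  rw [ENNReal.rpow_natCast] at this
  simp only [Measure.euclideanHausdorffMeasure_def, Measure.smul_apply]
  rw [ENNReal.smul_def, ENNReal.smul_def, smul_eq_mul, smul_eq_mul, mul_left_comm]
  gcongr

/-- Deleting a coordinate does not increase distances. Consequently almost every line parallel to
the axis avoids the exceptional part of the boundary. -/
theorem volume_deleteCoord_image_eq_zero {n : ℕ} (i : Fin (n + 1)) {Z : Set (Space (n + 1))}
    (hZ : μHE[n] Z = 0) : volume (deleteCoord i '' Z) = 0 := by
  have h := euclideanHausdorffMeasure_image_le ((lipschitzWith_deleteCoord i).lipschitzOnWith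
    (s := Z)) n
  rw [hZ, mul_zero, nonpos_iff_eq_zero] at h
  rwa [← EuclideanSpace.euclideanHausdorffMeasure_eq_volume]

/-! ### The Hausdorff measure of a hyperplane seen as a graph -/

/-- The parametrization over the coordinates other than `i` of the hyperplane
`{x | ⟪ν, x⟫ = c}`. -/
noncomputable def hyperplaneGraph {n : ℕ} (i : Fin (n + 1)) (ν : Space (n + 1)) (c : ℝ)
    (y : Space n) : Space (n + 1) :=
  insertCoord i ((c - ⟪deleteCoord i ν, y⟫) / ν i) y

section Graph

variable {n : ℕ} {i : Fin (n + 1)} {ν : Space (n + 1)}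

theorem inner_hyperplaneGraph (hi : ν i ≠ 0) (c : ℝ) (y : Space n) :
    ⟪ν, hyperplaneGraph i ν c y⟫ = c := by
  rw [hyperplaneGraph, inner_insertCoord]
  field_simp
  ring

theorem hyperplaneGraph_deleteCoord (hi : ν i ≠ 0) {c : ℝ} {x : Space (n + 1)}
    (hx : ⟪ν, x⟫ = c) : hyperplaneGraph i ν c (deleteCoord i x) = x := by
  have h : ⟪ν, x⟫ = ν i * x i + ⟪deleteCoord i ν, deleteCoord i x⟫ := by
    conv_lhs => rw [← insertCoord_deleteCoord i x, inner_insertCoord]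
  have : (c - ⟪deleteCoord i ν, deleteCoord i x⟫) / ν i = x i := by
    rw [div_eq_iff hi]; linarith
  rw [hyperplaneGraph, this, insertCoord_deleteCoord]

theorem hyperplaneGraph_injective (i : Fin (n + 1)) (ν : Space (n + 1)) (c : ℝ) :
    Function.Injective (hyperplaneGraph i ν c) := by
  intro y y' h
  have := congrArg (deleteCoord i) h
  simpa [hyperplaneGraph] using this

theorem continuous_insertCoord (i : Fin (n + 1)) :
    Continuous fun p : ℝ × Space n => insertCoord i p.1 p.2 := by
  unfold insertCoord
  refine (PiLp.continuous_toLp 2 _).comp ?_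
  refine continuous_pi fun j => ?_
  refine Fin.succAboveCases i ?_ (fun j => ?_) j
  · simpa using continuous_fst
  · simp only [Fin.insertNth_apply_succAbove]
    fun_prop

theorem continuous_hyperplaneGraph (i : Fin (n + 1)) (ν : Space (n + 1)) (c : ℝ) :
    Continuous (hyperplaneGraph i ν c) :=
  (continuous_insertCoord i).comp (by fun_prop : Continuous fun y : Space n =>
    (((c - ⟪deleteCoord i ν, y⟫) / ν i, y) : ℝ × Space n))

theorem measurableEmbedding_hyperplaneGraph (i : Fin (n + 1)) (ν : Space (n + 1)) (c : ℝ) :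
    MeasurableEmbedding (hyperplaneGraph i ν c) :=
  (continuous_hyperplaneGraph i ν c).measurableEmbedding (hyperplaneGraph_injective i ν c)

/-- Up to a translation the parametrization is linear, with Gram matrix `1 + a aᵀ` where `a_j = ν_j
/ ν_i`. Its determinant is `1 + |a|² = 1 / ν_i²` because `ν` is a unit vector, so the area factor is
`1 / |ν_i|`. -/
theorem euclideanHausdorffMeasure_hyperplaneGraph_image (hν : ‖ν‖ = 1) (hi : ν i ≠ 0) (c : ℝ)
    (A : Set (Space n)) :
    μHE[n] (hyperplaneGraph i ν c '' A) = ENNReal.ofReal |ν i|⁻¹ * volume A := by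
  let L : Space n →ₗ[ℝ] Space (n + 1) :=
    { toFun := hyperplaneGraph i ν 0
      map_add' := fun x y => by
        ext j
        refine Fin.succAboveCases i ?_ (fun j => ?_) j
        · simp [hyperplaneGraph, inner_add_right]; ring
        · simp [hyperplaneGraph]
      map_smul' := fun a x => by
        ext j
        refine Fin.succAboveCases i ?_ (fun j => ?_) j
        · simp [hyperplaneGraph, inner_smul_right]; ring
        · simp [hyperplaneGraph] }
  have hadd : ∀ y, hyperplaneGraph i ν c y = (c / ν i) • EuclideanSpace.single i (1 : ℝ) + L y := by
    intro y
    ext j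
    refine Fin.succAboveCases i ?_ (fun j => ?_) j
    · simp [hyperplaneGraph, L]; ring
    · simp [hyperplaneGraph, L]
  have himg : hyperplaneGraph i ν c '' A =
      (IsometryEquiv.addLeft ((c / ν i) • EuclideanSpace.single i (1 : ℝ))) '' (L '' A) := by
    rw [Set.image_image]
    exact Set.image_congr fun y _ => hadd y
  rw [himg, (IsometryEquiv.isometry _).euclideanHausdorffMeasure_image]
  have h1 := L.euclideanHausdorffMeasure_image_eq_normDet_mul_volume A
  rw [finrank_euclideanSpace_fin] at h1
  rw [h1]
  congr 2
  have h2 := L.normDet_sq_eq_det_gram (EuclideanSpace.basisFun (Fin n) ℝ)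
  have h3 : Matrix.gram ℝ (fun j => L (EuclideanSpace.basisFun (Fin n) ℝ j)) =
      1 + Matrix.replicateCol Unit (fun j => ν (i.succAbove j) / ν i) *
        Matrix.replicateRow Unit (fun j => ν (i.succAbove j) / ν i) := by
    ext a b
    rw [Matrix.gram_apply, inner_eq_coord i]
    have e : ∀ a : Fin n, L (EuclideanSpace.basisFun (Fin n) ℝ a) i =
        - (ν (i.succAbove a) / ν i) := by
      intro a
      simp [L, hyperplaneGraph, PiLp.inner_apply, neg_div]
    have e' : ∀ a b : Fin n, L (EuclideanSpace.basisFun (Fin n) ℝ a) (i.succAbove b) =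
        if b = a then 1 else 0 := by
      intro a b
      simp [L, hyperplaneGraph]
    simp only [e, e']
    simp only [Matrix.add_apply, Matrix.mul_apply, Matrix.one_apply]
    simp [@eq_comm _ b]
    exact add_comm _ _
  have hnorm : ν i ^ 2 + ∑ j, ν (i.succAbove j) ^ 2 = 1 := by
    have := EuclideanSpace.norm_sq_eq ν
    rw [hν, Fin.sum_univ_succAbove _ i] at this
    simpa using this.symm
  have h4 : L.normDet ^ 2 = (|ν i|⁻¹) ^ 2 := by
    rw [h3, Matrix.det_one_add_replicateCol_mul_replicateRow] at h2
    have h2' : L.normDet ^ 2 =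
      1 + (fun j => ν (i.succAbove j) / ν i) ⬝ᵥ (fun j => ν (i.succAbove j) / ν i) := by
      simpa using h2
    rw [h2', inv_pow, sq_abs]
    simp only [dotProduct, div_mul_div_comm, ← Finset.sum_div]
    field_simp
    linarith
  exact (pow_left_inj₀ L.normDet_nonneg (by positivity) two_ne_zero).1 h4

theorem restrict_hyperplane_eq_map (hν : ‖ν‖ = 1) (hi : ν i ≠ 0) (c : ℝ) :
    (μHE[n] : Measure (Space (n + 1))).restrict {x | ⟪ν, x⟫ = c} =
      (ENNReal.ofReal |ν i|⁻¹ • volume).map (hyperplaneGraph i ν c) := by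
  ext A hA
  rw [(measurableEmbedding_hyperplaneGraph i ν c).map_apply, Measure.restrict_apply hA,
    Measure.smul_apply, smul_eq_mul, ← euclideanHausdorffMeasure_hyperplaneGraph_image hν hi c,
    Set.image_preimage_eq_inter_range]
  congr 2
  ext x
  constructor
  · exact fun hx => ⟨_, hyperplaneGraph_deleteCoord hi hx⟩
  · rintro ⟨y, rfl⟩
    exact inner_hyperplaneGraph hi c y

/-- Integration over a measurable subset of a hyperplane. -/
theorem setIntegral_hyperplane_eq (hν : ‖ν‖ = 1) (hi : ν i ≠ 0) (c : ℝ)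
    {F : Set (Space (n + 1))} (hF : MeasurableSet F) (hFc : ∀ x ∈ F, ⟪ν, x⟫ = c)
    (f : Space (n + 1) → ℝ) :
    ∫ x in F, f x ∂μHE[n] =
      |ν i|⁻¹ * ∫ y, F.indicator f (hyperplaneGraph i ν c y) := by
  have hFc' : F ⊆ {x | ⟪ν, x⟫ = c} := hFc
  have h1 : (μHE[n] : Measure (Space (n + 1))).restrict F =
      ((μHE[n] : Measure (Space (n + 1))).restrict {x | ⟪ν, x⟫ = c}).restrict F := by
    rw [Measure.restrict_restrict hF, Set.inter_eq_left.2 hFc']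
  rw [h1, restrict_hyperplane_eq_map hν hi c, ← integral_indicator hF,
    (measurableEmbedding_hyperplaneGraph i ν c).integral_map, integral_smul_measure,
    ENNReal.toReal_ofReal (by positivity), smul_eq_mul]

theorem integrable_hyperplaneGraph (hν : ‖ν‖ = 1) (hi : ν i ≠ 0) (c : ℝ)
    {F : Set (Space (n + 1))} (hF : MeasurableSet F) (hFc : ∀ x ∈ F, ⟪ν, x⟫ = c)
    {f : Space (n + 1) → ℝ} (hf : IntegrableOn f F μHE[n]) :
    Integrable fun y => F.indicator f (hyperplaneGraph i ν c y) := by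
  have hFc' : F ⊆ {x | ⟪ν, x⟫ = c} := hFc
  have h1 : (μHE[n] : Measure (Space (n + 1))).restrict F =
      ((μHE[n] : Measure (Space (n + 1))).restrict {x | ⟪ν, x⟫ = c}).restrict F := by
    rw [Measure.restrict_restrict hF, Set.inter_eq_left.2 hFc']
  rw [IntegrableOn, h1, restrict_hyperplane_eq_map hν hi c] at hf
  have h2 := (integrable_indicator_iff hF).2 hf
  rw [(measurableEmbedding_hyperplaneGraph i ν c).integrable_map_iff] at h2
  rwa [integrable_smul_measure (by simpa using hi) ENNReal.ofReal_ne_top] at h2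

/-- A face parallel to the slicing axis projects into such a hyperplane, hence is missed by almost
every line of the slicing. -/
theorem volume_hyperplane_eq_zero {n : ℕ} {ν : Space n} (hν : ν ≠ 0) (c : ℝ) :
    volume {x : Space n | ⟪ν, x⟫ = c} = 0 := by
  rcases Set.eq_empty_or_nonempty {x : Space n | ⟪ν, x⟫ = c} with h | ⟨x₀, hx₀⟩
  · rw [h, measure_empty]
  have : {x : Space n | ⟪ν, x⟫ = c} = (fun x => -x₀ + x) ⁻¹' ((ℝ ∙ ν)ᗮ : Submodule ℝ (Space n)) := by
    ext x
    simp only [Set.mem_ofPred_eq, Set.mem_preimage, SetLike.mem_coe,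
      Submodule.mem_orthogonal_singleton_iff_inner_right, inner_add_right, inner_neg_right]
    rw [Set.mem_ofPred_eq] at hx₀
    rw [hx₀]
    constructor <;> intro h <;> linarith
  rw [this, measure_preimage_add]
  refine Measure.addHaar_submodule _ _ fun h => hν ?_
  have : ν ∈ (ℝ ∙ ν)ᗮ := by rw [h]; trivial
  rw [Submodule.mem_orthogonal_singleton_iff_inner_right] at this
  exact inner_self_eq_zero.1 this

end Graph

/-! ### The fundamental theorem of calculus on an open set with finitely many boundary points -/

theorem setIntegral_Iic_sub_of_Ioo_subset {U : Set ℝ} (hU : IsOpen U)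
    {f f' : ℝ → ℝ} (hf : ∀ t, HasDerivAt f (f' t) t) (hc : Continuous f')
    (hint : IntegrableOn f' U) {x y : ℝ} (hxy : x ≤ y) (h : Set.Ioo x y ⊆ U) :
    (∫ t in U ∩ Set.Iic y, f' t) - ∫ t in U ∩ Set.Iic x, f' t = f y - f x := by
  have h1 : U ∩ Set.Iic y = (U ∩ Set.Iic x) ∪ (U ∩ Set.Ioc x y) := by
    rw [← Set.inter_union_distrib_left, Set.Iic_union_Ioc_eq_Iic hxy]
  have hd : Disjoint (U ∩ Set.Iic x) (U ∩ Set.Ioc x y) := by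
    rw [Set.disjoint_left]
    rintro t ⟨_, h1⟩ ⟨_, h2⟩
    exact absurd h2.1 (not_lt.2 h1)
  rw [h1, setIntegral_union hd (hU.measurableSet.inter measurableSet_Ioc)
    (hint.mono_set Set.inter_subset_left) (hint.mono_set Set.inter_subset_left), add_sub_cancel_left]
  have h2 : ∫ t in U ∩ Set.Ioc x y, f' t = ∫ t in Set.Ioc x y, f' t := by
    refine setIntegral_congr_set ?_
    have h3 : (Set.Ioo x y : Set ℝ) =ᵐ[volume] Set.Ioc x y := Ioo_ae_eq_Ioc
    filter_upwards [h3] with t ht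
    refine propext ⟨fun h => h.2, fun h4 => ⟨?_, h4⟩⟩
    exact h (ht.mpr h4)
  rw [h2, ← intervalIntegral.integral_of_le hxy,
    intervalIntegral.integral_eq_sub_of_hasDerivAt (fun t _ => hf t) (hc.intervalIntegrable _ _)]

theorem setIntegral_Iic_sub_of_disjoint_Ioo {U : Set ℝ}
    {f' : ℝ → ℝ} {x y : ℝ} (hxy : x ≤ y)
    (h : Disjoint (Set.Ioo x y) U) :
    (∫ t in U ∩ Set.Iic y, f' t) = ∫ t in U ∩ Set.Iic x, f' t := by
  refine setIntegral_congr_set ?_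
  have h3 : (Set.Ioo x y : Set ℝ) =ᵐ[volume] Set.Ioc x y := Ioo_ae_eq_Ioc
  filter_upwards [h3] with t ht
  refine propext ⟨fun h4 => ⟨h4.1, ?_⟩, fun h4 => ⟨h4.1, h4.2.trans hxy⟩⟩
  by_contra h5
  exact Set.disjoint_left.1 h (ht.mpr ⟨not_le.1 h5, h4.2⟩) h4.1

/-- No decomposition of `U` into intervals is needed. The function `W x = ∫_{U ∩ (-∞, x]} f' -
1_U(x) f(x)` is constant near points off the boundary of `U` and jumps by `σ f(τ)` at an endpoint
`τ`. Subtracting step functions `J` with the same jumps leaves a locally constant `Φ`, whose values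
to the left and to the right of everything are compared. -/
theorem setIntegral_deriv_eq_sum {ι : Type*} {U : Set ℝ} (hU : IsOpen U)
    (hb : Bornology.IsBounded U) {f f' : ℝ → ℝ} (hf : ∀ t, HasDerivAt f (f' t) t)
    (hc : Continuous f') (s : Finset ι) (τ σ : ι → ℝ)
    (hcov : ∀ t ∈ frontier U, ∃ a ∈ s, τ a = t)
    (hinj : ∀ a ∈ s, ∀ b ∈ s, τ a = τ b → a = b)
    (hσ : ∀ a ∈ s, (σ a = 1 ∧ ∀ᶠ t in 𝓝 (τ a), t ∈ U ↔ t < τ a) ∨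
      (σ a = -1 ∧ ∀ᶠ t in 𝓝 (τ a), t ∈ U ↔ τ a < t)) :
    ∫ t in U, f' t = ∑ a ∈ s, σ a * f (τ a) := by
  classical
  have hint : IntegrableOn f' U :=
    integrable_of_poly hb hU.measurableSet hb.measure_lt_top.ne hc
  set W : ℝ → ℝ := fun x => (∫ t in U ∩ Set.Iic x, f' t) - U.indicator f x with hW
  -- The side on which the step is closed matters. An endpoint never belongs to `U`, so at a right
  -- endpoint (`σ = 1`) the indicator has already dropped at `τ` itself, whereas at a left endpoint
  -- it only switches on strictly after `τ`.
  set J : ι → ℝ → ℝ := fun a x =>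
    if σ a = 1 then (if τ a ≤ x then 1 else 0) else (if τ a < x then 1 else 0) with hJ
  set Φ : ℝ → ℝ := fun x => W x - ∑ a ∈ s, σ a * f (τ a) * J a x with hΦ
  have hJloc : ∀ a x, τ a ≠ x → ∀ᶠ y in 𝓝 x, J a y = J a x := by
    intro a x hax
    rcases lt_or_gt_of_ne hax with h | h
    · filter_upwards [lt_mem_nhds h] with y hy
      simp [hJ, h, hy, h.le, hy.le]
    · filter_upwards [gt_mem_nhds h] with y hy
      simp [hJ, not_lt.2 h.le, not_lt.2 hy.le, not_le.2 h, not_le.2 hy]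
  have hsum : ∀ x (s' : Finset ι), (∀ a ∈ s', τ a ≠ x) →
      ∀ᶠ y in 𝓝 x, ∑ a ∈ s', σ a * f (τ a) * J a y = ∑ a ∈ s', σ a * f (τ a) * J a x := by
    intro x s' hs'
    have : ∀ᶠ y in 𝓝 x, ∀ a ∈ s', J a y = J a x :=
      (Filter.eventually_all_finset s').2 fun a ha => hJloc a x (hs' a ha)
    filter_upwards [this] with y hy
    exact Finset.sum_congr rfl fun a ha => by rw [hy a ha]
  have hloc : IsLocallyConstant Φ := by
    rw [IsLocallyConstant.iff_eventually_eq]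
    intro x
    by_cases hx : ∃ a ∈ s, τ a = x
    · obtain ⟨a, ha, rfl⟩ := hx
      have h1 := hsum (τ a) (s.erase a) fun b hb hab =>
        (Finset.ne_of_mem_erase hb) (hinj b (Finset.mem_of_mem_erase hb) a ha hab)
      have hΦ' : ∀ y, Φ y = W y - σ a * f (τ a) * J a y -
          ∑ b ∈ s.erase a, σ b * f (τ b) * J b y := by
        intro y
        simp only [hΦ]
        rw [← Finset.add_sum_erase s _ ha]
        ring
      suffices h2 : ∀ᶠ y in 𝓝 (τ a), W y - σ a * f (τ a) * J a y =
          W (τ a) - σ a * f (τ a) * J a (τ a) by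
        filter_upwards [h1, h2] with y h3 h4
        rw [hΦ', hΦ', h3, h4]
      rcases hσ a ha with ⟨hs, hev⟩ | ⟨hs, hev⟩
      · obtain ⟨ε, hε, hball⟩ := Metric.eventually_nhds_iff_ball.1 hev
        have hx0 : τ a ∉ U := by
          rw [hball (τ a) (Metric.mem_ball_self hε)]; exact lt_irrefl _
        filter_upwards [Metric.ball_mem_nhds (τ a) hε] with y hy
        rw [Real.ball_eq_Ioo] at hball hy
        rcases lt_or_ge y (τ a) with hlt | hge
        · have hyU : y ∈ U := (hball y hy).2 hlt
          have := setIntegral_Iic_sub_of_Ioo_subset hU hf hc hint hlt.le fun t ht =>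
            (hball t ⟨hy.1.trans ht.1, ht.2.trans (by linarith)⟩).2 ht.2
          simp only [hW, hJ, hs, Set.indicator_of_mem hyU, Set.indicator_of_notMem hx0,
            not_le.2 hlt, le_refl, if_true, if_false]
          linarith
        · have hyU : y ∉ U := fun h => absurd ((hball y hy).1 h) (not_lt.2 hge)
          have := setIntegral_Iic_sub_of_disjoint_Ioo (f' := f') hge
            (Set.disjoint_left.2 fun t ht htU =>
              absurd ((hball t ⟨by linarith [ht.1], ht.2.trans hy.2⟩).1 htU) (not_lt.2 ht.1.le))
          simp only [hW, hJ, hs, Set.indicator_of_notMem hyU, Set.indicator_of_notMem hx0,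
            hge, le_refl, if_true, this]
      · obtain ⟨ε, hε, hball⟩ := Metric.eventually_nhds_iff_ball.1 hev
        have hx0 : τ a ∉ U := by
          rw [hball (τ a) (Metric.mem_ball_self hε)]; exact lt_irrefl _
        have hne : σ a ≠ 1 := by rw [hs]; norm_num
        filter_upwards [Metric.ball_mem_nhds (τ a) hε] with y hy
        rw [Real.ball_eq_Ioo] at hball hy
        rcases lt_or_ge (τ a) y with hlt | hge
        · have hyU : y ∈ U := (hball y hy).2 hlt
          have := setIntegral_Iic_sub_of_Ioo_subset hU hf hc hint hlt.le fun t ht =>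
            (hball t ⟨by linarith [ht.1], ht.2.trans hy.2⟩).2 ht.1
          simp only [hW, hJ, if_neg hne, Set.indicator_of_mem hyU, Set.indicator_of_notMem hx0,
            hlt, lt_irrefl, if_true, if_false, hs]
          linarith
        · have hyU : y ∉ U := fun h => absurd ((hball y hy).1 h) (not_lt.2 hge)
          have := setIntegral_Iic_sub_of_disjoint_Ioo (f' := f') hge
            (Set.disjoint_left.2 fun t ht htU =>
              absurd ((hball t ⟨hy.1.trans ht.1, by linarith [ht.2]⟩).1 htU) (not_lt.2 ht.2.le))
          simp only [hW, hJ, if_neg hne, Set.indicator_of_notMem hyU, Set.indicator_of_notMem hx0,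
            not_lt.2 hge, lt_irrefl, if_false, this]
    · push Not at hx
      have h1 := hsum x s hx
      suffices h2 : ∀ᶠ y in 𝓝 x, W y = W x by
        filter_upwards [h1, h2] with y h3 h4
        simp only [hΦ, h3, h4]
      by_cases hxU : x ∈ U
      · obtain ⟨ε, hε, hball⟩ := Metric.isOpen_iff.1 hU x hxU
        filter_upwards [Metric.ball_mem_nhds x hε] with y hy
        have hyU := hball hy
        rw [Real.ball_eq_Ioo] at hball hy
        rcases le_total x y with h | h
        · have := setIntegral_Iic_sub_of_Ioo_subset hU hf hc hint h fun t ht =>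
            hball ⟨by linarith [ht.1], ht.2.trans hy.2⟩
          simp only [hW, Set.indicator_of_mem hxU, Set.indicator_of_mem hyU]
          linarith
        · have := setIntegral_Iic_sub_of_Ioo_subset hU hf hc hint h fun t ht =>
            hball ⟨hy.1.trans ht.1, by linarith [ht.2]⟩
          simp only [hW, Set.indicator_of_mem hxU, Set.indicator_of_mem hyU]
          linarith
      · have hxc : x ∉ closure U := fun h => by
          obtain ⟨a, ha, hax⟩ := hcov x ⟨h, by rwa [hU.interior_eq]⟩
          exact hx a ha hax
        obtain ⟨ε, hε, hball⟩ := Metric.isOpen_iff.1 isClosed_closure.isOpen_compl x hxc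
        have hball' : ∀ t ∈ Metric.ball x ε, t ∉ U := fun t ht h => hball ht (subset_closure h)
        filter_upwards [Metric.ball_mem_nhds x hε] with y hy
        have hyU := hball' y hy
        rw [Real.ball_eq_Ioo] at hball' hy
        rcases le_total x y with h | h
        · have := setIntegral_Iic_sub_of_disjoint_Ioo (f' := f') h (Set.disjoint_left.2 fun t ht =>
            hball' t ⟨by linarith [ht.1], ht.2.trans hy.2⟩)
          simp only [hW, Set.indicator_of_notMem hxU, Set.indicator_of_notMem hyU, this]
        · have := setIntegral_Iic_sub_of_disjoint_Ioo (f' := f') h (Set.disjoint_left.2 fun t ht =>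
            hball' t ⟨hy.1.trans ht.1, by linarith [ht.2]⟩)
          simp only [hW, Set.indicator_of_notMem hxU, Set.indicator_of_notMem hyU, this]
  -- Beyond `±A` there is neither a point of `U` nor an endpoint, so `Φ (-A) = 0` and `Φ A` is the
  -- difference of the two sides of the claim.
  obtain ⟨R, hR⟩ := hb.subset_closedBall 0
  obtain ⟨B, hB⟩ : ∃ B : ℝ, ∀ a ∈ s, |τ a| ≤ B := by
    obtain ⟨B, hB⟩ := (s.image fun a => |τ a|).bddAbove
    exact ⟨B, fun a ha => hB (by simpa using ⟨a, ha, rfl⟩)⟩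
  set A : ℝ := max R B + 1
  have hUR : ∀ t ∈ U, |t| < A := fun t ht => by
    have := hR ht
    rw [Metric.mem_closedBall, dist_zero_right, Real.norm_eq_abs] at this
    exact lt_of_le_of_lt (this.trans (le_max_left R B)) (lt_add_one _)
  have hτA : ∀ a ∈ s, |τ a| < A := fun a ha =>
    lt_of_le_of_lt ((hB a ha).trans (le_max_right R B)) (lt_add_one _)
  have hAU : ∀ t, A ≤ |t| → t ∉ U := fun t ht h => absurd (hUR t h) (not_lt.2 ht)
  have hconst := hloc.apply_eq_of_preconnectedSpace A (-A)
  have e1 : Φ (-A) = 0 := by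
    have h1 : U ∩ Set.Iic (-A) = ∅ := by
      ext t
      simp only [Set.mem_inter_iff, Set.mem_Iic, Set.mem_empty_iff_false, iff_false, not_and]
      intro ht h
      have := neg_lt_of_abs_lt (hUR t ht)
      linarith
    have h2 : ∀ a ∈ s, J a (-A) = 0 := fun a ha => by
      have := neg_lt_of_abs_lt (hτA a ha)
      simp [hJ, not_le.2 this, not_lt.2 this.le]
    simp only [hΦ, hW, h1]
    rw [Finset.sum_eq_zero fun a ha => by rw [h2 a ha, mul_zero],
      Set.indicator_of_notMem (hAU _ (by rw [abs_neg]; exact le_abs_self A))]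
    simp
  have e2 : Φ A = (∫ t in U, f' t) - ∑ a ∈ s, σ a * f (τ a) := by
    have h1 : U ∩ Set.Iic A = U := by
      refine Set.inter_eq_left.2 fun t ht => ((le_abs_self t).trans (hUR t ht).le)
    have h2 : ∀ a ∈ s, J a A = 1 := fun a ha => by
      have := lt_of_abs_lt (hτA a ha)
      simp [hJ, this, this.le]
    simp only [hΦ, hW, h1]
    rw [Finset.sum_congr rfl fun a ha => by rw [h2 a ha, mul_one],
      Set.indicator_of_notMem (hAU _ (le_abs_self A)), sub_zero]
  linarith

/-! ### The divergence theorem -/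

theorem hasDerivAt_comp_insertCoord {n : ℕ} (i : Fin (n + 1)) {f : Space (n + 1) → ℝ}
    (hf : Differentiable ℝ f) (y : Space n) (t : ℝ) :
    HasDerivAt (fun t => f (insertCoord i t y))
      (fderiv ℝ f (insertCoord i t y) (EuclideanSpace.single i 1)) t := by
  have h : HasDerivAt (fun t => insertCoord i t y) (EuclideanSpace.single i (1 : ℝ)) t := by
    have h0 : (fun t => insertCoord i t y) =
        fun t => insertCoord i 0 y + t • EuclideanSpace.single i (1 : ℝ) :=
      funext fun t => insertCoord_eq_add i t y
    rw [h0]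
    simpa using ((hasDerivAt_id t).smul_const (EuclideanSpace.single i (1 : ℝ))).const_add
      (insertCoord i 0 y)
  exact (hf (insertCoord i t y)).hasFDerivAt.comp_hasDerivAt t h

/-- The divergence theorem for the field `f e_i` on a bounded open set whose boundary is, up to a
null set, made of flat pieces near which the set is a half-space. -/
theorem setIntegral_fderiv_single_eq_sum {n : ℕ} (i : Fin (n + 1)) {T : Set (Space (n + 1))}
    (hT : IsOpen T) (hb : Bornology.IsBounded T) (𝓕 : Finset (Set (Space (n + 1))))
    (ν : Set (Space (n + 1)) → Space (n + 1)) (c : Set (Space (n + 1)) → ℝ)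
    (hν : ∀ F ∈ 𝓕, ‖ν F‖ = 1) (hm : ∀ F ∈ 𝓕, MeasurableSet F)
    (hc : ∀ F ∈ 𝓕, ∀ x ∈ F, ⟪ν F, x⟫ = c F)
    (hdisj : ∀ F ∈ 𝓕, ∀ F' ∈ 𝓕, F ≠ F' → Disjoint F F')
    {Z : Set (Space (n + 1))} (hZ : μHE[n] Z = 0)
    (hcov : ∀ x ∈ frontier T, x ∉ Z → ∃ F ∈ 𝓕, x ∈ F)
    (hhalf : ∀ F ∈ 𝓕, ∀ x ∈ F, x ∉ Z → ∀ᶠ y in 𝓝 x, y ∈ T ↔ ⟪ν F, y⟫ < c F)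
    {f : Space (n + 1) → ℝ} (hf : ContDiff ℝ 1 f)
    (hfi : ∀ F ∈ 𝓕, IntegrableOn f F μHE[n]) :
    ∫ x in T, fderiv ℝ f x (EuclideanSpace.single i 1) =
      ∑ F ∈ 𝓕, ν F i * ∫ x in F, f x ∂μHE[n] := by
  classical
  set f' : Space (n + 1) → ℝ := fun x => fderiv ℝ f x (EuclideanSpace.single i 1) with hf'
  have hf'c : Continuous f' := (hf.continuous_fderiv (by norm_num)).clm_apply continuous_const
  have hf'i : IntegrableOn f' T :=
    integrable_of_poly hb hT.measurableSet hb.measure_lt_top.ne hf'c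
  have hins : ∀ y : Space n, Continuous fun t => insertCoord i t y := fun y =>
    (continuous_insertCoord i).comp (by fun_prop : Continuous fun t : ℝ => (t, y))
  -- Faces parallel to the axis contribute nothing, since `ν_i = 0` there. On the others, `σ` is the
  -- sign of `ν_i`: the component `ν_i` from the formula times the area factor `1 / |ν_i|` of the
  -- graph.
  set 𝓖 := 𝓕.filter fun F => ν F i ≠ 0 with h𝓖
  set σ : Set (Space (n + 1)) → ℝ := fun F => ν F i * |ν F i|⁻¹ with hσ
  have hmem : ∀ F ∈ 𝓖, F ∈ 𝓕 ∧ ν F i ≠ 0 := fun F hF => by simpa [h𝓖] using hF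
  have hR : ∑ F ∈ 𝓕, ν F i * ∫ x in F, f x ∂μHE[n] =
      ∫ y, ∑ F ∈ 𝓖, σ F * F.indicator f (hyperplaneGraph i (ν F) (c F) y) := by
    rw [integral_finsetSum]
    · rw [h𝓖, Finset.sum_filter]
      refine Finset.sum_congr rfl fun F hF => ?_
      split_ifs with h
      · rw [setIntegral_hyperplane_eq (hν F hF) h (c F) (hm F hF) (hc F hF), integral_const_mul,
          mul_assoc]
      · rw [not_ne_iff.1 h, zero_mul]
    · intro F hF
      obtain ⟨h1, h2⟩ := hmem F hF
      exact (integrable_hyperplaneGraph (hν F h1) h2 (c F) (hm F h1) (hc F h1) (hfi F h1)).const_mul _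
  rw [hR, ← integral_indicator hT.measurableSet,
    integral_eq_integral_insertCoord i ((integrable_indicator_iff hT.measurableSet).2 hf'i)]
  refine integral_congr_ae ?_
  -- Only generic lines are kept: those missing the null set and missing every face parallel to the
  -- axis. Such a line meets each remaining face in at most one point, `τ F`, and crosses it
  -- transversally.
  have hZae : ∀ᵐ y : Space n, y ∉ deleteCoord i '' Z :=
    measure_eq_zero_iff_ae_notMem.1 (volume_deleteCoord_image_eq_zero i hZ)
  have hvert : ∀ᵐ y : Space n, ∀ F ∈ 𝓕, ν F i = 0 → ⟪deleteCoord i (ν F), y⟫ ≠ c F := by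
    refine (Finset.eventually_all 𝓕).2 fun F hF => ?_
    by_cases h0 : ν F i = 0
    · have hne : deleteCoord i (ν F) ≠ 0 := by
        intro h
        have h1 : ν F = 0 := by
          rw [← insertCoord_deleteCoord i (ν F), h, h0]
          ext j
          refine Fin.succAboveCases i ?_ (fun j => ?_) j <;> simp
        have := hν F hF
        simp [h1] at this
      filter_upwards [measure_eq_zero_iff_ae_notMem.1 (volume_hyperplane_eq_zero hne (c F))] with y hy _
      exact hy
    · exact Eventually.of_forall fun y h => absurd h h0
  filter_upwards [hZae, hvert] with y hyZ hyv
  have hZ' : ∀ t, insertCoord i t y ∉ Z := fun t h => hyZ ⟨_, h, deleteCoord_insertCoord i t y⟩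
  set U : Set ℝ := (fun t => insertCoord i t y) ⁻¹' T with hUdef
  have hU : IsOpen U := hT.preimage (hins y)
  have hUb : Bornology.IsBounded U := by
    obtain ⟨R, hR⟩ := hb.subset_closedBall 0
    refine (Metric.isBounded_closedBall (x := (0 : ℝ)) (r := R)).subset fun t ht => ?_
    have h1 := hR ht
    rw [Metric.mem_closedBall, dist_zero_right] at h1 ⊢
    have h2 := PiLp.norm_apply_le (insertCoord i t y) i
    rw [insertCoord_same] at h2
    exact h2.trans h1
  set τ : Set (Space (n + 1)) → ℝ := fun F => (c F - ⟪deleteCoord i (ν F), y⟫) / ν F i with hτ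
  have hgr : ∀ F, hyperplaneGraph i (ν F) (c F) y = insertCoord i (τ F) y := fun F => rfl
  have hpt : ∀ F ∈ 𝓕, ∀ t, insertCoord i t y ∈ F → ν F i ≠ 0 ∧ t = τ F := by
    intro F hF t ht
    have h1 := hc F hF _ ht
    rw [inner_insertCoord] at h1
    have h2 : ν F i ≠ 0 := fun h => hyv F hF h (by rw [h] at h1; linarith)
    exact ⟨h2, by simp only [hτ]; rw [eq_div_iff h2]; linarith⟩
  set s := 𝓖.filter fun F => insertCoord i (τ F) y ∈ F with hs
  have hsmem : ∀ F ∈ s, F ∈ 𝓕 ∧ ν F i ≠ 0 ∧ insertCoord i (τ F) y ∈ F := fun F hF => by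
    rw [hs, Finset.mem_filter] at hF
    exact ⟨(hmem F hF.1).1, (hmem F hF.1).2, hF.2⟩
  have key := setIntegral_deriv_eq_sum hU hUb
    (f := fun t => f (insertCoord i t y)) (f' := fun t => f' (insertCoord i t y))
    (hasDerivAt_comp_insertCoord i (hf.differentiable (by norm_num)) y)
    (hf'c.comp (hins y)) s τ σ ?_ ?_ ?_
  · have e1 : (fun t => T.indicator f' (insertCoord i t y)) =
        U.indicator fun t => f' (insertCoord i t y) := by
      ext t
      simp only [Set.indicator, hUdef, Set.mem_preimage]
    rw [e1, integral_indicator hU.measurableSet, key, hs, Finset.sum_filter]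
    refine Finset.sum_congr rfl fun F hF => ?_
    rw [hgr]
    split_ifs with h
    · rw [Set.indicator_of_mem h]
    · rw [Set.indicator_of_notMem h, mul_zero]
  · intro t ht
    have h1 : insertCoord i t y ∈ frontier T := (hins y).frontier_preimage_subset T ht
    obtain ⟨F, hF, hx⟩ := hcov _ h1 (hZ' t)
    obtain ⟨h2, h3⟩ := hpt F hF t hx
    exact ⟨F, by simp only [hs, h𝓖, Finset.mem_filter]; exact ⟨⟨hF, h2⟩, h3 ▸ hx⟩, h3.symm⟩
  · intro F hF F' hF' h
    obtain ⟨h1, -, h2⟩ := hsmem F hF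
    obtain ⟨h3, -, h4⟩ := hsmem F' hF'
    by_contra hne
    exact Set.disjoint_left.1 (hdisj F h1 F' h3 hne) h2 (h ▸ h4)
  · intro F hF
    obtain ⟨h1, h2, h3⟩ := hsmem F hF
    have hev : ∀ᶠ t in 𝓝 (τ F), t ∈ U ↔ ⟪ν F, insertCoord i t y⟫ < c F :=
      (hins y).continuousAt.eventually (hhalf F h1 _ h3 (hZ' _))
    -- Along the line the half-space condition becomes a condition on `t - τ F`; the sign of `ν_i`
    -- decides whether `τ F` is a right or a left endpoint of the slice.
    have hlin : ∀ t, ⟪ν F, insertCoord i t y⟫ - c F = ν F i * (t - τ F) := by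
      intro t
      rw [inner_insertCoord]
      simp only [hτ]
      field_simp
      ring
    rcases lt_or_gt_of_ne h2 with hneg | hpos
    · right
      refine ⟨by simp only [hσ, abs_of_neg hneg]; field_simp, ?_⟩
      filter_upwards [hev] with t ht
      rw [ht, ← sub_neg, hlin, mul_neg_iff]
      constructor
      · rintro (⟨h, -⟩ | ⟨-, h⟩) <;> linarith
      · exact fun h => Or.inr ⟨hneg, by linarith⟩
    · left
      refine ⟨by simp only [hσ, abs_of_pos hpos]; field_simp, ?_⟩
      filter_upwards [hev] with t ht
      rw [ht, ← sub_neg, hlin, mul_neg_iff]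
      constructor
      · rintro (⟨-, h⟩ | ⟨h, -⟩) <;> linarith
      · exact fun h => Or.inl ⟨hpos, by linarith⟩

/-! ### Local structure of a mesh near its skeleton -/

/-- The finite union of closed simplices is closed, so it contains the closure of its interior.
Hence a point with a whole neighbourhood in the closure of the domain is interior to the domain,
which excludes slits. -/
theorem IsPolytope.interior_closure {d : ℕ} {X : Set (Space d)} (h : IsPolytope X) :
    interior (closure X) = X := by
  refine subset_antisymm ?_ (h.isOpen.subset_interior_closure)
  obtain ⟨-, S, rfl⟩ := h
  refine interior_mono (closure_minimal interior_subset ?_)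
  exact isClosed_biUnion_finset fun s _ => s.isCompact_closedInterior.isClosed

/-- The open half-ball is convex, hence connected, and it misses the boundary of `T`, which within
the ball lies in the hyperplane. -/
theorem halfBall_subset_or_disjoint {d : ℕ} {T : Set (Space d)} (hT : IsOpen T) {x m : Space d}
    {r c : ℝ} (h : ∀ y ∈ frontier T, y ∈ Metric.ball x r → ⟪m, y⟫ = c) :
    Metric.ball x r ∩ {y | ⟪m, y⟫ < c} ⊆ T ∨ Disjoint (Metric.ball x r ∩ {y | ⟪m, y⟫ < c}) T := by
  rw [or_iff_not_imp_right, Set.not_disjoint_iff_nonempty_inter]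
  intro hne
  have hconv : Convex ℝ (Metric.ball x r ∩ {y | ⟪m, y⟫ < c}) :=
    (convex_ball x r).inter (convex_halfSpace_lt (innerₛₗ ℝ m).isLinear c)
  refine hconv.isPreconnected.subset_left_of_subset_union hT isClosed_closure.isOpen_compl
    (v := (closure T)ᶜ) ?_ ?_ hne
  · exact Set.disjoint_left.2 fun y hy hy' => hy' (subset_closure hy)
  · intro y hy
    by_cases hyT : y ∈ T
    · exact Or.inl hyT
    · refine Or.inr fun hyc => ?_
      have : ⟪m, y⟫ = c := h y ⟨hyc, by rwa [hT.interior_eq]⟩ hy.1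
      exact absurd hy.2 (by simp [this])

theorem exists_mem_lt_of_isOpen {d : ℕ} {V : Set (Space d)} (hV : IsOpen V) {m z : Space d} {c : ℝ}
    (hm : ‖m‖ = 1) (hz : z ∈ V) (hzc : ⟪m, z⟫ = c) : ∃ y ∈ V, ⟪m, y⟫ < c := by
  have hcont : Continuous fun t : ℝ => z - t • m := by fun_prop
  have h1 : ∀ᶠ t in 𝓝[>] (0 : ℝ), z - t • m ∈ V :=
    nhdsWithin_le_nhds (hcont.continuousAt.eventually (hV.mem_nhds (by simpa using hz)))
  obtain ⟨t, ht, ht0⟩ := (h1.and self_mem_nhdsWithin).exists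
  refine ⟨_, ht, ?_⟩
  rw [inner_sub_right, inner_smul_right, real_inner_self_eq_norm_sq, hm, hzc]
  have : (0 : ℝ) < t := ht0
  linarith

theorem exists_mem_ne_of_isOpen {d : ℕ} {V : Set (Space d)} (hV : IsOpen V) {m : Space d} (c : ℝ)
    (hm : ‖m‖ = 1) (hne : V.Nonempty) : ∃ y ∈ V, ⟪m, y⟫ < c ∨ ⟪-m, y⟫ < -c := by
  obtain ⟨z, hz⟩ := hne
  rcases lt_trichotomy ⟪m, z⟫ c with h | h | h
  · exact ⟨z, hz, Or.inl h⟩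
  · obtain ⟨y, hy, hlt⟩ := exists_mem_lt_of_isOpen hV hm hz h
    exact ⟨y, hy, Or.inl hlt⟩
  · exact ⟨z, hz, Or.inr (by rw [inner_neg_left]; linarith)⟩

namespace PolytopalMesh

variable {d : ℕ} {Ω : Set (Space d)}

theorem mem_facesOf (M : PolytopalMesh Ω) {T F : Set (Space d)} :
    F ∈ M.facesOf T ↔ F ∈ M.faces ∧ F ⊆ frontier T := by
  classical
  rw [facesOf, Finset.mem_filter]

/-- Faces are disjoint and `x` lies on no relative boundary of a face, so `x` is at positive
distance from the closures of the finitely many other faces. Near `x` the skeleton is thus contained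
in the closure of `F` alone. -/
theorem exists_ball_frontier_subset (M : PolytopalMesh Ω) {F : Set (Space d)} (hF : F ∈ M.faces)
    {x : Space d} (hx : x ∈ F) (hxZ : ∀ F' ∈ M.faces, x ∉ closure F' \ F') :
    ∃ r > 0, ∀ T ∈ M.elements, ∀ y ∈ frontier T, y ∈ Metric.ball x r → y ∈ closure F := by
  have h1 : ∀ᶠ y in 𝓝 x, ∀ F' ∈ M.faces, F' ≠ F → y ∉ closure F' := by
    refine (Filter.eventually_all_finset _).2 fun F' hF' => ?_
    by_cases hne : F' = F
    · exact Eventually.of_forall fun y h => absurd hne h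
    · have : x ∉ closure F' := fun h => hxZ F' hF'
        ⟨h, fun h' => Set.disjoint_left.1 (M.faces_disjoint F' hF' F hF hne) h' hx⟩
      filter_upwards [isClosed_closure.isOpen_compl.mem_nhds this] with y hy _
      exact hy
  obtain ⟨r, hr, hball⟩ := Metric.eventually_nhds_iff_ball.1 h1
  refine ⟨r, hr, fun T hT y hy hyb => ?_⟩
  have hyS : y ∈ ⋃ F ∈ M.faces, closure F := by
    rw [← M.skeleton]
    exact Set.mem_biUnion hT hy
  simp only [Set.mem_iUnion] at hyS
  obtain ⟨F', hF', hyF'⟩ := hyS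
  by_cases hne : F' = F
  · exact hne ▸ hyF'
  · exact absurd hyF' (hball y hyb F' hF' hne)

/-- The skeleton axiom only says that boundary points lie in closures of faces; this lemma shows
that a face met at a good point by the boundary of `T` is a face of `T`. Every element having `x` on
its boundary fills one of the two half-balls at `x`. If `F` separates two elements, a third one
would have no half-ball left. If `F` lies on the boundary of the domain and belongs to another
element, the two elements fill both halves, which puts `x` inside the domain. -/
theorem subset_frontier_of_mem (M : PolytopalMesh Ω) (hΩ : IsPolytope Ω) {T F : Set (Space d)}
    (hT : T ∈ M.elements) (hF : F ∈ M.faces) {x : Space d} (hxT : x ∈ frontier T) (hx : x ∈ F)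
    (hxZ : ∀ F' ∈ M.faces, x ∉ closure F' \ F') : F ⊆ frontier T := by
  obtain ⟨r, hr, hball⟩ := M.exists_ball_frontier_subset hF hx hxZ
  obtain ⟨⟨m, c, U, hm, hU, hFU⟩, -⟩ := M.isFlatFace_of_mem F hF
  have hFc : closure F ⊆ {y | ⟪m, y⟫ = c} :=
    closure_minimal (by rw [hFU]; exact Set.inter_subset_right)
      (isClosed_eq (by fun_prop) continuous_const)
  set A : Set (Space d) := Metric.ball x r ∩ {y | ⟪m, y⟫ < c} with hA
  set B : Set (Space d) := Metric.ball x r ∩ {y | ⟪-m, y⟫ < -c} with hB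
  have hsub : ∀ T' ∈ M.elements, x ∈ frontier T' → (A ⊆ T' ∧ A.Nonempty) ∨ (B ⊆ T' ∧ B.Nonempty) := by
    intro T' hT' hxT'
    have hopen := (M.isPolytope_of_mem T' hT').isOpen
    have hne : (Metric.ball x r ∩ T').Nonempty :=
      mem_closure_iff.1 hxT'.1 _ Metric.isOpen_ball (Metric.mem_ball_self hr)
    obtain ⟨y, hy, h | h⟩ := exists_mem_ne_of_isOpen (Metric.isOpen_ball.inter hopen) c hm hne
    · left
      refine ⟨(halfBall_subset_or_disjoint hopen fun z hz hzb => hFc (hball T' hT' z hz hzb)).resolve_right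
        fun hd => Set.disjoint_left.1 hd ⟨hy.1, h⟩ hy.2, y, hy.1, h⟩
    · right
      refine ⟨(halfBall_subset_or_disjoint hopen fun z hz hzb => ?_).resolve_right
        fun hd => Set.disjoint_left.1 hd ⟨hy.1, h⟩ hy.2, y, hy.1, h⟩
      rw [inner_neg_left, hFc (hball T' hT' z hz hzb)]
  have hcontra : ∀ T' ∈ M.elements, T ≠ T' → ∀ Y : Set (Space d), Y.Nonempty → Y ⊆ T →
      ¬ Y ⊆ T' := by
    rintro T' hT' hne Y ⟨y, hy⟩ h1 h2
    exact Set.disjoint_left.1 (M.elements_disjoint T hT T' hT' hne) (h1 hy) (h2 hy)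
  rcases M.interface_or_boundary F hF with ⟨T₁, hT₁, T₂, hT₂, hne, hsubF⟩ | ⟨T₁, hT₁, hsubF⟩
  · by_contra hnot
    have hn1 : T ≠ T₁ := fun h => hnot (h ▸ fun y hy => (hsubF hy).1)
    have hn2 : T ≠ T₂ := fun h => hnot (h ▸ fun y hy => (hsubF hy).2)
    have h12 : ∀ Y : Set (Space d), Y.Nonempty → Y ⊆ T₁ → ¬ Y ⊆ T₂ := by
      rintro Y ⟨y, hy⟩ h1 h2
      exact Set.disjoint_left.1 (M.elements_disjoint T₁ hT₁ T₂ hT₂ hne) (h1 hy) (h2 hy)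
    -- Pigeonhole: three pairwise disjoint elements, two half-balls.
    rcases hsub T hT hxT with ⟨h0, hn⟩ | ⟨h0, hn⟩ <;>
    rcases hsub T₁ hT₁ (hsubF hx).1 with ⟨h1, hn'⟩ | ⟨h1, hn'⟩ <;>
    rcases hsub T₂ hT₂ (hsubF hx).2 with ⟨h2, -⟩ | ⟨h2, -⟩ <;>
    first
      | exact hcontra T₁ hT₁ hn1 _ hn h0 h1
      | exact hcontra T₂ hT₂ hn2 _ hn h0 h2
      | exact h12 _ hn' h1 h2
  · by_contra hnot
    have hn1 : T ≠ T₁ := fun h => hnot (h ▸ fun y hy => (hsubF hy).1)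
    have hcl : ∀ T' ∈ M.elements, T' ⊆ closure Ω := by
      intro T' hT' y hy
      rw [M.closure_domain]
      exact Set.mem_biUnion hT' (subset_closure hy)
    have hAB : A ⊆ closure Ω ∧ B ⊆ closure Ω := by
      rcases hsub T hT hxT with ⟨h0, hn⟩ | ⟨h0, hn⟩ <;>
      rcases hsub T₁ hT₁ (hsubF hx).1 with ⟨h1, hn'⟩ | ⟨h1, hn'⟩
      · exact absurd h1 (hcontra T₁ hT₁ hn1 _ hn h0)
      · exact ⟨h0.trans (hcl T hT), h1.trans (hcl T₁ hT₁)⟩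
      · exact ⟨h1.trans (hcl T₁ hT₁), h0.trans (hcl T hT)⟩
      · exact absurd h1 (hcontra T₁ hT₁ hn1 _ hn h0)
    -- A point of the ball outside the closed set would have an open neighbourhood outside it, and
    -- such a neighbourhood cannot stay within the hyperplane separating the two halves.
    have hBall : Metric.ball x r ⊆ closure Ω := by
      intro z hz
      by_contra hzΩ
      obtain ⟨y, hy, h | h⟩ := exists_mem_ne_of_isOpen
        (Metric.isOpen_ball.inter isClosed_closure.isOpen_compl) c hm ⟨z, hz, hzΩ⟩
      · exact hy.2 (hAB.1 ⟨hy.1, h⟩)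
      · exact hy.2 (hAB.2 ⟨hy.1, h⟩)
    have hxΩ : x ∈ Ω := by
      rw [← hΩ.interior_closure]
      exact mem_interior.2 ⟨_, hBall, Metric.isOpen_ball, Metric.mem_ball_self hr⟩
    exact (hsubF hx).2.2 (by rwa [hΩ.isOpen.interior_eq])

/-- One point behind `x` in `T` and one in front outside `T` decide the dichotomy of
`halfBall_subset_or_disjoint` on each side: the lower half-ball is in `T`, the upper one is disjoint
from it. -/
theorem eventually_mem_iff_inner_lt (M : PolytopalMesh Ω) {T F : Set (Space d)}
    (hT : T ∈ M.elements) (hF : F ∈ M.faces) {x m : Space d} {c : ℝ} (hm : ‖m‖ = 1)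
    (hFc : ∀ y ∈ F, ⟪m, y⟫ = c) (hx : x ∈ F) (hxZ : ∀ F' ∈ M.faces, x ∉ closure F' \ F')
    (hxm : ∀ᶠ t : ℝ in 𝓝[>] 0, x - t • m ∈ T ∧ x + t • m ∉ T) :
    ∀ᶠ y in 𝓝 x, y ∈ T ↔ ⟪m, y⟫ < c := by
  obtain ⟨r, hr, hball⟩ := M.exists_ball_frontier_subset hF hx hxZ
  have hopen := (M.isPolytope_of_mem T hT).isOpen
  have hFc' : closure F ⊆ {y | ⟪m, y⟫ = c} :=
    closure_minimal hFc (isClosed_eq (by fun_prop) continuous_const)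
  have hfr : ∀ y ∈ frontier T, y ∈ Metric.ball x r → ⟪m, y⟫ = c :=
    fun y hy hyb => hFc' (hball T hT y hy hyb)
  have hcont : Continuous fun t : ℝ => x - t • m := by fun_prop
  have hcont' : Continuous fun t : ℝ => x + t • m := by fun_prop
  have hb1 : ∀ᶠ t in 𝓝[>] (0 : ℝ), x - t • m ∈ Metric.ball x r :=
    nhdsWithin_le_nhds (hcont.continuousAt.eventually
      (Metric.isOpen_ball.mem_nhds (by simpa using hr)))
  have hb2 : ∀ᶠ t in 𝓝[>] (0 : ℝ), x + t • m ∈ Metric.ball x r :=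
    nhdsWithin_le_nhds (hcont'.continuousAt.eventually
      (Metric.isOpen_ball.mem_nhds (by simpa using hr)))
  obtain ⟨t, ⟨⟨h1, h2⟩, h3⟩, h4⟩ :=
    (((hxm.and hb1).and hb2).and self_mem_nhdsWithin).exists
  have ht0 : (0 : ℝ) < t := h4
  have hlow : Metric.ball x r ∩ {y | ⟪m, y⟫ < c} ⊆ T := by
    refine (halfBall_subset_or_disjoint hopen hfr).resolve_right fun hd => ?_
    suffices h : ⟪m, x - t • m⟫ < c from
      Set.disjoint_left.1 hd (show x - t • m ∈ Metric.ball x r ∩ {y | ⟪m, y⟫ < c} from ⟨h2, h⟩) h1.1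
    rw [inner_sub_right, inner_smul_right, real_inner_self_eq_norm_sq, hm, hFc x hx]
    linarith
  have hup : Disjoint (Metric.ball x r ∩ {y | ⟪-m, y⟫ < -c}) T := by
    refine (halfBall_subset_or_disjoint hopen fun y hy hyb => by
      rw [inner_neg_left, hfr y hy hyb]).resolve_left fun hd => ?_
    refine h1.2 (hd ⟨h3, ?_⟩)
    change ⟪-m, x + t • m⟫ < -c
    rw [inner_neg_left, inner_add_right, inner_smul_right, real_inner_self_eq_norm_sq, hm, hFc x hx]
    linarith
  filter_upwards [Metric.ball_mem_nhds x hr] with y hy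
  refine ⟨fun hyT => ?_, fun h => hlow ⟨hy, h⟩⟩
  by_contra hge
  -- A point of the open set `T` on the hyperplane itself would have points of `T` just above it, in
  -- the forbidden half-ball.
  rcases eq_or_lt_of_le (not_lt.1 hge) with heq | hlt
  · obtain ⟨z, hz, hzc⟩ := exists_mem_lt_of_isOpen (Metric.isOpen_ball.inter hopen) (m := -m)
      (c := -c) (by rwa [norm_neg]) ⟨hy, hyT⟩ (by rw [inner_neg_left, heq])
    exact Set.disjoint_left.1 hup ⟨hz.1, hzc⟩ hz.2
  · exact Set.disjoint_left.1 hup ⟨hy, by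
      change ⟪-m, y⟫ < -c
      rw [inner_neg_left]; linarith⟩ hyT

/-- Up to a null set, the boundary of an element is covered by its faces, and the element is a
half-space near every point of its faces. -/
theorem exists_null_set (M : PolytopalMesh Ω) (hΩ : IsPolytope Ω) {T : Set (Space d)}
    (hT : T ∈ M.elements) (c : Set (Space d) → ℝ)
    (hc : ∀ F ∈ M.facesOf T, ∀ x ∈ F, ⟪M.normal T F, x⟫ = c F) :
    ∃ Z : Set (Space d), μHE[d - 1] Z = 0 ∧
      (∀ x ∈ frontier T, x ∉ Z → ∃ F ∈ M.facesOf T, x ∈ F) ∧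
      ∀ F ∈ M.facesOf T, ∀ x ∈ F, x ∉ Z → ∀ᶠ y in 𝓝 x, y ∈ T ↔ ⟪M.normal T F, y⟫ < c F := by
  set bad : Set (Space d) → Set (Space d) := fun F => {x | ¬ (x ∈ F → ∀ᶠ t : ℝ in 𝓝[>] 0,
    x - t • M.normal T F ∈ T ∧ x + t • M.normal T F ∉ T)} with hbad
  refine ⟨(⋃ F ∈ M.faces, (closure F \ F)) ∪ ⋃ F ∈ M.facesOf T, bad F, ?_, ?_, ?_⟩
  · refine measure_union_null ?_ ?_
    · exact (measure_biUnion_null_iff M.faces.countable_toSet).2 fun F hF =>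
        (M.isFlatFace_of_mem F hF).2.2
    · refine (measure_biUnion_null_iff (M.facesOf T).countable_toSet).2 fun F hF => ?_
      obtain ⟨hF, hFT⟩ := M.mem_facesOf.1 hF
      have h := (M.isOuterUnitNormal T hT F hF hFT).2.2
      rw [ae_restrict_iff' (M.isFlatFace_of_mem F hF).measurableSet] at h
      exact h
  · intro x hx hxZ
    have hxZ' : ∀ F' ∈ M.faces, x ∉ closure F' \ F' := fun F' hF' h =>
      hxZ (Or.inl (Set.mem_biUnion hF' h))
    have hxS : x ∈ ⋃ F ∈ M.faces, closure F := by
      rw [← M.skeleton]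
      exact Set.mem_biUnion hT hx
    simp only [Set.mem_iUnion] at hxS
    obtain ⟨F, hF, hxF⟩ := hxS
    have hxF' : x ∈ F := by
      by_contra h
      exact hxZ' F hF ⟨hxF, h⟩
    exact ⟨F, M.mem_facesOf.2 ⟨hF, M.subset_frontier_of_mem hΩ hT hF hx hxF' hxZ'⟩, hxF'⟩
  · intro F hF x hx hxZ
    have hxZ' : ∀ F' ∈ M.faces, x ∉ closure F' \ F' := fun F' hF' h =>
      hxZ (Or.inl (Set.mem_biUnion hF' h))
    have hxb : ∀ᶠ t : ℝ in 𝓝[>] 0, x - t • M.normal T F ∈ T ∧ x + t • M.normal T F ∉ T := by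
      by_contra h
      exact hxZ (Or.inr (Set.mem_biUnion hF fun h' => h (h' hx)))
    obtain ⟨hF', hFT⟩ := M.mem_facesOf.1 hF
    exact M.eventually_mem_iff_inner_lt hT hF' (M.isOuterUnitNormal T hT F hF' hFT).1 (hc F hF) hx
      hxZ' hxb

end PolytopalMesh

/-- The divergence theorem on a mesh element, for the field `f e_i`. -/
theorem PolytopalMesh.setIntegral_fderiv_single {n : ℕ} {Ω : Set (Space (n + 1))}
    (M : PolytopalMesh Ω) (hΩ : IsPolytope Ω) {T : Set (Space (n + 1))} (hT : T ∈ M.elements)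
    (i : Fin (n + 1)) {f : Space (n + 1) → ℝ} (hf : ContDiff ℝ 1 f) :
    ∫ x in T, fderiv ℝ f x (EuclideanSpace.single i 1) =
      ∑ F ∈ M.facesOf T, M.normal T F i * ∫ x in F, f x ∂μHE[n] := by
  have hn : ∀ F ∈ M.facesOf T, IsOuterUnitNormal T F (M.normal T F) := fun F hF =>
    M.isOuterUnitNormal T hT F (M.mem_facesOf.1 hF).1 (M.mem_facesOf.1 hF).2
  have hex : ∀ F, ∃ c : ℝ, F ∈ M.facesOf T → ∀ x ∈ F, ⟪M.normal T F, x⟫ = c := by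
    intro F
    by_cases hF : F ∈ M.facesOf T
    · obtain ⟨c, hc⟩ := (hn F hF).2.1
      exact ⟨c, fun _ => hc⟩
    · exact ⟨0, fun h => absurd h hF⟩
  choose c hc using hex
  obtain ⟨Z, hZ, hcov, hhalf⟩ := M.exists_null_set hΩ hT c hc
  have hpoly := M.isPolytope_of_mem T hT
  refine setIntegral_fderiv_single_eq_sum i hpoly.isOpen hpoly.isBounded (M.facesOf T)
    (M.normal T) c (fun F hF => (hn F hF).1) (fun F hF => (M.isBounded_face hT hF).1.measurableSet)
    hc (fun F hF F' hF' => M.faces_disjoint F (M.mem_facesOf.1 hF).1 F' (M.mem_facesOf.1 hF').1)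
    hZ hcov hhalf hf fun F hF => ?_
  obtain ⟨h1, h2⟩ := M.isBounded_face hT hF
  exact integrable_of_poly h2 h1.measurableSet (h1.measure_ne_top h2) hf.continuous

/-! ### The boundary measure of sets connected by star-shaped sets -/

/-- The inverse of `g` on its image is Lipschitz with constant `K`. This form needs neither the
continuity of `g` nor an explicit inverse. -/
theorem euclideanHausdorffMeasure_le_of_dist_le {X Y : Type*} [MetricSpace X] [MeasurableSpace X]
    [BorelSpace X] [MetricSpace Y] [MeasurableSpace Y] [BorelSpace Y] {g : X → Y} {s : Set X}
    {Q : Set Y} {K : NNReal} (hg : ∀ x ∈ s, ∀ y ∈ s, dist x y ≤ K * dist (g x) (g y))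
    (hQ : Set.MapsTo g s Q) (m : ℕ) : μHE[m] s ≤ (K : ENNReal) ^ m * μHE[m] Q := by
  have hanti : AntilipschitzWith K (fun x : s => g x) :=
    AntilipschitzWith.of_le_mul_dist fun x y => hg x x.2 y y.2
  have h1 := hanti.le_hausdorffMeasure_image (d := m) (by positivity) Set.univ
  rw [ENNReal.rpow_natCast] at h1
  have h2 : μHE[m] s = μHE[m] (Set.univ : Set s) := by
    have h := Isometry.euclideanHausdorffMeasure_image (f := ((↑) : s → X)) (d := m)
      isometry_subtype_coe Set.univ
    rwa [Set.image_univ, Subtype.range_coe] at h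
  rw [h2]
  have h3 : (fun x : s => g x) '' Set.univ ⊆ Q := by
    rintro _ ⟨x, -, rfl⟩
    exact hQ x.2
  refine le_trans ?_ (mul_le_mul_right (measure_mono h3) _)
  simp only [Measure.euclideanHausdorffMeasure_def, Measure.smul_apply]
  rw [ENNReal.smul_def, ENNReal.smul_def, smul_eq_mul, smul_eq_mul, mul_left_comm]
  gcongr

theorem euclideanHausdorffMeasure_hyperplane_inter_lt_top {n : ℕ} {i : Fin (n + 1)}
    {ν : Space (n + 1)} (hν : ‖ν‖ = 1) (hi : ν i ≠ 0) (c R : ℝ) :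
    μHE[n] (Metric.closedBall 0 R ∩ {x | ⟪ν, x⟫ = c}) < ⊤ := by
  rw [← Measure.restrict_apply Metric.isClosed_closedBall.measurableSet,
    restrict_hyperplane_eq_map hν hi c, (measurableEmbedding_hyperplaneGraph i ν c).map_apply,
    Measure.smul_apply, smul_eq_mul]
  refine ENNReal.mul_lt_top ENNReal.ofReal_lt_top ?_
  refine lt_of_le_of_lt (measure_mono (t := Metric.closedBall 0 R) fun y hy => ?_)
    measure_closedBall_lt_top
  rw [Set.mem_preimage, mem_closedBall_zero_iff] at hy
  rw [mem_closedBall_zero_iff]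
  refine le_trans ?_ hy
  simpa [hyperplaneGraph] using norm_deleteCoord_le i (hyperplaneGraph i ν c y)

/-- The boundary of the unit cube `[-1, 1]^d`. -/
def cubeBoundary (d : ℕ) : Set (Space d) := {x | ‖x.ofLp‖ = 1}

theorem norm_le_sqrt_mul_norm_ofLp {d : ℕ} (x : Space d) : ‖x‖ ≤ √d * ‖x.ofLp‖ := by
  have h := (PiLp.antilipschitzWith_ofLp 2 (fun _ : Fin d => ℝ)).le_mul_dist x 0
  simp only [dist_zero_right, WithLp.ofLp_zero] at h
  refine h.trans (le_of_eq ?_)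
  simp [Real.sqrt_eq_rpow]

/-- The reference surface is a cube rather than a sphere because its boundary consists of bounded
pieces of the hyperplanes `x_i = ±1`, whose measure is known to be finite from the graph formula. -/
theorem euclideanHausdorffMeasure_cubeBoundary_lt_top (n : ℕ) :
    μHE[n] (cubeBoundary (n + 1)) < ⊤ := by
  set e : Fin (n + 1) → Space (n + 1) := fun i => EuclideanSpace.single i 1
  have hsub : cubeBoundary (n + 1) ⊆ ⋃ i : Fin (n + 1),
      ((Metric.closedBall 0 √(n + 1 : ℕ) ∩ {x | ⟪e i, x⟫ = 1}) ∪
        (Metric.closedBall 0 √(n + 1 : ℕ) ∩ {x | ⟪e i, x⟫ = -1})) := by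
    intro x hx
    have hx1 : ‖x.ofLp‖ = 1 := hx
    have hball : x ∈ Metric.closedBall (0 : Space (n + 1)) √(n + 1 : ℕ) := by
      rw [mem_closedBall_zero_iff]
      have := norm_le_sqrt_mul_norm_ofLp x
      rwa [hx1, mul_one] at this
    obtain ⟨i, hi⟩ := Finite.exists_max (fun i => ‖x i‖)
    have h2 : ‖x.ofLp‖ = ‖x i‖ :=
      le_antisymm ((pi_norm_le_iff_of_nonneg (norm_nonneg _)).2 hi) (norm_le_pi_norm _ i)
    rw [hx1, Real.norm_eq_abs] at h2
    refine Set.mem_iUnion.2 ⟨i, ?_⟩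
    rcases (abs_eq zero_le_one).1 h2.symm with h | h
    · exact Or.inl ⟨hball, by simp [e, EuclideanSpace.inner_single_left, h]⟩
    · exact Or.inr ⟨hball, by simp [e, EuclideanSpace.inner_single_left, h]⟩
  refine lt_of_le_of_lt (measure_mono hsub) ?_
  refine lt_of_le_of_lt (measure_iUnion_fintype_le _ _) ?_
  refine ENNReal.sum_lt_top.2 fun i _ => ?_
  refine lt_of_le_of_lt (measure_union_le _ _) (ENNReal.add_lt_top.2 ⟨?_, ?_⟩) <;>
  exact euclideanHausdorffMeasure_hyperplane_inter_lt_top (i := i) (by simp [e]) (by simp [e]) _ _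

/-! ### Radial projection of sets star-shaped with respect to a ball -/

section StarShaped

variable {d : ℕ} {Y : Set (Space d)} {x₀ : Space d} {r : ℝ}

/-- This is the cone with apex `x` over the ball of centres. A point of the closure is allowed as
apex: moving it slightly into `Y` keeps `z` in the open shrunken ball. -/
theorem ball_subset_of_starConvex_ball (hY : ∀ y ∈ Metric.ball x₀ r, StarConvex ℝ y Y)
    {x : Space d} (hx : x ∈ closure Y) {s : ℝ} (hs0 : 0 ≤ s) (hs : s < 1) :
    Metric.ball (s • x + (1 - s) • x₀) ((1 - s) * r) ⊆ Y := by
  intro z hz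
  have h1s : 0 < 1 - s := by linarith
  have hopen : IsOpen {w : Space d | dist z (s • w + (1 - s) • x₀) < (1 - s) * r} :=
    isOpen_lt (by fun_prop) continuous_const
  obtain ⟨w, hw, hwY⟩ := mem_closure_iff.1 hx _ hopen hz
  have hw' : dist z (s • w + (1 - s) • x₀) < (1 - s) * r := hw
  set y : Space d := (1 - s)⁻¹ • (z - s • w) with hy
  have hzy : (1 - s) • y + s • w = z := by
    rw [hy, smul_inv_smul₀ h1s.ne']; abel
  have hyb : y ∈ Metric.ball x₀ r := by
    rw [Metric.mem_ball, dist_eq_norm]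
    rw [dist_eq_norm, ← hzy,
      show (1 - s) • y + s • w - (s • w + (1 - s) • x₀) = (1 - s) • (y - x₀) by
        rw [smul_sub]; abel, norm_smul, Real.norm_of_nonneg h1s.le] at hw'
    exact lt_of_mul_lt_mul_left hw' h1s.le
  rw [← hzy]
  exact hY y hyb hwY h1s.le hs0 (by ring)

theorem le_dist_of_mem_frontier (hY : ∀ y ∈ Metric.ball x₀ r, StarConvex ℝ y Y)
    {x x' : Space d} (hx : x ∈ closure Y) (hx' : x' ∈ frontier Y) {s : ℝ} (hs0 : 0 ≤ s)
    (hs : s < 1) : (1 - s) * r ≤ dist x' (s • x + (1 - s) • x₀) := by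
  by_contra h
  exact hx'.2 (mem_interior.2
    ⟨_, ball_subset_of_starConvex_ball hY hx hs0 hs, Metric.isOpen_ball, not_le.1 h⟩)

/-- With `a` the sup-norm distance of a boundary point to `x₀` and `z` its radial projection on the
cube, the claim is that `a` is a Lipschitz function of `z`. If `a' ≤ a`, the cone over the ball of
centres with apex `x` pushes `x'` away from the segment from `x₀` to `x`, which gives `(a - a') r ≤
a a' |z - z'|`. The constant then comes from `x - x' = (a - a') z + a' (z - z')` and `|z| ≤ √d`. -/
theorem frontier_dist_le_of_starConvex_ball (hr : 0 < r)
    (hY : ∀ y ∈ Metric.ball x₀ r, StarConvex ℝ y Y) {D : ℝ}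
    (hD : closure Y ⊆ Metric.closedBall x₀ D) :
    (∀ x ∈ frontier Y, 0 < ‖(x - x₀).ofLp‖) ∧
    ∀ x ∈ frontier Y, ∀ x' ∈ frontier Y, dist x x' ≤ (√d * D ^ 2 / r + D) *
      dist (‖(x - x₀).ofLp‖⁻¹ • (x - x₀)) (‖(x' - x₀).ofLp‖⁻¹ • (x' - x₀)) := by
  have hpos : ∀ x ∈ frontier Y, 0 < ‖(x - x₀).ofLp‖ := by
    intro x hx
    rw [norm_pos_iff]
    intro h0
    have hxx : x = x₀ := by
      have h1 : x - x₀ = 0 := by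
        ext j
        exact congrFun h0 j
      exact sub_eq_zero.1 h1
    have := le_dist_of_mem_frontier hY hx.1 hx le_rfl zero_lt_one
    simp [hxx] at this
    linarith
  refine ⟨hpos, ?_⟩
  have hle : ∀ x ∈ frontier Y, ‖(x - x₀).ofLp‖ ≤ D := by
    intro x hx
    have h1 : ‖(x - x₀).ofLp‖ ≤ ‖x - x₀‖ :=
      (pi_norm_le_iff_of_nonneg (norm_nonneg _)).2 fun j => PiLp.norm_apply_le (x - x₀) j
    have h2 := hD hx.1
    rw [Metric.mem_closedBall, dist_eq_norm] at h2
    exact h1.trans h2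
  have main : ∀ x ∈ frontier Y, ∀ x' ∈ frontier Y, ‖(x' - x₀).ofLp‖ ≤ ‖(x - x₀).ofLp‖ →
      dist x x' ≤ (√d * D ^ 2 / r + D) *
      dist (‖(x - x₀).ofLp‖⁻¹ • (x - x₀)) (‖(x' - x₀).ofLp‖⁻¹ • (x' - x₀)) := by
    intro x hx x' hx' hll
    set a := ‖(x - x₀).ofLp‖ with ha
    set a' := ‖(x' - x₀).ofLp‖ with ha'
    have hap : 0 < a := hpos x hx
    have hap' : 0 < a' := hpos x' hx'
    have haD : a ≤ D := hle x hx
    set z := a⁻¹ • (x - x₀) with hz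
    set z' := a'⁻¹ • (x' - x₀) with hz'
    have hxz : x = x₀ + a • z := by rw [hz, smul_inv_smul₀ hap.ne']; abel
    have hxz' : x' = x₀ + a' • z' := by rw [hz', smul_inv_smul₀ hap'.ne']; abel
    have hzn : ‖z‖ ≤ √d := by
      refine (norm_le_sqrt_mul_norm_ofLp z).trans (le_of_eq ?_)
      rw [hz, WithLp.ofLp_smul, norm_smul, ← ha, norm_inv, Real.norm_of_nonneg hap.le,
        inv_mul_cancel₀ hap.ne', mul_one]
    clear_value z z'
    have key : (a - a') * r ≤ D ^ 2 * dist z z' := by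
      rcases eq_or_lt_of_le hll with heq | hlt
      · rw [heq, sub_self, zero_mul]; positivity
      · have hs1 : a' / a < 1 := (div_lt_one hap).2 hlt
        -- The ratio `a' / a` selects the point `x₀ + a' z` of the segment, at the same sup-norm
        -- distance from `x₀` as `x'`.
        have h := le_dist_of_mem_frontier hY hx.1 hx' (s := a' / a) (by positivity) hs1
        have e : x' - ((a' / a) • x + (1 - a' / a) • x₀) = a' • (z' - z) := by
          rw [hxz, hxz', smul_add, smul_smul, div_mul_cancel₀ _ hap.ne', sub_smul, one_smul,
            smul_sub]
          abel
        rw [dist_eq_norm, e, norm_smul, Real.norm_of_nonneg hap'.le, ← dist_eq_norm,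
          dist_comm z' z] at h
        have h2 : (a - a') * r ≤ a * (a' * dist z z') := by
          calc (a - a') * r = a * ((1 - a' / a) * r) := by field_simp
            _ ≤ _ := by gcongr
        refine h2.trans ?_
        rw [← mul_assoc, sq]
        have : a' ≤ D := hll.trans haD
        have : 0 ≤ D := hap.le.trans haD
        gcongr
    have e2 : x - x' = (a - a') • z + a' • (z - z') := by
      conv_lhs => rw [hxz, hxz']
      rw [sub_smul, smul_sub]; abel
    have haa : 0 ≤ a - a' := sub_nonneg.2 hll
    have h3 : a - a' ≤ D ^ 2 / r * dist z z' := by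
      rw [div_mul_eq_mul_div, le_div_iff₀ hr]; exact key
    rw [dist_eq_norm, e2]
    refine (norm_add_le _ _).trans ?_
    rw [norm_smul, norm_smul, Real.norm_of_nonneg haa, Real.norm_of_nonneg hap'.le, ← dist_eq_norm]
    have h4 : (a - a') * ‖z‖ ≤ D ^ 2 / r * dist z z' * √d := by gcongr
    have h5 : a' * dist z z' ≤ D * dist z z' := by
      gcongr
      exact hll.trans haD
    calc (a - a') * ‖z‖ + a' * dist z z' ≤ D ^ 2 / r * dist z z' * √d + D * dist z z' :=
        add_le_add h4 h5
      _ = _ := by ring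
  intro x hx x' hx'
  rcases le_total ‖(x' - x₀).ofLp‖ ‖(x - x₀).ofLp‖ with h | h
  · exact main x hx x' hx' h
  · have := main x' hx' x hx h
    rwa [dist_comm x' x, dist_comm (‖(x' - x₀).ofLp‖⁻¹ • (x' - x₀))] at this

end StarShaped

theorem euclideanHausdorffMeasure_frontier_le_of_starConvex_ball {n : ℕ} {Y : Set (Space (n + 1))}
    {x₀ : Space (n + 1)} {r D : ℝ} (hr : 0 < r) (hD0 : 0 ≤ D)
    (hY : ∀ y ∈ Metric.ball x₀ r, StarConvex ℝ y Y) (hD : closure Y ⊆ Metric.closedBall x₀ D) :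
    μHE[n] (frontier Y) ≤
      ENNReal.ofReal (√(n + 1 : ℕ) * D ^ 2 / r + D) ^ n * μHE[n] (cubeBoundary (n + 1)) := by
  obtain ⟨hpos, hdist⟩ := frontier_dist_le_of_starConvex_ball hr hY hD
  have h0 : 0 ≤ √(n + 1 : ℕ) * D ^ 2 / r + D := by positivity
  refine euclideanHausdorffMeasure_le_of_dist_le (K := Real.toNNReal (√(n + 1 : ℕ) * D ^ 2 / r + D))
    (g := fun x => ‖(x - x₀).ofLp‖⁻¹ • (x - x₀)) ?_ ?_ n
  · intro x hx y hy
    rw [Real.coe_toNNReal _ h0]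
    exact hdist x hx y hy
  · intro x hx
    have h1 := hpos x hx
    change ‖(‖(x - x₀).ofLp‖⁻¹ • (x - x₀)).ofLp‖ = 1
    rw [WithLp.ofLp_smul, norm_smul, norm_inv, Real.norm_of_nonneg h1.le, inv_mul_cancel₀ h1.ne']

/-- With a single piece, the ball of centres itself lies in `T`. With at least two, the first step
of a path between distinct pieces provides a ball of radius `ϱ * diam T` in an intersection. -/
theorem ConnectedByStarShapedSets.exists_ball_subset {d : ℕ} {ϱ : ℝ} {T : Set (Space d)}
    (h : ConnectedByStarShapedSets ϱ T) (ho : IsOpen T) (hne : T.Nonempty) :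
    ∃ x, Metric.ball x (ϱ * Metric.diam T) ⊆ T := by
  obtain ⟨N, Y, -, hTY, hstar, hpath⟩ := h
  rw [ho.affineSpan_eq_top hne] at hstar hpath
  simp only [AffineSubspace.top_coe, Set.inter_univ, AffineSubspace.mem_top, true_and] at hstar hpath
  obtain ⟨z, hz⟩ := hne
  rw [hTY, Set.mem_iUnion] at hz
  obtain ⟨i, hi⟩ := hz
  by_cases hall : ∀ j, j = i
  · have hTi : T = Y i := by
      rw [hTY]
      refine subset_antisymm (Set.iUnion_subset fun j => by rw [hall j]) (Set.subset_iUnion Y i)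
    obtain ⟨x, hx⟩ := hstar i
    refine ⟨x, fun y hy => ?_⟩
    rw [hTi] at hy ⊢
    exact (hx y hy).mem ⟨z, hi⟩
  · push Not at hall
    obtain ⟨j, hj⟩ := hall
    rcases (hpath i j).cases_head with h | ⟨c, ⟨x, hx⟩, -⟩
    · exact absurd h.symm hj
    · refine ⟨x, fun y hy => ?_⟩
      rw [hTY]
      exact Set.mem_iUnion.2 ⟨i, (hx hy).1⟩

/-- The boundary of the union is covered by the boundaries of at most `ϱ⁻¹` pieces. For a piece of
diameter `D`, the radial projection with `r = ϱ D` has Lipschitz constant `κ D` for its inverse, and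
`D` is at most the diameter of `T`. -/
theorem exists_frontier_measure_le (n : ℕ) (hn : n ≠ 0) {ϱ : ℝ} (hϱ : 0 < ϱ) :
    ∃ K : ℝ, 0 < K ∧ ∀ T : Set (Space (n + 1)), ConnectedByStarShapedSets ϱ T → IsOpen T →
      Bornology.IsBounded T → T.Nonempty →
      μHE[n] (frontier T) ≤ ENNReal.ofReal (K * Metric.diam T ^ n) := by
  set Q := (μHE[n] (cubeBoundary (n + 1))).toReal with hQ
  set κ : ℝ := √(n + 1 : ℕ) / ϱ + 1 with hκ
  have hκ0 : 0 ≤ κ := by positivity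
  have hQ' : μHE[n] (cubeBoundary (n + 1)) = ENNReal.ofReal Q :=
    (ENNReal.ofReal_toReal (euclideanHausdorffMeasure_cubeBoundary_lt_top n).ne).symm
  have hQ0 : 0 ≤ Q := ENNReal.toReal_nonneg
  -- The added `1` gives strict positivity without having to show `Q > 0`.
  refine ⟨ϱ⁻¹ * (κ ^ n * Q) + 1, by positivity, ?_⟩
  intro T h ho hb hne
  obtain ⟨N, Y, hN, hTY, hstar, -⟩ := h
  rw [ho.affineSpan_eq_top hne] at hstar
  simp only [AffineSubspace.top_coe, Set.inter_univ, AffineSubspace.mem_top, true_and] at hstar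
  have hdT : 0 ≤ Metric.diam T := Metric.diam_nonneg
  have hYT : ∀ i, Y i ⊆ T := fun i => by rw [hTY]; exact Set.subset_iUnion Y i
  have hYi : ∀ i, μHE[n] (frontier (Y i)) ≤ ENNReal.ofReal ((κ * Metric.diam T) ^ n * Q) := by
    intro i
    have hYb := hb.subset (hYT i)
    -- A piece of zero diameter has an empty ball of centres and must be treated apart: it has at
    -- most one point, which is null because `n ≠ 0`.
    rcases eq_or_lt_of_le (Metric.diam_nonneg (s := Y i)) with h0 | hpos
    · have hsub : (Y i).Subsingleton := fun x hx y hy =>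
        dist_le_zero.1 (h0 ▸ Metric.dist_le_diam_of_mem hYb hx hy)
      have hnull : μHE[n] (frontier (Y i)) = 0 := by
        have h1 : frontier (Y i) ⊆ Y i := by
          rw [← hsub.finite.isClosed.closure_eq]
          exact frontier_subset_closure.trans (by rw [closure_closure])
        have h2 : (frontier (Y i)).Subsingleton := hsub.anti h1
        rw [Measure.euclideanHausdorffMeasure_def, Measure.smul_apply]
        have := Measure.nullSingletonClass_hausdorff (Space (n + 1)) (d := n)
          (by exact_mod_cast Nat.pos_of_ne_zero hn)
        rw [h2.measure_zero, smul_zero]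
      rw [hnull]
      exact zero_le
    · obtain ⟨x, hx⟩ := hstar i
      have hr : 0 < ϱ * Metric.diam (Y i) := by positivity
      have hYne : (Y i).Nonempty := by
        by_contra h
        rw [Set.not_nonempty_iff_eq_empty.1 h, Metric.diam_empty] at hpos
        exact lt_irrefl _ hpos
      have hxY : x ∈ Y i := (hx x (Metric.mem_ball_self hr)).mem hYne
      have hcl : closure (Y i) ⊆ Metric.closedBall x (Metric.diam (Y i)) :=
        closure_minimal (fun y hy => Metric.dist_le_diam_of_mem hYb hy hxY)
          Metric.isClosed_closedBall
      refine (euclideanHausdorffMeasure_frontier_le_of_starConvex_ball hr hpos.le hx hcl).trans ?_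
      rw [hQ', ENNReal.ofReal_mul (by positivity), ← ENNReal.ofReal_pow (by positivity)]
      gcongr
      have e : √(n + 1 : ℕ) * Metric.diam (Y i) ^ 2 / (ϱ * Metric.diam (Y i)) + Metric.diam (Y i) =
          κ * Metric.diam (Y i) := by
        rw [hκ]; field_simp
      rw [e]
      gcongr
      exact Metric.diam_mono (hYT i) hb
  have hfr : frontier T ⊆ ⋃ i, frontier (Y i) := by
    intro x hx
    have h1 : x ∈ ⋃ i, closure (Y i) := by
      rw [← closure_iUnion_of_finite, ← hTY]
      exact hx.1
    obtain ⟨i, hi⟩ := Set.mem_iUnion.1 h1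
    exact Set.mem_iUnion.2 ⟨i, hi, fun h => hx.2 (interior_mono (hYT i) h)⟩
  calc μHE[n] (frontier T) ≤ μHE[n] (⋃ i, frontier (Y i)) := measure_mono hfr
    _ ≤ ∑ i, μHE[n] (frontier (Y i)) := measure_iUnion_fintype_le _ _
    _ ≤ ∑ _i : Fin N, ENNReal.ofReal ((κ * Metric.diam T) ^ n * Q) :=
        Finset.sum_le_sum fun i _ => hYi i
    _ = ENNReal.ofReal (N * ((κ * Metric.diam T) ^ n * Q)) := by
        rw [Finset.sum_const, Finset.card_univ, Fintype.card_fin, nsmul_eq_mul,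
          ENNReal.ofReal_mul (Nat.cast_nonneg N), ENNReal.ofReal_natCast]
    _ ≤ _ := by
        refine ENNReal.ofReal_le_ofReal ?_
        rw [mul_pow]
        calc (N : ℝ) * (κ ^ n * Metric.diam T ^ n * Q)
            ≤ ϱ⁻¹ * (κ ^ n * Metric.diam T ^ n * Q) := by gcongr
          _ = ϱ⁻¹ * (κ ^ n * Q) * Metric.diam T ^ n := by ring
          _ ≤ _ := by gcongr; linarith

/-! ### Calculus of polynomial functions -/

/-- The `i`-th partial derivative. -/
noncomputable def partialDeriv {d : ℕ} (i : Fin d) (f : Space d → ℝ) : Space d → ℝ :=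
  fun x => fderiv ℝ f x (EuclideanSpace.single i 1)

theorem polySpace_mono {d m m' : ℕ} (h : m ≤ m') : polySpace d m ≤ polySpace d m' := by
  refine Submodule.map_mono fun p hp => ?_
  rw [MvPolynomial.mem_restrictTotalDegree] at hp ⊢
  omega

theorem polySpace_continuous {d m : ℕ} {p : Space d → ℝ} (hp : p ∈ polySpace d m) :
    Continuous p :=
  (polySpace_contDiff hp (n := 0)).continuous

theorem polySpace_differentiable {d m : ℕ} {p : Space d → ℝ} (hp : p ∈ polySpace d m) :
    Differentiable ℝ p :=
  (polySpace_contDiff hp (n := 1)).differentiable (by norm_num)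

theorem mem_polySpace_iff {d m : ℕ} {p : Space d → ℝ} :
    p ∈ polySpace d m ↔ ∃ q : MvPolynomial (Fin d) ℝ, q.totalDegree ≤ m ∧
      p = fun x : Space d => MvPolynomial.aeval (fun i => x i) q := by
  constructor
  · rintro ⟨q, hq, rfl⟩
    exact ⟨q, (MvPolynomial.mem_restrictTotalDegree _ _ _).1 hq, rfl⟩
  · rintro ⟨q, hq, rfl⟩
    exact ⟨q, (MvPolynomial.mem_restrictTotalDegree _ _ _).2 hq, rfl⟩

theorem contDiff_aeval {d : ℕ} (q : MvPolynomial (Fin d) ℝ) {n : WithTop ℕ∞} :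
    ContDiff ℝ n fun x : Space d => MvPolynomial.aeval (fun i => x i) q :=
  polySpace_contDiff (mem_polySpace_iff.2 ⟨q, le_rfl, rfl⟩)

theorem partialDeriv_aeval {d : ℕ} (i : Fin d) (q : MvPolynomial (Fin d) ℝ) :
    partialDeriv i (fun x : Space d => MvPolynomial.aeval (fun i => x i) q) =
      fun x : Space d => MvPolynomial.aeval (fun i => x i) (MvPolynomial.pderiv i q) := by
  have hd : ∀ q : MvPolynomial (Fin d) ℝ, Differentiable ℝ
      fun x : Space d => MvPolynomial.aeval (fun i => x i) q := fun q =>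
    (contDiff_aeval q (n := 1)).differentiable (by norm_num)
  ext x
  induction q using MvPolynomial.induction_on with
  | C a => simp [partialDeriv]
  | add p q hp hq =>
    simp only [partialDeriv, map_add] at hp hq ⊢
    rw [fderiv_fun_add (hd p x) (hd q x), ← hp, ← hq]
    rfl
  | mul_X p j hp =>
    simp only [partialDeriv, map_mul, MvPolynomial.aeval_X, Derivation.leibniz] at hp ⊢
    have hj : HasFDerivAt (fun x : Space d => x j) (EuclideanSpace.proj j : Space d →L[ℝ] ℝ) x :=
      (EuclideanSpace.proj j : Space d →L[ℝ] ℝ).hasFDerivAt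
    rw [((hd p x).hasFDerivAt.fun_mul hj).fderiv]
    simp only [map_add, smul_eq_mul, map_mul, MvPolynomial.aeval_X, MvPolynomial.pderiv_X,
      ← hp, add_apply, smul_apply]
    by_cases h : i = j
    · subst h; simp
    · simp [Ne.symm h]

theorem pderiv_mem_restrictTotalDegree {d m : ℕ} (i : Fin d) {q : MvPolynomial (Fin d) ℝ}
    (hq : q.totalDegree ≤ m) : (MvPolynomial.pderiv i q).totalDegree ≤ m - 1 := by
  rw [q.as_sum, map_sum]
  refine (MvPolynomial.totalDegree_finsetSum _ _).trans (Finset.sup_le fun s hs => ?_)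
  rw [MvPolynomial.pderiv_monomial]
  by_cases h0 : s i = 0
  · simp [h0]
  · refine (MvPolynomial.totalDegree_monomial_le _ _).trans ?_
    have h1 := (MvPolynomial.le_totalDegree hs).trans hq
    have h2 : s.degree ≤ m := h1
    change (s - Finsupp.single i 1).degree ≤ m - 1
    have h3 : (s - Finsupp.single i 1) + Finsupp.single i 1 = s :=
      tsub_add_cancel_of_le (Finsupp.single_le_iff.2 (Nat.one_le_iff_ne_zero.2 h0))
    have h4 := congrArg Finsupp.degree h3
    rw [map_add, Finsupp.degree_single] at h4
    omega

theorem partialDeriv_mem_polySpace {d m : ℕ} (i : Fin d) {p : Space d → ℝ}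
    (hp : p ∈ polySpace d m) : partialDeriv i p ∈ polySpace d (m - 1) := by
  obtain ⟨q, hq, rfl⟩ := mem_polySpace_iff.1 hp
  exact mem_polySpace_iff.2 ⟨_, pderiv_mem_restrictTotalDegree i hq, partialDeriv_aeval i q⟩

theorem inner_gradient_eq_sum {d : ℕ} (f : Space d → ℝ) (x v : Space d) :
    ⟪∇ f x, v⟫ = ∑ i, partialDeriv i f x * v i := by
  rw [inner_gradient_left]
  conv_lhs => rw [← (EuclideanSpace.basisFun (Fin d) ℝ).sum_repr v]
  simp [partialDeriv, mul_comm]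

theorem gradient_apply {d : ℕ} (f : Space d → ℝ) (x : Space d) (i : Fin d) :
    ∇ f x i = partialDeriv i f x := by
  have h := inner_gradient_eq_sum f x (EuclideanSpace.single i (1 : ℝ))
  rw [EuclideanSpace.inner_single_right] at h
  simpa using h

theorem inner_gradient_gradient {d : ℕ} (f g : Space d → ℝ) (x : Space d) :
    ⟪∇ f x, ∇ g x⟫ = ∑ i, partialDeriv i f x * partialDeriv i g x := by
  simp only [inner_gradient_eq_sum, gradient_apply]

theorem laplacian_eq_sum_partialDeriv {d : ℕ} {f : Space d → ℝ} (hf : ContDiff ℝ 2 f)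
    (x : Space d) : Laplacian.laplacian f x = ∑ i, partialDeriv i (partialDeriv i f) x := by
  rw [InnerProductSpace.laplacian_eq_iteratedFDeriv_orthonormalBasis f
    (EuclideanSpace.basisFun (Fin d) ℝ)]
  refine Finset.sum_congr rfl fun i _ => ?_
  rw [iteratedFDeriv_two_apply]
  have hd : DifferentiableAt ℝ (fderiv ℝ f) x :=
    ((hf.fderiv_right (m := 1) (by norm_num)).differentiable (by norm_num)).differentiableAt
  simp only [EuclideanSpace.basisFun_apply, Matrix.cons_val_zero, Matrix.cons_val_one]
  change _ = fderiv ℝ (fun y => fderiv ℝ f y (EuclideanSpace.single i 1)) x _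
  rw [fderiv_clm_apply hd (differentiableAt_const _)]
  simp

theorem partialDeriv_mul {d : ℕ} (i : Fin d) {f g : Space d → ℝ} (hf : Differentiable ℝ f)
    (hg : Differentiable ℝ g) (x : Space d) :
    partialDeriv i (fun x => f x * g x) x = partialDeriv i f x * g x + f x * partialDeriv i g x := by
  simp only [partialDeriv]
  rw [fderiv_fun_mul (hf x) (hg x)]
  simp
  ring

/-! ### Affine changes of variables -/

theorem partialDeriv_comp_affine {d : ℕ} (i : Fin d) {f : Space d → ℝ} (hf : Differentiable ℝ f)
    (c a : ℝ) (b x : Space d) :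
    partialDeriv i (fun x => c * f (b + a • x)) x = c * a * partialDeriv i f (b + a • x) := by
  have h : HasFDerivAt (fun x : Space d => b + a • x) (a • ContinuousLinearMap.id ℝ (Space d)) x :=
    ((hasFDerivAt_id x).const_smul a).const_add b
  have h2 := ((hf (b + a • x)).hasFDerivAt.comp x h).const_mul c
  simp only [partialDeriv]
  have h3 : fderiv ℝ (fun x => c * f (b + a • x)) x = _ := h2.fderiv
  rw [h3]
  simp [mul_assoc]

theorem comp_affine_mem_polySpace {d m : ℕ} {p : Space d → ℝ} (hp : p ∈ polySpace d m)
    (c a : ℝ) (b : Space d) : (fun x => c * p (b + a • x)) ∈ polySpace d m := by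
  obtain ⟨q, hq, rfl⟩ := mem_polySpace_iff.1 hp
  set L : Fin d → MvPolynomial (Fin d) ℝ := fun i =>
    MvPolynomial.C (b i) + MvPolynomial.C a * MvPolynomial.X i with hL
  have hLdeg : ∀ i, (L i).totalDegree ≤ 1 := by
    intro i
    refine (MvPolynomial.totalDegree_add _ _).trans (max_le (by simp) ?_)
    refine (MvPolynomial.totalDegree_mul _ _).trans ?_
    simp [MvPolynomial.totalDegree_X]
  refine mem_polySpace_iff.2 ⟨MvPolynomial.C c * MvPolynomial.aeval L q, ?_, ?_⟩
  · refine (MvPolynomial.totalDegree_mul _ _).trans ?_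
    rw [MvPolynomial.totalDegree_C, zero_add, q.as_sum, map_sum]
    refine (MvPolynomial.totalDegree_finsetSum _ _).trans (Finset.sup_le fun s hs => ?_)
    rw [MvPolynomial.aeval_monomial]
    refine (MvPolynomial.totalDegree_mul _ _).trans ?_
    rw [MvPolynomial.algebraMap_eq, MvPolynomial.totalDegree_C, zero_add, Finsupp.prod]
    refine (MvPolynomial.totalDegree_finsetProd _ _).trans ?_
    refine le_trans (Finset.sum_le_sum (g := fun i => s i) fun i _ => ?_)
      ((MvPolynomial.le_totalDegree hs).trans hq)
    refine (MvPolynomial.totalDegree_pow _ _).trans ?_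
    calc s i * (L i).totalDegree ≤ s i * 1 := Nat.mul_le_mul_left _ (hLdeg i)
      _ = s i := mul_one _
  · ext x
    rw [map_mul, MvPolynomial.aeval_C]
    congr 1
    rw [← AlgHom.comp_apply, MvPolynomial.comp_aeval]
    simp [hL]

/-! ### The Laplacian is onto -/

/-- The Laplacian of a polynomial. -/
noncomputable def mvLaplacian (d : ℕ) : MvPolynomial (Fin d) ℝ →ₗ[ℝ] MvPolynomial (Fin d) ℝ :=
  ∑ i, (MvPolynomial.pderiv i).toLinearMap ∘ₗ (MvPolynomial.pderiv i).toLinearMap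

theorem mvLaplacian_apply {d : ℕ} (q : MvPolynomial (Fin d) ℝ) :
    mvLaplacian d q = ∑ i, MvPolynomial.pderiv i (MvPolynomial.pderiv i q) := by
  simp [mvLaplacian]

theorem laplacian_aeval {d : ℕ} (q : MvPolynomial (Fin d) ℝ) (x : Space d) :
    Laplacian.laplacian (fun x : Space d => MvPolynomial.aeval (fun i => x i) q) x =
      MvPolynomial.aeval (fun i => x i) (mvLaplacian d q) := by
  rw [laplacian_eq_sum_partialDeriv (contDiff_aeval q), mvLaplacian_apply, map_sum]
  simp only [partialDeriv_aeval]

/-- Integrate twice in the variable `x_0`: the Laplacian of the resulting monomial is the given one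
plus terms whose degree in the other variables is lower by two. Induction is on that degree, bounded
by `N`. -/
theorem monomial_mem_map_mvLaplacian {n m : ℕ} (N : ℕ) :
    ∀ (s : Fin (n + 1) →₀ ℕ) (a : ℝ), s.degree ≤ m → s.degree - s 0 ≤ N →
      MvPolynomial.monomial s a ∈
        (MvPolynomial.restrictTotalDegree (Fin (n + 1)) ℝ (m + 2)).map (mvLaplacian (n + 1)) := by
  induction N using Nat.strong_induction_on with
  | _ N ih =>
  intro s a hs hN
  set t : Fin (n + 1) →₀ ℕ := s + Finsupp.single 0 2 with ht
  set b : ℝ := a / ((s 0 + 2) * (s 0 + 1)) with hb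
  have htdeg : t.degree = s.degree + 2 := by simp [ht]
  have h0 : MvPolynomial.pderiv 0 (MvPolynomial.pderiv 0 (MvPolynomial.monomial t b)) =
      MvPolynomial.monomial s a := by
    rw [MvPolynomial.pderiv_monomial, MvPolynomial.pderiv_monomial]
    have e1 : t - Finsupp.single 0 1 - Finsupp.single 0 1 = s := by
      ext j
      by_cases hj : j = 0
      · subst hj; simp [ht]
      · simp [ht, Ne.symm hj]
    rw [e1]
    congr 1
    simp [ht, hb]
    field_simp
  have hw : MvPolynomial.monomial t b ∈ MvPolynomial.restrictTotalDegree (Fin (n + 1)) ℝ (m + 2) := by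
    rw [MvPolynomial.mem_restrictTotalDegree]
    refine (MvPolynomial.totalDegree_monomial_le _ _).trans ?_
    change t.degree ≤ _
    omega
  have hsum := mvLaplacian_apply (MvPolynomial.monomial t b)
  rw [Fin.sum_univ_succ, h0] at hsum
  rw [← sub_eq_iff_eq_add] at hsum
  rw [← hsum]
  refine Submodule.sub_mem _ (Submodule.mem_map_of_mem hw) (Submodule.sum_mem _ fun j _ => ?_)
  rw [MvPolynomial.pderiv_monomial, MvPolynomial.pderiv_monomial]
  by_cases hj : 2 ≤ s j.succ
  · have e2 : (t - Finsupp.single j.succ 1 - Finsupp.single j.succ 1) + Finsupp.single j.succ 2 = t := by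
      ext i
      by_cases hi : j.succ = i
      · subst hi
        simp [ht]
        omega
      · simp [hi]
    have h1 := congrArg Finsupp.degree e2
    rw [map_add, Finsupp.degree_single] at h1
    have h2 : (t - Finsupp.single j.succ 1 - Finsupp.single j.succ 1 : Fin (n + 1) →₀ ℕ) 0 =
        s 0 + 2 := by
      simp [ht]
    have h3 : s 0 + s j.succ ≤ s.degree := by
      rw [Finsupp.degree_eq_sum, Fin.sum_univ_succ]
      have := Finset.single_le_sum (f := fun i : Fin n => s i.succ) (fun i _ => Nat.zero_le _)
        (Finset.mem_univ j)
      omega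
    exact ih (s.degree - s 0 - 2) (by omega) _ _ (by omega) (by omega)
  -- With exponent `0` or `1` in `x_j`, the second derivative vanishes; truncated subtraction of
  -- exponents is harmless since the coefficient is zero.
  · have hz : b * ↑(t j.succ) * ↑((t - Finsupp.single j.succ 1 : Fin (n + 1) →₀ ℕ) j.succ) = 0 := by
      have h4 : t j.succ = s j.succ := by simp [ht]
      rw [Finsupp.tsub_apply, Finsupp.single_eq_same, h4]
      have : s j.succ = 0 ∨ s j.succ = 1 := by omega
      rcases this with h | h <;> simp [h]
    rw [hz, MvPolynomial.monomial_zero]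
    exact Submodule.zero_mem _

/-- With `m = l = k - 1`, the preimage has degree at most `k + 1`, exactly the degree of the test
functions in the definition of the reconstruction. -/
theorem exists_laplacian_eq {n m : ℕ} {g : Space (n + 1) → ℝ} (hg : g ∈ polySpace (n + 1) m) :
    ∃ w ∈ polySpace (n + 1) (m + 2), ∀ x, Laplacian.laplacian w x = g x := by
  obtain ⟨q, hq, rfl⟩ := mem_polySpace_iff.1 hg
  have hmem : q ∈ (MvPolynomial.restrictTotalDegree (Fin (n + 1)) ℝ (m + 2)).map
      (mvLaplacian (n + 1)) := by
    rw [q.as_sum]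
    exact Submodule.sum_mem _ fun s hs => monomial_mem_map_mvLaplacian _ s _
      ((MvPolynomial.le_totalDegree hs).trans hq) le_rfl
  obtain ⟨w, hw, hwq⟩ := hmem
  refine ⟨_, mem_polySpace_iff.2 ⟨w, (MvPolynomial.mem_restrictTotalDegree _ _ _).1 hw, rfl⟩,
    fun x => ?_⟩
  rw [laplacian_aeval, hwq]

/-! ### Norm equivalences for polynomials on balls -/

theorem integrableOn_ball {d : ℕ} {f : Space d → ℝ} (hf : Continuous f) (x : Space d) (r : ℝ) :
    IntegrableOn f (Metric.ball x r) :=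
  integrable_of_poly Metric.isBounded_ball Metric.isOpen_ball.measurableSet
    measure_ball_lt_top.ne hf

theorem eq_zero_of_integral_sq_ball_eq_zero {d m : ℕ} {p : Space d → ℝ} (hp : p ∈ polySpace d m)
    {r : ℝ} (hr : 0 < r) (h : ∫ x in Metric.ball (0 : Space d) r, p x * p x = 0) : p = 0 := by
  have hc := polySpace_continuous hp
  rw [integral_eq_zero_iff_of_nonneg (fun x => mul_self_nonneg _)
    (integrableOn_ball (hc.mul hc) 0 r)] at h
  have h0 : Set.EqOn p 0 (Metric.ball 0 r) := by
    refine Measure.eqOn_open_of_ae_eq (μ := volume) ?_ Metric.isOpen_ball hc.continuousOn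
      continuousOn_const
    filter_upwards [h] with x hx
    exact mul_self_eq_zero.1 hx
  have han : AnalyticOnNhd ℝ p Set.univ := fun x _ =>
    ((polySpace_contDiff hp (n := ⊤)).contDiffAt (x := x)).analyticAt
  have hev : p =ᶠ[𝓝 (0 : Space d)] 0 := by
    filter_upwards [Metric.ball_mem_nhds (0 : Space d) hr] with x hx
    exact h0 hx
  exact han.eq_of_eventuallyEq (fun x _ => analyticAt_const) hev

/-- The `L²` product on a ball is definite on polynomials, so each coordinate functional is the
product with some `p j`; Cauchy–Schwarz then bounds the coordinate. -/
theorem exists_sum_sq_repr_le (d m : ℕ) {r : ℝ} (hr : 0 < r) :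
    ∃ C : ℝ, 0 < C ∧ ∀ q : polySpace d m,
      ∑ j, (Module.finBasis ℝ (polySpace d m)).repr q j ^ 2 ≤
        C * ∫ x in Metric.ball (0 : Space d) r, q.1 x * q.1 x := by
  have hI : ∀ {f : Space d → ℝ}, Continuous f →
      Integrable f (volume.restrict (Metric.ball (0 : Space d) r)) :=
    fun hf => integrableOn_ball hf 0 r
  have hc : ∀ w : polySpace d m, Continuous (w : Space d → ℝ) := fun w => polySpace_continuous w.2
  let B : polySpace d m →ₗ[ℝ] polySpace d m →ₗ[ℝ] ℝ := LinearMap.mk₂ ℝ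
    (fun p w => ∫ x in Metric.ball (0 : Space d) r, p.1 x * w.1 x)
    (fun p p' w => by
      rw [← integral_add (hI ((hc p).fun_mul (hc w))) (hI ((hc p').fun_mul (hc w)))]
      simp [add_mul])
    (fun a p w => by rw [smul_eq_mul, ← integral_const_mul]; simp [mul_assoc])
    (fun p w w' => by
      rw [← integral_add (hI ((hc p).fun_mul (hc w))) (hI ((hc p).fun_mul (hc w')))]
      simp [mul_add])
    (fun a p w => by rw [smul_eq_mul, ← integral_const_mul]; simp [mul_left_comm])
  have hsymm : ∀ x y, B x y = B y x := fun x y => by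
    simp only [B, LinearMap.mk₂_apply, mul_comm]
  have hnonneg : ∀ x, 0 ≤ B x x := fun x => integral_nonneg fun _ => mul_self_nonneg _
  have hex : ∀ j, ∃ p, ∀ w, B p w = (Module.finBasis ℝ (polySpace d m)).coord j w := fun j =>
    exists_of_psd B hsymm _ fun v hv => by
      have : v = 0 := Subtype.ext (eq_zero_of_integral_sq_ball_eq_zero v.2 hr hv)
      rw [this, map_zero]
  choose p hp using hex
  refine ⟨∑ j, B (p j) (p j) + 1,
    add_pos_of_nonneg_of_pos (Finset.sum_nonneg fun j _ => hnonneg _) one_pos, fun q => ?_⟩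
  have hj : ∀ j, (Module.finBasis ℝ (polySpace d m)).repr q j ^ 2 ≤ B (p j) (p j) * B q q := by
    intro j
    rw [← Module.Basis.coord_apply, ← hp j q]
    have := LinearMap.BilinForm.apply_mul_apply_le_of_forall_zero_le B hnonneg (p j) q
    rwa [hsymm q, ← sq] at this
  calc _ ≤ ∑ j, B (p j) (p j) * B q q := Finset.sum_le_sum fun j _ => hj j
    _ = (∑ j, B (p j) (p j)) * B q q := (Finset.sum_mul _ _ _).symm
    _ ≤ (∑ j, B (p j) (p j) + 1) * B q q := by
        have := hnonneg q
        nlinarith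

theorem finBasis_sum_repr_apply {d m : ℕ} (q : polySpace d m) (x : Space d) :
    q.1 x = ∑ j, (Module.finBasis ℝ (polySpace d m)).repr q j *
      (Module.finBasis ℝ (polySpace d m) j).1 x := by
  conv_lhs => rw [← (Module.finBasis ℝ (polySpace d m)).sum_repr q]
  simp only [AddSubmonoidClass.coe_finsetSum, Submodule.coe_smul, Finset.sum_apply,
    Pi.smul_apply, smul_eq_mul]

/-- Expand in the basis and apply Cauchy–Schwarz: the coordinates are controlled on the small ball,
the basis functions on the compact unit ball. -/
theorem exists_sq_le_integral_ball (d m : ℕ) {r : ℝ} (hr : 0 < r) :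
    ∃ C : ℝ, 0 < C ∧ ∀ q ∈ polySpace d m, ∀ x ∈ Metric.closedBall (0 : Space d) 1,
      q x ^ 2 ≤ C * ∫ x in Metric.ball (0 : Space d) r, q x * q x := by
  obtain ⟨C, hC, hq⟩ := exists_sum_sq_repr_le d m hr
  set b := Module.finBasis ℝ (polySpace d m)
  have hcont : Continuous fun x : Space d => ∑ j, (b j).1 x ^ 2 :=
    continuous_finsetSum _ fun j _ => (polySpace_continuous (b j).2).pow 2
  obtain ⟨A, hA⟩ := (isCompact_closedBall (0 : Space d) 1).exists_bound_of_continuousOn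
    hcont.continuousOn
  refine ⟨(|A| + 1) * C, by positivity, fun q hqm x hx => ?_⟩
  have hrepr : q x = ∑ j, b.repr ⟨q, hqm⟩ j * (b j).1 x :=
    finBasis_sum_repr_apply ⟨q, hqm⟩ x
  have h2 := hq ⟨q, hqm⟩
  have h3 : ∑ j, (b j).1 x ^ 2 ≤ |A| + 1 := by
    have := hA x hx
    rw [Real.norm_eq_abs] at this
    linarith [le_abs_self (∑ j, (b j).1 x ^ 2), le_abs_self A]
  have h4 : 0 ≤ C * ∫ x in Metric.ball (0 : Space d) r, q x * q x :=
    mul_nonneg hC.le (integral_nonneg fun _ => mul_self_nonneg _)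
  rw [hrepr]
  calc _ ≤ (∑ j, b.repr ⟨q, hqm⟩ j ^ 2) * ∑ j, (b j).1 x ^ 2 :=
        Finset.sum_mul_sq_le_sq_mul_sq _ _ _
    _ ≤ (C * ∫ x in Metric.ball (0 : Space d) r, q x * q x) * (|A| + 1) :=
        mul_le_mul h2 h3 (Finset.sum_nonneg fun _ _ => sq_nonneg _) h4
    _ = _ := by ring

theorem partialDeriv_sum {d m : ℕ} {ι : Type*} (s : Finset ι) (c : ι → ℝ) {f : ι → Space d → ℝ}
    (hf : ∀ j, f j ∈ polySpace d m) (i : Fin d) (x : Space d) :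
    partialDeriv i (∑ j ∈ s, c j • f j) x = ∑ j ∈ s, c j * partialDeriv i (f j) x := by
  have h : HasFDerivAt (∑ j ∈ s, c j • f j) (∑ j ∈ s, c j • fderiv ℝ (f j) x) x :=
    HasFDerivAt.sum fun j _ => ((polySpace_differentiable (hf j) x).hasFDerivAt).const_smul (c j)
  rw [partialDeriv, h.fderiv]
  simp [partialDeriv]

/-- A bounded right inverse of the Laplacian: preimages of the basis elements are fixed once and for
all and combined with the coordinates of `g`. -/
theorem exists_laplacian_eq_bound (n m : ℕ) {r : ℝ} (hr : 0 < r) :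
    ∃ C : ℝ, 0 < C ∧ ∀ g ∈ polySpace (n + 1) m, ∃ w ∈ polySpace (n + 1) (m + 2),
      (∀ x, ∑ i, partialDeriv i (partialDeriv i w) x = g x) ∧
      ∀ x ∈ Metric.closedBall (0 : Space (n + 1)) 1, ∀ i, partialDeriv i w x ^ 2 ≤
        C * ∫ x in Metric.ball (0 : Space (n + 1)) r, g x * g x := by
  obtain ⟨C, hC, hq⟩ := exists_sum_sq_repr_le (n + 1) m hr
  set b := Module.finBasis ℝ (polySpace (n + 1) m)
  choose w hw hwb using fun j => exists_laplacian_eq (b j).2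
  have hd : ∀ i j, partialDeriv i (w j) ∈ polySpace (n + 1) (m + 2 - 1) := fun i j =>
    partialDeriv_mem_polySpace i (hw j)
  have hcont : Continuous fun x : Space (n + 1) => ∑ i, ∑ j, partialDeriv i (w j) x ^ 2 :=
    continuous_finsetSum _ fun i _ => continuous_finsetSum _ fun j _ =>
      (polySpace_continuous (hd i j)).pow 2
  obtain ⟨A, hA⟩ := (isCompact_closedBall (0 : Space (n + 1)) 1).exists_bound_of_continuousOn
    hcont.continuousOn
  refine ⟨(|A| + 1) * C, by positivity, fun g hg => ?_⟩
  set c := b.repr ⟨g, hg⟩ with hc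
  have hder : ∀ i x, partialDeriv i (∑ j, c j • w j) x = ∑ j, c j * partialDeriv i (w j) x :=
    fun i x => partialDeriv_sum _ _ hw i x
  refine ⟨∑ j, c j • w j, Submodule.sum_mem _ fun j _ => Submodule.smul_mem _ _ (hw j),
    fun x => ?_, fun x hx i => ?_⟩
  · have h2 : g x = ∑ j, c j * (b j).1 x := finBasis_sum_repr_apply ⟨g, hg⟩ x
    have h3 : ∀ i, partialDeriv i (∑ j, c j • w j) = ∑ j, c j • partialDeriv i (w j) := fun i => by
      ext y
      rw [hder]
      simp
    simp only [h3]
    rw [Finset.sum_congr rfl fun i _ => partialDeriv_sum _ _ (hd i) i x, Finset.sum_comm, h2]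
    refine Finset.sum_congr rfl fun j _ => ?_
    rw [← Finset.mul_sum, ← laplacian_eq_sum_partialDeriv (polySpace_contDiff (hw j)), hwb]
  · have h2 := hq ⟨g, hg⟩
    have h3 : ∑ j, partialDeriv i (w j) x ^ 2 ≤ |A| + 1 := by
      have := hA x hx
      rw [Real.norm_eq_abs] at this
      have h5 := Finset.single_le_sum (f := fun i => ∑ j, partialDeriv i (w j) x ^ 2)
        (fun i _ => Finset.sum_nonneg fun j _ => sq_nonneg _) (Finset.mem_univ i)
      linarith [le_abs_self (∑ i, ∑ j, partialDeriv i (w j) x ^ 2), le_abs_self A]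
    have h4 : 0 ≤ C * ∫ x in Metric.ball (0 : Space (n + 1)) r, g x * g x :=
      mul_nonneg hC.le (integral_nonneg fun _ => mul_self_nonneg _)
    rw [hder]
    calc _ ≤ (∑ j, c j ^ 2) * ∑ j, partialDeriv i (w j) x ^ 2 :=
          Finset.sum_mul_sq_le_sq_mul_sq _ _ _
      _ ≤ (C * ∫ x in Metric.ball (0 : Space (n + 1)) r, g x * g x) * (|A| + 1) :=
          mul_le_mul h2 h3 (Finset.sum_nonneg fun _ _ => sq_nonneg _) h4
      _ = _ := by ring

/-! ### Scaling -/

theorem integral_ball_comp_affine {d : ℕ} (f : Space d → ℝ) (x₀ : Space d) {h : ℝ} (hh : 0 < h)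
    (r : ℝ) : ∫ x in Metric.ball (0 : Space d) r, f (x₀ + h • x) =
      (h ^ d)⁻¹ * ∫ x in Metric.ball x₀ (r * h), f x := by
  rw [Measure.setIntegral_comp_smul_of_pos volume (fun x => f (x₀ + x)) _ hh, smul_eq_mul,
    finrank_euclideanSpace_fin, smul_ball hh.ne', smul_zero, Real.norm_of_nonneg hh.le, mul_comm h r]
  congr 1
  have hpre : (fun x => x₀ + x) ⁻¹' Metric.ball x₀ (r * h) = Metric.ball 0 (r * h) := by
    ext x
    simp [dist_eq_norm]
  rw [← hpre, (measurePreserving_add_left volume x₀).setIntegral_preimage_emb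
    (measurableEmbedding_addLeft x₀)]

/-- The small ball will lie inside an element and the large one will contain it. The estimate serves
both for the Poincaré inequality, applied to derivatives, and for the discrete trace inequality. -/
theorem exists_sq_le_integral (d m : ℕ) {r : ℝ} (hr : 0 < r) :
    ∃ C : ℝ, 0 < C ∧ ∀ (x₀ : Space d) (h : ℝ), 0 < h → ∀ q ∈ polySpace d m,
      ∀ x ∈ Metric.closedBall x₀ h,
      q x ^ 2 ≤ C * (h ^ d)⁻¹ * ∫ x in Metric.ball x₀ (r * h), q x * q x := by
  obtain ⟨C, hC, H⟩ := exists_sq_le_integral_ball d m hr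
  refine ⟨C, hC, fun x₀ h hh q hq x hx => ?_⟩
  have h1 := H _ (comp_affine_mem_polySpace hq 1 h x₀) (h⁻¹ • (x - x₀)) (by
    rw [mem_closedBall_zero_iff, norm_smul, norm_inv, Real.norm_of_nonneg hh.le, ← dist_eq_norm,
      inv_mul_le_one₀ hh]
    exact hx)
  simp only [one_mul, smul_inv_smul₀ hh.ne', add_sub_cancel] at h1
  rwa [integral_ball_comp_affine (fun x => q x * q x) x₀ hh, ← mul_assoc] at h1

theorem exists_laplacian_eq_scaled (n m : ℕ) {r : ℝ} (hr : 0 < r) :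
    ∃ C : ℝ, 0 < C ∧ ∀ (x₀ : Space (n + 1)) (h : ℝ), 0 < h → ∀ g ∈ polySpace (n + 1) m,
      ∃ w ∈ polySpace (n + 1) (m + 2), (∀ x, ∑ i, partialDeriv i (partialDeriv i w) x = g x) ∧
      ∀ x ∈ Metric.closedBall x₀ h, ∀ i, partialDeriv i w x ^ 2 ≤
        C * h ^ 2 * (h ^ (n + 1))⁻¹ * ∫ x in Metric.ball x₀ (r * h), g x * g x := by
  obtain ⟨C, hC, H⟩ := exists_laplacian_eq_bound n m hr
  refine ⟨C, hC, fun x₀ h hh g hg => ?_⟩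
  obtain ⟨w, hw, hwg, hwb⟩ := H _ (comp_affine_mem_polySpace hg 1 h x₀)
  set b : Space (n + 1) := -(h⁻¹ • x₀) with hb
  have hpt : ∀ x, b + h⁻¹ • x = h⁻¹ • (x - x₀) := fun x => by rw [hb, smul_sub]; abel
  have e1 : ∀ i, partialDeriv i (fun x => h ^ 2 * w (b + h⁻¹ • x)) =
      fun x => h * partialDeriv i w (b + h⁻¹ • x) := fun i => by
    ext x
    rw [partialDeriv_comp_affine i (polySpace_differentiable hw), sq, mul_inv_cancel_right₀ hh.ne']
  -- The factor `h ^ 2` compensates the two derivatives in the Laplacian; one factor `h` survives in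
  -- the gradient, hence `h ^ 2` in the squared bound.
  refine ⟨_, comp_affine_mem_polySpace hw (h ^ 2) h⁻¹ b, fun x => ?_, fun x hx i => ?_⟩
  · simp only [e1]
    rw [Finset.sum_congr rfl fun i _ => partialDeriv_comp_affine i
      (polySpace_differentiable (partialDeriv_mem_polySpace i hw)) _ _ _ _]
    simp only [mul_inv_cancel₀ hh.ne', one_mul]
    rw [hwg, hpt, smul_inv_smul₀ hh.ne', add_sub_cancel, one_mul]
  · rw [e1]
    simp only [hpt, mul_pow]
    have h1 := hwb (h⁻¹ • (x - x₀)) (by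
      rw [mem_closedBall_zero_iff, norm_smul, norm_inv, Real.norm_of_nonneg hh.le, ← dist_eq_norm,
        inv_mul_le_one₀ hh]
      exact hx) i
    simp only [one_mul] at h1
    rw [integral_ball_comp_affine (fun x => g x * g x) x₀ hh] at h1
    calc _ ≤ h ^ 2 * (C * ((h ^ (n + 1))⁻¹ * ∫ x in Metric.ball x₀ (r * h), g x * g x)) := by
          gcongr
      _ = _ := by ring

/-! ### Green's formula and the error identity -/

theorem norm_gradient_sq {d : ℕ} (f : Space d → ℝ) (x : Space d) :
    ‖∇ f x‖ ^ 2 = ∑ i, partialDeriv i f x ^ 2 := by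
  rw [← real_inner_self_eq_norm_sq, inner_gradient_gradient]
  simp only [sq]

theorem inner_gradient_mem_polySpace {d m : ℕ} {w : Space d → ℝ} (hw : w ∈ polySpace d m)
    (v : Space d) : (fun x => ⟪∇ w x, v⟫) ∈ polySpace d (m - 1) := by
  have h : (fun x => ⟪∇ w x, v⟫) = ∑ i, v i • partialDeriv i w := by
    ext x
    rw [inner_gradient_eq_sum]
    simp [mul_comm]
  rw [h]
  exact Submodule.sum_mem _ fun i _ => Submodule.smul_mem _ _ (partialDeriv_mem_polySpace i hw)

theorem IsPolytope.integrableOn {d : ℕ} {T : Set (Space d)} (hT : IsPolytope T) {f : Space d → ℝ}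
    (hf : Continuous f) : IntegrableOn f T :=
  integrable_of_poly hT.isBounded hT.isOpen.measurableSet hT.isBounded.measure_lt_top.ne hf

namespace PolytopalMesh

theorem integrableOn_face {n : ℕ} {Ω : Set (Space (n + 1))} (M : PolytopalMesh Ω)
    {T F : Set (Space (n + 1))} (hT : T ∈ M.elements) (hF : F ∈ M.facesOf T)
    {f : Space (n + 1) → ℝ} (hf : Continuous f) : IntegrableOn f F μHE[n] := by
  obtain ⟨h1, h2⟩ := M.isBounded_face hT hF
  exact integrable_of_poly h2 h1.measurableSet (h1.measure_ne_top h2) hf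

theorem bdryDifference_eq {d : ℕ} {Ω : Set (Space d)} (M : PolytopalMesh Ω) {T F : Set (Space d)}
    (hF : F ∈ M.facesOf T) (k : ℕ) (v : (Space d → ℝ) × (Space d → ℝ)) {x : Space d} (hx : x ∈ F) :
    M.bdryDifference T k v x = faceProjection F k (M.potentialReconstruction T k v - v.2) x := by
  rw [bdryDifference, bdryProjection, Finset.sum_eq_single_of_mem F hF, Set.indicator_of_mem hx]
  intro F' hF' hne
  refine Set.indicator_of_notMem (fun h => ?_) _
  exact Set.disjoint_left.1
    (M.faces_disjoint F' (M.mem_facesOf.1 hF').1 F (M.mem_facesOf.1 hF).1 hne) h hx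

variable {n : ℕ} {Ω : Set (Space (n + 1))}

/-- The divergence theorem is applied to `p ∂_i w` in the direction `i`, and the results are summed
over `i`. -/
theorem green_formula (M : PolytopalMesh Ω) (hΩ : IsPolytope Ω) {T : Set (Space (n + 1))}
    (hT : T ∈ M.elements) {m m' : ℕ} {p w : Space (n + 1) → ℝ} (hp : p ∈ polySpace (n + 1) m)
    (hw : w ∈ polySpace (n + 1) m') :
    (∫ x in T, ⟪∇ p x, ∇ w x⟫) + ∫ x in T, p x * Laplacian.laplacian w x =
      ∑ F ∈ M.facesOf T, ∫ x in F, p x * ⟪∇ w x, M.normal T F⟫ ∂μHE[n] := by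
  have hpoly := M.isPolytope_of_mem T hT
  have hw1 : ∀ i, partialDeriv i w ∈ polySpace (n + 1) (m' - 1) := fun i =>
    partialDeriv_mem_polySpace i hw
  have hw2 : ∀ i, partialDeriv i (partialDeriv i w) ∈ polySpace (n + 1) (m' - 1 - 1) := fun i =>
    partialDeriv_mem_polySpace i (hw1 i)
  have hp1 : ∀ i, partialDeriv i p ∈ polySpace (n + 1) (m - 1) := fun i =>
    partialDeriv_mem_polySpace i hp
  have hc1 : ∀ i, Continuous fun x => partialDeriv i p x * partialDeriv i w x := fun i =>
    (polySpace_continuous (hp1 i)).mul (polySpace_continuous (hw1 i))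
  have hc2 : ∀ i, Continuous fun x => p x * partialDeriv i (partialDeriv i w) x := fun i =>
    (polySpace_continuous hp).mul (polySpace_continuous (hw2 i))
  simp only [inner_gradient_gradient, laplacian_eq_sum_partialDeriv (polySpace_contDiff hw),
    Finset.mul_sum]
  rw [integral_finsetSum _ fun i _ => hpoly.integrableOn (hc1 i),
    integral_finsetSum _ fun i _ => hpoly.integrableOn (hc2 i), ← Finset.sum_add_distrib]
  have key : ∀ i, (∫ x in T, partialDeriv i p x * partialDeriv i w x) +
      ∫ x in T, p x * partialDeriv i (partialDeriv i w) x =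
      ∑ F ∈ M.facesOf T, M.normal T F i * ∫ x in F, p x * partialDeriv i w x ∂μHE[n] := by
    intro i
    rw [← M.setIntegral_fderiv_single hΩ hT i
      ((polySpace_contDiff hp (n := 1)).mul (polySpace_contDiff (hw1 i) (n := 1))),
      ← integral_add (hpoly.integrableOn (hc1 i)) (hpoly.integrableOn (hc2 i))]
    refine integral_congr_ae (Eventually.of_forall fun x => ?_)
    exact (partialDeriv_mul i (polySpace_differentiable hp) (polySpace_differentiable (hw1 i)) x).symm
  rw [Finset.sum_congr rfl fun i _ => key i, Finset.sum_comm]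
  refine Finset.sum_congr rfl fun F hF => ?_
  have hcF : ∀ i, Continuous fun x => p x * partialDeriv i w x := fun i =>
    (polySpace_continuous hp).mul (polySpace_continuous (hw1 i))
  simp only [← integral_const_mul]
  rw [← integral_finsetSum _ fun i _ => (M.integrableOn_face hT hF (hcF i)).const_mul _]
  refine integral_congr_ae (Eventually.of_forall fun x => ?_)
  simp only [inner_gradient_eq_sum, Finset.mul_sum]
  exact Finset.sum_congr rfl fun i _ => by ring

/-- Subtracting the definition of the reconstruction from Green's formula for `p` leaves `p - v_∂T`
tested against `∇w·n` on the faces. That function has degree at most `k`, so `p - v_∂T` may be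
replaced by its projection. -/
theorem integral_sub_mul_laplacian (M : PolytopalMesh Ω) (hΩ : IsPolytope Ω)
    {T : Set (Space (n + 1))} (hT : T ∈ M.elements) {k l : ℕ}
    {v : (Space (n + 1) → ℝ) × (Space (n + 1) → ℝ)} (hv : v ∈ M.localSpace T k l)
    {w : Space (n + 1) → ℝ} (hw : w ∈ polySpace (n + 1) (k + 1)) :
    ∫ x in T, (M.potentialReconstruction T k v x - v.1 x) * Laplacian.laplacian w x =
      ∑ F ∈ M.facesOf T, ∫ x in F, M.bdryDifference T k v x * ⟪∇ w x, M.normal T F⟫ ∂μHE[n] := by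
  set p := M.potentialReconstruction T k v with hpdef
  have hpoly := M.isPolytope_of_mem T hT
  have hrec := M.isPotentialReconstruction hT k l hv
  have hp : p ∈ polySpace (n + 1) (k + 1) := hrec.1
  have hr : (∫ x in T, ⟪∇ p x, ∇ w x⟫) = -(∫ x in T, v.1 x * Laplacian.laplacian w x) +
      ∑ F ∈ M.facesOf T, ∫ x in F, v.2 x * ⟪∇ w x, M.normal T F⟫ ∂μHE[n] := hrec.2.1 w hw
  have hg := M.green_formula hΩ hT hp hw
  have hlc : Continuous (Laplacian.laplacian w) := by
    have : Laplacian.laplacian w = fun x => ∑ i, partialDeriv i (partialDeriv i w) x :=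
      funext fun x => laplacian_eq_sum_partialDeriv (polySpace_contDiff hw) x
    rw [this]
    exact continuous_finsetSum _ fun i _ => polySpace_continuous
      (partialDeriv_mem_polySpace i (partialDeriv_mem_polySpace i hw))
  have e1 : ∫ x in T, (p x - v.1 x) * Laplacian.laplacian w x =
      (∫ x in T, p x * Laplacian.laplacian w x) - ∫ x in T, v.1 x * Laplacian.laplacian w x := by
    rw [← integral_sub (hpoly.integrableOn ((polySpace_continuous hp).fun_mul hlc))
      (hpoly.integrableOn ((polySpace_continuous hv.1).fun_mul hlc))]
    simp only [sub_mul]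
  have e2 : ∀ F ∈ M.facesOf T,
      (∫ x in F, p x * ⟪∇ w x, M.normal T F⟫ ∂μHE[n]) -
        ∫ x in F, v.2 x * ⟪∇ w x, M.normal T F⟫ ∂μHE[n] =
      ∫ x in F, M.bdryDifference T k v x * ⟪∇ w x, M.normal T F⟫ ∂μHE[n] := by
    intro F hF
    have hm := (M.isBounded_face hT hF).1.measurableSet
    obtain ⟨q, hq, hvq⟩ := hv.2 F hF
    have hwn := inner_gradient_mem_polySpace hw (M.normal T F)
    have hproj : ∫ x in F, faceProjection F k (p - v.2) x * ⟪∇ w x, M.normal T F⟫ ∂μHE[n] =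
        ∫ x in F, (p - v.2) x * ⟪∇ w x, M.normal T F⟫ ∂μHE[n] :=
      (M.isL2Projection_face hT k l hv hF).2 _ hwn
    have h1 : ∫ x in F, M.bdryDifference T k v x * ⟪∇ w x, M.normal T F⟫ ∂μHE[n] =
        ∫ x in F, faceProjection F k (p - v.2) x * ⟪∇ w x, M.normal T F⟫ ∂μHE[n] :=
      setIntegral_congr_fun hm fun x hx => by simp only [M.bdryDifference_eq hF k v hx, hpdef]
    rw [h1]
    refine Eq.trans ?_ hproj.symm
    have h2 : ∫ x in F, v.2 x * ⟪∇ w x, M.normal T F⟫ ∂μHE[n] =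
        ∫ x in F, q x * ⟪∇ w x, M.normal T F⟫ ∂μHE[n] :=
      setIntegral_congr_fun hm fun x hx => by simp only [hvq hx]
    rw [h2, ← integral_sub
      (M.integrableOn_face hT hF ((polySpace_continuous hp).fun_mul (polySpace_continuous hwn)))
      (M.integrableOn_face hT hF ((polySpace_continuous hq).fun_mul (polySpace_continuous hwn)))]
    exact setIntegral_congr_fun hm fun x hx => by simp only [Pi.sub_apply, hvq hx, sub_mul]
  rw [e1, ← Finset.sum_congr rfl e2, Finset.sum_sub_distrib]
  linarith

/-- As `l ≤ k`, the function `v_∂T - v_T` is itself an admissible test function for the projector.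
Testing with it gives `‖v_∂T - v_T‖² = (v_∂T - v_T, p - v_T - δ)`, and Young's inequality absorbs
half of the left-hand side. -/
theorem setIntegral_face_sq_le (M : PolytopalMesh Ω)
    {T F : Set (Space (n + 1))} (hT : T ∈ M.elements) (hF : F ∈ M.facesOf T) {k l : ℕ}
    (hlk : l ≤ k) {v : (Space (n + 1) → ℝ) × (Space (n + 1) → ℝ)} (hv : v ∈ M.localSpace T k l) :
    ∫ x in F, (v.2 x - v.1 x) ^ 2 ∂μHE[n] ≤
      2 * (∫ x in F, M.bdryDifference T k v x ^ 2 ∂μHE[n]) +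
        2 * ∫ x in F, (M.potentialReconstruction T k v x - v.1 x) ^ 2 ∂μHE[n] := by
  set p := M.potentialReconstruction T k v with hpdef
  have hp : p ∈ polySpace (n + 1) (k + 1) := (M.isPotentialReconstruction hT k l hv).1
  have hm := (M.isBounded_face hT hF).1.measurableSet
  obtain ⟨q, hq, hvq⟩ := hv.2 F hF
  set g := faceProjection F k (p - v.2) with hgdef
  have hg : g ∈ polySpace (n + 1) k := (M.isL2Projection_face hT k l hv hF).1
  have hproj : ∀ w ∈ polySpace (n + 1) k, ∫ x in F, g x * w x ∂μHE[n] =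
      ∫ x in F, (p - v.2) x * w x ∂μHE[n] := (M.isL2Projection_face hT k l hv hF).2
  have hz : q - v.1 ∈ polySpace (n + 1) k := sub_mem hq (polySpace_mono hlk hv.1)
  have hpc := polySpace_continuous hp
  have hgc := polySpace_continuous hg
  have hqc := polySpace_continuous hq
  have hvc := polySpace_continuous hv.1
  have hI : ∀ {f : Space (n + 1) → ℝ}, Continuous f → IntegrableOn f F μHE[n] :=
    fun hf => M.integrableOn_face hT hF hf
  have e1 : ∫ x in F, (v.2 x - v.1 x) ^ 2 ∂μHE[n] = ∫ x in F, (q x - v.1 x) ^ 2 ∂μHE[n] :=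
    setIntegral_congr_fun hm fun x hx => by simp only [hvq hx]
  have e2 : ∫ x in F, M.bdryDifference T k v x ^ 2 ∂μHE[n] = ∫ x in F, g x ^ 2 ∂μHE[n] :=
    setIntegral_congr_fun hm fun x hx => by simp only [M.bdryDifference_eq hF k v hx, hgdef, hpdef]
  have e3 : ∫ x in F, g x * (q x - v.1 x) ∂μHE[n] =
      ∫ x in F, (p x - q x) * (q x - v.1 x) ∂μHE[n] := by
    refine (hproj _ hz).trans ?_
    exact setIntegral_congr_fun hm fun x hx => by simp only [Pi.sub_apply, hvq hx]
  rw [e1, e2]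
  have e4 : (∫ x in F, (q x - v.1 x) ^ 2 ∂μHE[n]) =
      ∫ x in F, (q x - v.1 x) * (p x - v.1 x - g x) ∂μHE[n] := by
    have h5 : (∫ x in F, (q x - v.1 x) * (p x - v.1 x - g x) ∂μHE[n]) =
        (∫ x in F, ((q x - v.1 x) ^ 2 + (p x - q x) * (q x - v.1 x)) ∂μHE[n]) -
          ∫ x in F, g x * (q x - v.1 x) ∂μHE[n] := by
      rw [← integral_sub (hI (by fun_prop)) (hI (by fun_prop))]
      exact integral_congr_ae (Eventually.of_forall fun x => by ring)
    rw [h5, integral_add (hI (by fun_prop)) (hI (by fun_prop)), e3]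
    ring
  have e6 : ∫ x in F, (q x - v.1 x) * (p x - v.1 x - g x) ∂μHE[n] ≤
      ∫ x in F, ((1 / 2) * (q x - v.1 x) ^ 2 + (g x ^ 2 + (p x - v.1 x) ^ 2)) ∂μHE[n] := by
    refine integral_mono (hI (by fun_prop)) (hI (by fun_prop)) fun x => ?_
    nlinarith [sq_nonneg ((q x - v.1 x) - (p x - v.1 x - g x)), sq_nonneg (p x - v.1 x + g x)]
  rw [integral_add (hI (by fun_prop)) (hI (by fun_prop)), integral_const_mul,
    integral_add (hI (by fun_prop)) (hI (by fun_prop))] at e6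
  linarith

end PolytopalMesh

/-! ### Local estimates on a mesh element -/

theorem volume_real_le_of_subset_closedBall {d : ℕ} {T : Set (Space d)} {x₀ : Space d} {h : ℝ}
    (hh : 0 ≤ h) (hT : T ⊆ Metric.closedBall x₀ h) :
    volume.real T ≤ h ^ d * volume.real (Metric.closedBall (0 : Space d) 1) := by
  have h1 : volume.real T ≤ volume.real (Metric.closedBall x₀ h) :=
    measureReal_mono hT measure_closedBall_lt_top.ne
  refine h1.trans (le_of_eq ?_)
  rw [measureReal_def, Measure.addHaar_closedBall' _ _ hh, ENNReal.toReal_mul,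
    ENNReal.toReal_ofReal (by positivity), finrank_euclideanSpace_fin, measureReal_def]

theorem setIntegral_le_const_mul {X : Type*} [MeasurableSpace X] {μ : Measure X} {A : Set X}
    (hA : MeasurableSet A) (hμ : μ A ≠ ⊤) {f : X → ℝ} (hf : IntegrableOn f A μ) {c : ℝ}
    (h : ∀ x ∈ A, f x ≤ c) : ∫ x in A, f x ∂μ ≤ c * μ.real A := by
  have h1 := setIntegral_mono_on hf (integrableOn_const hμ) hA h
  rwa [setIntegral_const, smul_eq_mul, mul_comm] at h1

theorem integral_mul_self_mono_set {d : ℕ} {A T : Set (Space d)} (hT : IsPolytope T) (hA : A ⊆ T)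
    {f : Space d → ℝ} (hf : Continuous f) :
    ∫ x in A, f x * f x ≤ ∫ x in T, f x * f x :=
  setIntegral_mono_set (hT.integrableOn (hf.mul hf))
    (Eventually.of_forall fun _ => mul_self_nonneg _) hA.eventuallyLE

theorem integral_mul_le_young {X : Type*} [MeasurableSpace X] {μ : Measure X} {f g : X → ℝ}
    (hf : Integrable (fun x => f x ^ 2) μ) (hg : Integrable (fun x => g x ^ 2) μ)
    (hfg : Integrable (fun x => f x * g x) μ) {ε : ℝ} (hε : 0 < ε) :
    -∫ x, f x * g x ∂μ ≤ ε * (∫ x, f x ^ 2 ∂μ) + (4 * ε)⁻¹ * ∫ x, g x ^ 2 ∂μ := by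
  rw [← integral_const_mul, ← integral_const_mul, ← integral_neg,
    ← integral_add (hf.const_mul _) (hg.const_mul _)]
  refine integral_mono hfg.neg ((hf.const_mul _).add (hg.const_mul _)) fun x => ?_
  have h1 : ε * f x ^ 2 + (4 * ε)⁻¹ * g x ^ 2 + f x * g x =
      (4 * ε)⁻¹ * (2 * ε * f x + g x) ^ 2 := by
    field_simp
    ring
  have h2 : 0 ≤ (4 * ε)⁻¹ * (2 * ε * f x + g x) ^ 2 := by positivity
  simp only
  linarith

/-- A Poincaré inequality for polynomials. -/
theorem integral_sub_sq_le {d m : ℕ} {r C : ℝ} (hC : 0 < C)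
    (H : ∀ (x₀ : Space d) (h : ℝ), 0 < h → ∀ q ∈ polySpace d m, ∀ x ∈ Metric.closedBall x₀ h,
      q x ^ 2 ≤ C * (h ^ d)⁻¹ * ∫ x in Metric.ball x₀ (r * h), q x * q x)
    {T : Set (Space d)} (hT : IsPolytope T) {x₀ : Space d} {h : ℝ} (hh : 0 < h)
    (hB : Metric.ball x₀ (r * h) ⊆ T) (hTB : T ⊆ Metric.closedBall x₀ h) {p : Space d → ℝ}
    (hp : p ∈ polySpace d m) :
    ∫ x in T, (p x - p x₀) ^ 2 ≤
      volume.real (Metric.closedBall (0 : Space d) 1) * C * h ^ 2 * ∫ x in T, ⟪∇ p x, ∇ p x⟫ := by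
  set G := ∫ x in T, ⟪∇ p x, ∇ p x⟫ with hG
  have hpd : ∀ i, partialDeriv i p ∈ polySpace d m := fun i =>
    polySpace_mono (Nat.sub_le m 1) (partialDeriv_mem_polySpace i hp)
  have hG' : G = ∑ i, ∫ x in T, partialDeriv i p x * partialDeriv i p x := by
    rw [hG, ← integral_finsetSum _ fun i _ => hT.integrableOn
      ((polySpace_continuous (hpd i)).fun_mul (polySpace_continuous (hpd i)))]
    simp only [inner_gradient_gradient]
  have hG0 : 0 ≤ G := integral_nonneg fun _ => real_inner_self_nonneg
  -- The element need not be convex, so the mean value inequality is used on the enclosing ball.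
  -- This is possible because a polynomial gradient is bounded there by its `L²` norm on the small
  -- ball inside `T`.
  have hgrad : ∀ y ∈ Metric.closedBall x₀ h, ‖fderiv ℝ p y‖ ≤ √(C * (h ^ d)⁻¹ * G) := by
    intro y hy
    have e : ‖fderiv ℝ p y‖ = ‖∇ p y‖ := by simp [gradient]
    rw [e]
    refine Real.le_sqrt_of_sq_le ?_
    rw [norm_gradient_sq, hG', Finset.mul_sum]
    refine Finset.sum_le_sum fun i _ => (H x₀ h hh _ (hpd i) y hy).trans ?_
    have := integral_mul_self_mono_set hT hB (polySpace_continuous (hpd i))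
    gcongr
  have hpt : ∀ x ∈ T, (p x - p x₀) ^ 2 ≤ C * (h ^ d)⁻¹ * G * h ^ 2 := by
    intro x hx
    have h1 := (convex_closedBall x₀ h).norm_image_sub_le_of_norm_fderiv_le (𝕜 := ℝ)
      (fun y _ => polySpace_differentiable hp y) hgrad (Metric.mem_closedBall_self hh.le) (hTB hx)
    have h2 : ‖x - x₀‖ ≤ h := by
      rw [← dist_eq_norm]
      exact hTB hx
    rw [← sq_abs, ← Real.norm_eq_abs]
    calc ‖p x - p x₀‖ ^ 2 ≤ (√(C * (h ^ d)⁻¹ * G) * h) ^ 2 := by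
          gcongr
          exact h1.trans (by gcongr)
      _ = _ := by rw [mul_pow, Real.sq_sqrt (by positivity)]
  have hcont : Continuous fun x => (p x - p x₀) ^ 2 :=
    ((polySpace_continuous hp).sub continuous_const).pow 2
  refine (setIntegral_le_const_mul hT.isOpen.measurableSet hT.isBounded.measure_lt_top.ne
    (hT.integrableOn hcont) hpt).trans ?_
  calc C * (h ^ d)⁻¹ * G * h ^ 2 * volume.real T
      ≤ C * (h ^ d)⁻¹ * G * h ^ 2 * (h ^ d * volume.real (Metric.closedBall (0 : Space d) 1)) := by
        gcongr
        exact volume_real_le_of_subset_closedBall hh.le hTB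
    _ = _ := by field_simp

/-! ### Boundary sums and the cell unknown on a mesh element -/

namespace PolytopalMesh

variable {n : ℕ} {Ω : Set (Space (n + 1))}

/-- Faces are disjoint and contained in the boundary, so their total measure is bounded whatever
their number. -/
theorem sum_face_measure_le (M : PolytopalMesh Ω) {T : Set (Space (n + 1))} (hT : T ∈ M.elements)
    {K : ℝ} (hK0 : 0 ≤ K) (hK : μHE[n] (frontier T) ≤ ENNReal.ofReal K) :
    ∑ F ∈ M.facesOf T, (μHE[n] : Measure (Space (n + 1))).real F ≤ K := by
  have h1 : ∑ F ∈ M.facesOf T, (μHE[n] : Measure (Space (n + 1))) F =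
      μHE[n] (⋃ F ∈ M.facesOf T, F) := by
    refine (measure_biUnion_finset (fun F hF F' hF' hne => ?_) fun F hF =>
      (M.isBounded_face hT hF).1.measurableSet).symm
    exact M.faces_disjoint F (M.mem_facesOf.1 hF).1 F' (M.mem_facesOf.1 hF').1 hne
  have h2 : ∑ F ∈ M.facesOf T, (μHE[n] : Measure (Space (n + 1))) F ≤ ENNReal.ofReal K := by
    rw [h1]
    exact (measure_mono (Set.iUnion₂_subset fun F hF => (M.mem_facesOf.1 hF).2)).trans hK
  have h3 : ∀ F ∈ M.facesOf T, (μHE[n] : Measure (Space (n + 1))) F ≠ ⊤ := fun F hF =>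
    (M.isBounded_face hT hF).1.measure_ne_top (M.isBounded_face hT hF).2
  simp only [measureReal_def]
  rw [← ENNReal.toReal_sum h3]
  exact ENNReal.toReal_le_of_le_ofReal hK0 h2

theorem sum_face_integral_le (M : PolytopalMesh Ω) {T : Set (Space (n + 1))} (hT : T ∈ M.elements)
    {K : ℝ} (hK0 : 0 ≤ K) (hK : μHE[n] (frontier T) ≤ ENNReal.ofReal K)
    {f : Set (Space (n + 1)) → Space (n + 1) → ℝ} (hf : ∀ F ∈ M.facesOf T, Continuous (f F)) {c : ℝ}
    (hc : 0 ≤ c) (h : ∀ F ∈ M.facesOf T, ∀ x ∈ F, f F x ≤ c) :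
    ∑ F ∈ M.facesOf T, ∫ x in F, f F x ∂μHE[n] ≤ c * K := by
  calc _ ≤ ∑ F ∈ M.facesOf T, c * (μHE[n] : Measure (Space (n + 1))).real F := by
        refine Finset.sum_le_sum fun F hF => ?_
        obtain ⟨h1, h2⟩ := M.isBounded_face hT hF
        exact setIntegral_le_const_mul h1.measurableSet (h1.measure_ne_top h2)
          (M.integrableOn_face hT hF (hf F hF)) (h F hF)
    _ = c * ∑ F ∈ M.facesOf T, (μHE[n] : Measure (Space (n + 1))).real F :=
        (Finset.mul_sum _ _ _).symm
    _ ≤ c * K := by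
        gcongr
        exact M.sum_face_measure_le hT hK0 hK

/-- Control of the cell unknown by the potential reconstruction and the boundary difference. -/
theorem integral_reconstruction_sub_sq_le (M : PolytopalMesh Ω) (hΩ : IsPolytope Ω)
    {T : Set (Space (n + 1))} (hT : T ∈ M.elements) {l : ℕ} {r C K h : ℝ} {x₀ : Space (n + 1)}
    (hC : 0 < C) (hK : 0 < K) (hh : 0 < h)
    (H : ∀ g ∈ polySpace (n + 1) l, ∃ w ∈ polySpace (n + 1) (l + 2),
      (∀ x, ∑ i, partialDeriv i (partialDeriv i w) x = g x) ∧
      ∀ x ∈ Metric.closedBall x₀ h, ∀ i, partialDeriv i w x ^ 2 ≤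
        C * h ^ 2 * (h ^ (n + 1))⁻¹ * ∫ x in Metric.ball x₀ (r * h), g x * g x)
    (hB : Metric.ball x₀ (r * h) ⊆ T) (hTB : closure T ⊆ Metric.closedBall x₀ h)
    (hfr : μHE[n] (frontier T) ≤ ENNReal.ofReal (K * h ^ n))
    {v : (Space (n + 1) → ℝ) × (Space (n + 1) → ℝ)} (hv : v ∈ M.localSpace T (l + 1) l) (c : ℝ) :
    ∫ x in T, (M.potentialReconstruction T (l + 1) v x - v.1 x) ^ 2 ≤
      6 * (∫ x in T, (M.potentialReconstruction T (l + 1) v x - c) ^ 2) +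
        4 * (K * (n + 1) * C) * h *
          ∑ F ∈ M.facesOf T, ∫ x in F, M.bdryDifference T (l + 1) v x ^ 2 ∂μHE[n] := by
  have hpoly := M.isPolytope_of_mem T hT
  set p := M.potentialReconstruction T (l + 1) v with hpdef
  have hp : p ∈ polySpace (n + 1) (l + 1 + 1) := (M.isPotentialReconstruction hT (l + 1) l hv).1
  have hpc := polySpace_continuous hp
  have hvc := polySpace_continuous hv.1
  have hbm : (fun x => v.1 x - c) ∈ polySpace (n + 1) l :=
    sub_mem hv.1 (const_mem_polySpace (n + 1) l c)
  -- The test function solves `Δw = v_T - c`, so that the error identity pairs `p - v_T` with `v_T -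
  -- c`.
  obtain ⟨w, hw, hwb, hwbd⟩ := H _ hbm
  have hI : ∀ {f : Space (n + 1) → ℝ}, Continuous f → IntegrableOn f T :=
    fun hf => hpoly.integrableOn hf
  set A := ∫ x in T, (p x - c) ^ 2 with hA
  set B := ∫ x in T, (v.1 x - c) ^ 2 with hBdef
  set S := ∑ F ∈ M.facesOf T, ∫ x in F, M.bdryDifference T (l + 1) v x ^ 2 ∂μHE[n] with hS
  set K₂ := K * (n + 1) * C with hK₂
  have hK₂0 : 0 < K₂ := by positivity
  have hB0 : 0 ≤ B := integral_nonneg fun _ => sq_nonneg _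
  have hid := M.integral_sub_mul_laplacian hΩ hT hv hw
  have hlap : ∀ x, Laplacian.laplacian w x = v.1 x - c := fun x => by
    rw [laplacian_eq_sum_partialDeriv (polySpace_contDiff hw), hwb]
  simp only [hlap, ← hpdef] at hid
  have hWn : ∀ F ∈ M.facesOf T, ∀ x ∈ F, ⟪∇ w x, M.normal T F⟫ ^ 2 ≤
      (n + 1) * (C * h ^ 2 * (h ^ (n + 1))⁻¹ * B) := by
    intro F hF x hx
    obtain ⟨hF1, hF2⟩ := M.mem_facesOf.1 hF
    have hxB : x ∈ Metric.closedBall x₀ h := hTB (frontier_subset_closure (hF2 hx))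
    have h1 : ⟪∇ w x, M.normal T F⟫ ^ 2 ≤ ‖∇ w x‖ ^ 2 := by
      rw [← sq_abs]
      have := abs_real_inner_le_norm (∇ w x) (M.normal T F)
      rw [(M.isOuterUnitNormal T hT F hF1 hF2).1, mul_one] at this
      gcongr
    refine h1.trans ?_
    rw [norm_gradient_sq]
    calc ∑ i, partialDeriv i w x ^ 2 ≤ ∑ _i : Fin (n + 1), C * h ^ 2 * (h ^ (n + 1))⁻¹ * B := by
          refine Finset.sum_le_sum fun i _ => (hwbd x hxB i).trans ?_
          have h2 := integral_mul_self_mono_set hpoly hB (hvc.fun_sub (continuous_const (y := c)))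
          have h3 : B = ∫ x in T, (v.1 x - c) * (v.1 x - c) := by simp only [hBdef, sq]
          rw [h3]
          exact mul_le_mul_of_nonneg_left h2 (by positivity)
      _ = _ := by simp
  have hWc : ∀ F, Continuous fun x => ⟪∇ w x, M.normal T F⟫ := fun F =>
    polySpace_continuous (inner_gradient_mem_polySpace hw (M.normal T F))
  have hW : ∑ F ∈ M.facesOf T, ∫ x in F, ⟪∇ w x, M.normal T F⟫ ^ 2 ∂μHE[n] ≤ K₂ * h * B := by
    refine (M.sum_face_integral_le hT (by positivity) hfr (fun F _ => (hWc F).pow 2)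
      (by positivity) hWn).trans (le_of_eq ?_)
    rw [hK₂]
    field_simp
    ring
  -- Young's parameter `K₂ * h` is tuned to the bound `hW`: the term in `∇w·n` then contributes
  -- exactly `B / 4`, which can be absorbed.
  have hδ : -∑ F ∈ M.facesOf T,
      ∫ x in F, M.bdryDifference T (l + 1) v x * ⟪∇ w x, M.normal T F⟫ ∂μHE[n] ≤
      K₂ * h * S + (4 * (K₂ * h))⁻¹ * (K₂ * h * B) := by
    calc _ ≤ ∑ F ∈ M.facesOf T, (K₂ * h * (∫ x in F, M.bdryDifference T (l + 1) v x ^ 2 ∂μHE[n]) +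
          (4 * (K₂ * h))⁻¹ * ∫ x in F, ⟪∇ w x, M.normal T F⟫ ^ 2 ∂μHE[n]) := by
          rw [← Finset.sum_neg_distrib]
          refine Finset.sum_le_sum fun F hF => ?_
          have hm := (M.isBounded_face hT hF).1.measurableSet
          have hgm : faceProjection F (l + 1) (p - v.2) ∈ polySpace (n + 1) (l + 1) :=
            (M.isL2Projection_face hT (l + 1) l hv hF).1
          have hgc := polySpace_continuous hgm
          have heq : Set.EqOn (faceProjection F (l + 1) (p - v.2)) (M.bdryDifference T (l + 1) v) F :=
            fun x hx => (M.bdryDifference_eq hF (l + 1) v hx).symm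
          refine integral_mul_le_young ?_ ((M.integrableOn_face hT hF ((hWc F).pow 2))) ?_
            (by positivity)
          · exact (M.integrableOn_face hT hF (hgc.pow 2)).congr_fun
              (fun x hx => by simp only [Pi.pow_apply, heq hx]) hm
          · exact (M.integrableOn_face hT hF (hgc.fun_mul (hWc F))).congr_fun
              (fun x hx => by simp only [heq hx]) hm
      _ = K₂ * h * S + (4 * (K₂ * h))⁻¹ *
          ∑ F ∈ M.facesOf T, ∫ x in F, ⟪∇ w x, M.normal T F⟫ ^ 2 ∂μHE[n] := by
          rw [Finset.sum_add_distrib, ← Finset.mul_sum, ← Finset.mul_sum]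
      _ ≤ _ := by gcongr
  have hδ' : (4 * (K₂ * h))⁻¹ * (K₂ * h * B) = B / 4 := by field_simp
  rw [hδ', ← hid] at hδ
  have e1 : ∫ x in T, (p x - v.1 x) * (v.1 x - c) = (∫ x in T, (p x - c) * (v.1 x - c)) - B := by
    rw [hBdef, ← integral_sub (hI (by fun_prop)) (hI (by fun_prop))]
    exact integral_congr_ae (Eventually.of_forall fun x => by ring)
  have e2 : ∫ x in T, (p x - c) * (v.1 x - c) ≤ A + B / 4 := by
    have h1 : ∫ x in T, (p x - c) * (v.1 x - c) ≤
        ∫ x in T, ((p x - c) ^ 2 + (1 / 4) * (v.1 x - c) ^ 2) :=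
      integral_mono (hI (by fun_prop)) (hI (by fun_prop)) fun x => by
        nlinarith [sq_nonneg ((p x - c) - (v.1 x - c) / 2)]
    rw [integral_add (hI (by fun_prop)) (hI (by fun_prop)), integral_const_mul] at h1
    linarith
  have e3 : ∫ x in T, (p x - v.1 x) ^ 2 ≤ 2 * A + 2 * B := by
    have h1 : ∫ x in T, (p x - v.1 x) ^ 2 ≤ ∫ x in T, (2 * (p x - c) ^ 2 + 2 * (v.1 x - c) ^ 2) :=
      integral_mono (hI (by fun_prop)) (hI (by fun_prop)) fun x => by
        nlinarith [sq_nonneg ((p x - c) + (v.1 x - c))]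
    rwa [integral_add (hI (by fun_prop)) (hI (by fun_prop)), integral_const_mul,
      integral_const_mul] at h1
  -- By `e1`, `B` is the pairing of `p - c` with `v_T - c` minus that of `p - v_T` with `v_T - c`.
  -- Each of the two leaves `B / 4` on the right, and half of `B` remains on the left.
  have e4 : B ≤ 2 * A + 2 * K₂ * h * S := by linarith
  linarith

end PolytopalMesh

/-- Coercivity, written out with integrals. -/
theorem exists_boundary_sq_le (n : ℕ) (hn : n ≠ 0) {Ω : Set (Space (n + 1))} (hΩ : IsPolytope Ω)
    {ϱ : ℝ} (hϱ : 0 < ϱ) (l : ℕ) :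
    ∃ C : ℝ, 0 < C ∧ ∀ M : PolytopalMesh Ω, M.IsRegular ϱ → ∀ T ∈ M.elements,
      ∀ v ∈ M.localSpace T (l + 1) l,
        (Metric.diam T)⁻¹ * ∑ F ∈ M.facesOf T, ∫ x in F, (v.2 x - v.1 x) ^ 2 ∂μHE[n] ≤
          C * ((∫ x in T, ⟪∇ (M.potentialReconstruction T (l + 1) v) x,
            ∇ (M.potentialReconstruction T (l + 1) v) x⟫) + (Metric.diam T)⁻¹ *
            ∑ F ∈ M.facesOf T, ∫ x in F, M.bdryDifference T (l + 1) v x ^ 2 ∂μHE[n]) := by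
  obtain ⟨K, hK, HK⟩ := exists_frontier_measure_le n hn hϱ
  obtain ⟨C₁, hC₁, H₁⟩ := exists_sq_le_integral (n + 1) (l + 2) hϱ
  obtain ⟨C₂, hC₂, H₂⟩ := exists_laplacian_eq_scaled n l hϱ
  set V := volume.real (Metric.closedBall (0 : Space (n + 1)) 1) with hV
  have hV0 : 0 ≤ V := measureReal_nonneg
  set K₂ := K * (n + 1) * C₂ with hK₂
  have hK₂0 : 0 < K₂ := by positivity
  -- The first group is the final coefficient of `h⁻¹ * S`, the last term that of `G`; their sum
  -- dominates both.
  refine ⟨(2 + 8 * K * C₁ * K₂) + 12 * K * C₁ * V * C₁, by positivity, ?_⟩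
  intro M hM T hT v hv
  have hpoly := M.isPolytope_of_mem T hT
  set h := Metric.diam T with hhdef
  set p := M.potentialReconstruction T (l + 1) v with hpdef
  have hp : p ∈ polySpace (n + 1) (l + 2) := (M.isPotentialReconstruction hT (l + 1) l hv).1
  have hstar := hM.1 T hT
  obtain ⟨x₀, hB⟩ := hstar.exists_ball_subset hpoly.isOpen hpoly.1.nonempty
  have hh : 0 < h := by
    obtain ⟨x, hx⟩ := hpoly.1.nonempty
    refine lt_of_le_of_ne Metric.diam_nonneg fun h0 => ?_
    have hsub : T ⊆ {x} := fun y hy => by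
      have := Metric.dist_le_diam_of_mem hpoly.isBounded hy hx
      rw [← hhdef, ← h0] at this
      exact dist_le_zero.1 this
    have h1 := hpoly.isOpen.measure_pos volume ⟨x, hx⟩
    have h2 := measure_mono_null hsub (measure_singleton (μ := volume) x)
    exact h1.ne' h2
  have hx₀ : x₀ ∈ T := hB (Metric.mem_ball_self (by positivity))
  have hTB' : closure T ⊆ Metric.closedBall x₀ h :=
    closure_minimal (fun y hy => Metric.dist_le_diam_of_mem hpoly.isBounded hy hx₀)
      Metric.isClosed_closedBall
  have hTB : T ⊆ Metric.closedBall x₀ h := subset_closure.trans hTB'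
  have hfr := HK T hstar hpoly.isOpen hpoly.isBounded hpoly.1.nonempty
  set G := ∫ x in T, ⟪∇ p x, ∇ p x⟫ with hG
  set S := ∑ F ∈ M.facesOf T, ∫ x in F, M.bdryDifference T (l + 1) v x ^ 2 ∂μHE[n] with hS
  set E := ∫ x in T, (p x - v.1 x) ^ 2 with hE
  have hG0 : 0 ≤ G := integral_nonneg fun _ => real_inner_self_nonneg
  have hS0 : 0 ≤ S := Finset.sum_nonneg fun F _ => integral_nonneg fun _ => sq_nonneg _
  have hE0 : 0 ≤ E := integral_nonneg fun _ => sq_nonneg _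
  have hA := integral_sub_sq_le hC₁ H₁ hpoly hh hB hTB hp
  have hE1 : E ≤ 6 * (V * C₁ * h ^ 2 * G) + 4 * K₂ * h * S := by
    have := M.integral_reconstruction_sub_sq_le hΩ hT hC₂ hK hh (H₂ x₀ h hh) hB hTB' hfr hv (p x₀)
    refine this.trans ?_
    gcongr
  have hsubm : (fun x => p x - v.1 x) ∈ polySpace (n + 1) (l + 2) :=
    sub_mem hp (polySpace_mono (by omega) hv.1)
  -- Discrete trace inequality: the pointwise bound of order `h^(-(n+1)) E` times the boundary
  -- measure of order `h^n`.
  have htr : ∑ F ∈ M.facesOf T, ∫ x in F, (p x - v.1 x) ^ 2 ∂μHE[n] ≤ K * C₁ * h⁻¹ * E := by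
    refine (M.sum_face_integral_le hT (f := fun _ x => (p x - v.1 x) ^ 2)
      (c := C₁ * (h ^ (n + 1))⁻¹ * E) (by positivity) hfr
      (fun F _ => (polySpace_continuous hsubm).pow 2) (by positivity) fun F hF x hx => ?_).trans
      (le_of_eq ?_)
    · refine (H₁ x₀ h hh _ hsubm x (hTB' (frontier_subset_closure
        ((M.mem_facesOf.1 hF).2 hx)))).trans ?_
      have h1 := integral_mul_self_mono_set hpoly hB (polySpace_continuous hsubm)
      simp only [← sq] at h1 ⊢
      gcongr
    · rw [← hhdef]
      field_simp
      ring
  have hface : ∑ F ∈ M.facesOf T, ∫ x in F, (v.2 x - v.1 x) ^ 2 ∂μHE[n] ≤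
      2 * S + 2 * (K * C₁ * h⁻¹ * E) := by
    calc _ ≤ ∑ F ∈ M.facesOf T,
          (2 * (∫ x in F, M.bdryDifference T (l + 1) v x ^ 2 ∂μHE[n]) +
            2 * ∫ x in F, (p x - v.1 x) ^ 2 ∂μHE[n]) :=
          Finset.sum_le_sum fun F hF => M.setIntegral_face_sq_le hT hF (by omega) hv
      _ = 2 * S + 2 * ∑ F ∈ M.facesOf T, ∫ x in F, (p x - v.1 x) ^ 2 ∂μHE[n] := by
          rw [Finset.sum_add_distrib, ← Finset.mul_sum, ← Finset.mul_sum]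
      _ ≤ _ := by gcongr
  have hhS : 0 ≤ h⁻¹ * S := by positivity
  calc _ ≤ h⁻¹ * (2 * S + 2 * (K * C₁ * h⁻¹ * (6 * (V * C₁ * h ^ 2 * G) + 4 * K₂ * h * S))) := by
        gcongr
        exact hface.trans (by gcongr)
    _ = (2 + 8 * K * C₁ * K₂) * (h⁻¹ * S) + 12 * K * C₁ * V * C₁ * G := by
        field_simp
        ring
    _ ≤ _ := by
        have h1 : 0 ≤ (2 + 8 * K * C₁ * K₂) * G := by positivity
        have h2 : 0 ≤ 12 * K * C₁ * V * C₁ * (h⁻¹ * S) := by positivity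
        linarith

end HHO

/-! ### Coercivity in terms of the seminorm and the bilinear form -/

theorem mainTheorem10 (d : ℕ) (hd : 2 ≤ d) (Ω : Set (HHO.Space d)) (hΩ : HHO.IsPolytope Ω)
    (ϱ : ℝ) (hϱ : 0 < ϱ) (k l : ℕ) (hkl : k = l + 1) :
    ∃ C : ℝ, 0 < C ∧
      ∀ M : HHO.PolytopalMesh Ω, M.IsRegular ϱ →
        ∀ T ∈ M.elements, ∀ v ∈ M.localSpace T k l,
          M.localSeminorm T v ^ 2 ≤ C * M.localForm T k (M.bdryStabilisation T k) v v := by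
  subst hkl
  -- Faces then have dimension `n`, to which `d - 1` reduces by definition, and `2 ≤ d` supplies the
  -- `n ≠ 0` that makes points null on faces.
  obtain ⟨n, rfl⟩ : ∃ n, d = n + 1 := ⟨d - 1, by omega⟩
  obtain ⟨C, hC, H⟩ := HHO.exists_boundary_sq_le n (by omega) hΩ hϱ l
  refine ⟨C, hC, fun M hM T hT v hv => ?_⟩
  have h1 := H M hM T hT v hv
  have hin : ∀ f, M.bdryInner T f f = ∑ F ∈ M.facesOf T, ∫ x in F, f x ^ 2 ∂μHE[n] := fun f => by
    simp only [HHO.PolytopalMesh.bdryInner, ← sq]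
    rfl
  have hin0 : ∀ f, 0 ≤ M.bdryInner T f f := fun f => by
    rw [hin]
    exact Finset.sum_nonneg fun F _ => integral_nonneg fun _ => sq_nonneg _
  have e1 : M.localSeminorm T v ^ 2 =
      (Metric.diam T)⁻¹ * ∑ F ∈ M.facesOf T, ∫ x in F, (v.2 x - v.1 x) ^ 2 ∂μHE[n] := by
    rw [HHO.PolytopalMesh.localSeminorm, mul_pow, HHO.PolytopalMesh.bdryNorm,
      Real.sq_sqrt (hin0 _), hin, ← Real.rpow_natCast, ← Real.rpow_mul Metric.diam_nonneg]
    norm_num [Real.rpow_neg_one]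
  rw [e1]
  refine h1.trans (le_of_eq ?_)
  rw [HHO.PolytopalMesh.localForm, HHO.PolytopalMesh.bdryStabilisation, hin]
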